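/- Let $k$ be an algebraically closed field of characteristic $0$. For an odd hyperelliptic curve $B$ of genus $\gamma\ge 2$, i.e. the smooth projective curve with affine equation $y^2+h(x)y=f(x)$, where $\deg h\le\gamma$, $f$ is monic of degree $2\gamma+1$ and $h^2+4f$ is separable, let $q$ be its point at infinity. Let $\Theta_d\subset \mathrm{Jac}(B)$ be the set of classes $[p_1+\cdots+p_d-dq]$ with $p_i\in B$, and put $\Theta^0_d=\Theta_d\setminus\Theta_{d-1}$ (with $\Theta_{-1}=\emptyset$). The multiplication profile of $x\in\mathrm{Jac}(B)$ is the sequence $(\epsilon_j)_{j\ge1}$ with $jx\in\Theta^0_{\epsilon_j}$ for all $j\ge 1$. For $N\in\{2\gamma+7,2\gamma+9\}$, the profile of order $N$ determined by $(\epsilon_{\gamma+2},\dots,\epsilon_{(N-1)/2})$ is the $N$-periodic sequence with $\epsilon_N=0$, $\epsilon_{N-j}=\epsilon_j$ for $1\le j<N$, $\epsilon_j=j$ for $1\le j\le\gamma$, $\epsilon_{\gamma+1}=\gamma$, and the given values of $\epsilon_{\gamma+2},\dots,\epsilon_{(N-1)/2}$. Define $\theta_1=\phi_1=1$ and, for $r\ge1$,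 $\theta_{r+1}=(x+2)\theta_r+2(x+1)\phi_r$ and $\phi_{r+1}=2\theta_r+(x+2)\phi_r$. Let $p=(0,0)$. 1. If $\gamma\ge3$, the equation $y^2+\phi_4(x)y-\theta_4(x)x^\gamma=x^{2\gamma+1}+x^{2\gamma}$ defines an odd hyperelliptic curve of genus $\gamma$ on which $[p-q]$ has order exactly $2\gamma+7$, with the profile determined by $(\epsilon_{\gamma+2},\epsilon_{\gamma+3})=(\gamma,\gamma)$. 2. If $\gamma\ge4$, the equation $y^2+\phi_5(x)y-\theta_5(x)x^\gamma=x^{2\gamma+1}+x^{2\gamma}$ defines an odd hyperelliptic curve of genus $\gamma$ on which $[p-q]$ has order exactly $2\gamma+9$, with the profile determined by $(\epsilon_{\gamma+2},\epsilon_{\gamma+3},\epsilon_{\gamma+4})=(\gamma,\gamma,\gamma)$. 3. If $\gamma\ge4$, the equation $y^2+(x^3+4)y=x^{2\gamma+1}+x^{2\gamma-2}-(3x^3+4)x^{\gamma-1}$ defines an odd hyperelliptic curve of genus $\gamma$ on which the function $(3x^3+4)x^{\gamma-1}+(x^3+4)y$ has divisor $(2\gamma+7)(p-q)$ and $[p-q]$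 has order exactly $2\gamma+7$, with the profile determined by $(\epsilon_{\gamma+2},\epsilon_{\gamma+3})=(\gamma-1,\gamma)$. -/

import Mathlib

open Polynomial

/-- The (closed) points of the smooth projective curve over `k` with function field `K`: the discrete
valuation rings of `K` that contain `k`. -/
@[ext]
structure CurvePoint (k K : Type*) [Field k] [Field K] [Algebra k K] where
  ring : ValuationSubring K
  algebraMap_mem : ∀ c : k, algebraMap k K c ∈ ring
  isDVR : IsDiscreteValuationRing ring

namespace CurvePoint

variable {k K : Type*} [Field k] [Field K] [Algebra k K]

instance (v : CurvePoint k K) : IsDiscreteValuationRing v.ring := v.isDVR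

/-- The order of vanishing at `v` of a nonzero rational function `g`. -/
noncomputable def ord (v : CurvePoint k K) (g : K) : ℤ :=
  -WithZero.log ((IsDiscreteValuationRing.maximalIdeal v.ring).valuation K g)

theorem ord_one (v : CurvePoint k K) : v.ord 1 = 0 := by simp [ord]

theorem ord_mul (v : CurvePoint k K) {g₁ g₂ : K} (h₁ : g₁ ≠ 0) (h₂ : g₂ ≠ 0) :
    v.ord (g₁ * g₂) = v.ord g₁ + v.ord g₂ := by
  rw [ord, map_mul, WithZero.log_mul (by simpa using h₁) (by simpa using h₂), neg_add]; rfl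

theorem ord_inv (v : CurvePoint k K) (g : K) : v.ord g⁻¹ = -v.ord g := by
  simp [ord, WithZero.log_inv]

end CurvePoint

/-- Divisors on the smooth projective curve over `k` with function field `K`. -/
abbrev CurveDivisor (k K : Type*) [Field k] [Field K] [Algebra k K] : Type _ :=
  CurvePoint k K →₀ ℤ

section Jacobian

variable (k K : Type*) [Field k] [Field K] [Algebra k K]

/-- `D` is the divisor of the rational function `g`. -/
def IsDivisorOf {k K : Type*} [Field k] [Field K] [Algebra k K] (D : CurveDivisor k K) (g : K) :
    Prop :=
  g ≠ 0 ∧ ∀ v : CurvePoint k K, D v = v.ord g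

/-- The group of divisors of degree zero; all points have degree one, as `k` is meant to be
algebraically closed. -/
noncomputable def degreeZeroDivisors : AddSubgroup (CurveDivisor k K) :=
  (Finsupp.degree : CurveDivisor k K →+ ℤ).ker

/-- The group of principal divisors. -/
def principalDivisors : AddSubgroup (CurveDivisor k K) where
  carrier := {D | ∃ g : K, IsDivisorOf D g}
  zero_mem' := ⟨1, one_ne_zero, fun v => by simp [v.ord_one]⟩
  add_mem' := by
    rintro D₁ D₂ ⟨g₁, h₁, e₁⟩ ⟨g₂, h₂, e₂⟩
    exact ⟨g₁ * g₂, mul_ne_zero h₁ h₂, fun v => by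
      rw [Finsupp.add_apply, e₁, e₂, v.ord_mul h₁ h₂]⟩
  neg_mem' := by
    rintro D ⟨g, h, e⟩
    exact ⟨g⁻¹, inv_ne_zero h, fun v => by rw [Finsupp.neg_apply, e, v.ord_inv]⟩

/-- The group of points of the Jacobian: divisors of degree zero modulo principal divisors. -/
abbrev CurveJacobian : Type _ :=
  degreeZeroDivisors k K ⧸ (principalDivisors k K).addSubgroupOf (degreeZeroDivisors k K)

variable {k K}

/-- The class `[p - q]`. -/
noncomputable def pointClass (p q : CurvePoint k K) : CurveJacobian k K :=
  QuotientAddGroup.mk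
    ⟨Finsupp.single p 1 - Finsupp.single q 1, by simp [degreeZeroDivisors, AddMonoidHom.mem_ker]⟩

/-- `Θ_d`, the image of the Abel-Jacobi map
`B^d → Jac(B), (p₁, …, p_d) ↦ [p₁ + ⋯ + p_d - d q]`. -/
def Theta (q : CurvePoint k K) (d : ℕ) : Set (CurveJacobian k K) :=
  Set.range fun p : Fin d → CurvePoint k K => ∑ i, pointClass (p i) q

/-- `Θ⁰_d = Θ_d \ Θ_{d-1}`, where `Θ_{-1} = ∅`. -/
def ThetaStrict (q : CurvePoint k K) : ℕ → Set (CurveJacobian k K)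
  | 0 => Theta q 0
  | d + 1 => Theta q (d + 1) \ Theta q d

/-- `(ε₁, ε₂, …)` is the multiplication profile of `x`: `j x ∈ Θ⁰_{ε_j}` for all `j ≥ 1`. -/
def IsMultiplicationProfile (q : CurvePoint k K) (x : CurveJacobian k K) (ε : ℕ → ℕ) : Prop :=
  ∀ j : ℕ, 1 ≤ j → j • x ∈ ThetaStrict q (ε j)

end Jacobian

/-- An odd-degree hyperelliptic equation `y² + h(x) y = f(x)` of genus `genus ≥ 2`, over a field of
characteristic zero: `deg h ≤ genus`, `f` is monic of degree `2 * genus + 1`, and the affine curve is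
nonsingular, i.e. the discriminant `h² + 4 f` has no multiple root. -/
structure HyperellipticCurve (k : Type*) [Field k] [CharZero k] where
  genus : ℕ
  h : k[X]
  f : k[X]
  two_le_genus : 2 ≤ genus
  natDegree_h_le : h.natDegree ≤ genus
  monic_f : f.Monic
  natDegree_f : f.natDegree = 2 * genus + 1
  separable_disc : (h ^ 2 + 4 * f).Separable

namespace HyperellipticCurve

variable {k : Type*} [Field k] [CharZero k] (B : HyperellipticCurve k)

/-- The polynomial `Y² + h Y - f` in `k[x][Y]`. -/
noncomputable def equation : k[X][X] := X ^ 2 + C B.h * X - C B.f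

theorem equation_eq : B.equation = X ^ 2 + C B.h * X + C (-B.f) := by
  rw [equation, C_neg, sub_eq_add_neg]

theorem monic_equation : B.equation.Monic := by
  rw [equation_eq]; monicity!

theorem natDegree_equation : B.equation.natDegree = 2 := by
  rw [equation_eq]; compute_degree!

theorem irreducible_equation : Irreducible B.equation := by
  have hf := B.natDegree_f
  have hh := B.natDegree_h_le
  rw [B.monic_equation.irreducible_iff_natDegree']
  refine ⟨fun h1 => by simpa [h1] using B.natDegree_equation, ?_⟩
  rintro a b ha hb hab hdeg
  rw [B.natDegree_equation] at hdeg
  have hb1 : b.natDegree = 1 := by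
    simp only [Finset.mem_Ioc] at hdeg; omega
  have ha1 : a.natDegree = 1 := by
    have := B.natDegree_equation
    rw [← hab, ha.natDegree_mul hb] at this; omega
  rw [ha.eq_X_add_C ha1, hb.eq_X_add_C hb1] at hab
  generalize a.coeff 0 = u at hab
  generalize b.coeff 0 = v at hab
  have e : X ^ 2 + C (u + v) * X + C (u * v) = X ^ 2 + C B.h * X + C (-B.f) := by
    rw [← equation_eq, ← hab, C_add, C_mul]; ring
  have e0 : u * v = -B.f := by simpa using congrArg (fun p : k[X][X] => p.coeff 0) e
  have e1 : u + v = B.h := by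
    simpa [coeff_X, coeff_C] using congrArg (fun p : k[X][X] => p.coeff 1) e
  have huv : u * v ≠ 0 := by
    rw [e0]; exact neg_ne_zero.mpr B.monic_f.ne_zero
  have hd : u.natDegree + v.natDegree = 2 * B.genus + 1 := by
    rw [← natDegree_mul (left_ne_zero_of_mul huv) (right_ne_zero_of_mul huv), e0, natDegree_neg, hf]
  rw [← e1] at hh
  rcases lt_or_gt_of_ne (show u.natDegree ≠ v.natDegree by omega) with hlt | hlt
  · rw [natDegree_add_eq_right_of_natDegree_lt hlt] at hh; omega
  · rw [natDegree_add_eq_left_of_natDegree_lt hlt] at hh; omega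

/-- The ring `k[x, y] / (y² + h y - f)` of regular functions on the affine curve. -/
abbrev CoordinateRing : Type _ := AdjoinRoot B.equation

instance : IsDomain B.CoordinateRing :=
  AdjoinRoot.isDomain_of_prime B.irreducible_equation.prime

/-- The function field of the curve. -/
def FunctionField : Type _ := FractionRing B.CoordinateRing

noncomputable instance : Field B.FunctionField :=
  inferInstanceAs (Field (FractionRing B.CoordinateRing))

noncomputable instance : Algebra B.CoordinateRing B.FunctionField :=
  inferInstanceAs (Algebra B.CoordinateRing (FractionRing B.CoordinateRing))

instance : IsFractionRing B.CoordinateRing B.FunctionField :=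
  inferInstanceAs (IsFractionRing B.CoordinateRing (FractionRing B.CoordinateRing))

noncomputable instance : Algebra k B.FunctionField :=
  inferInstanceAs (Algebra k (FractionRing B.CoordinateRing))

instance : IsScalarTower k B.CoordinateRing B.FunctionField :=
  inferInstanceAs (IsScalarTower k B.CoordinateRing (FractionRing B.CoordinateRing))

/-- The coordinate function `x`. -/
noncomputable def x : B.FunctionField :=
  algebraMap B.CoordinateRing B.FunctionField (AdjoinRoot.of B.equation X)

/-- The coordinate function `y`. -/
noncomputable def y : B.FunctionField :=
  algebraMap B.CoordinateRing B.FunctionField (AdjoinRoot.root B.equation)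

/-- The points of the smooth projective curve. -/
abbrev Point : Type _ := CurvePoint k B.FunctionField

/-- `p` is the point of the curve with affine coordinates `(a, b)`: the only point at which the
functions `x - a` and `y - b` both vanish. -/
def IsAffinePoint (p : B.Point) (a b : k) : Prop :=
  ∀ v : B.Point,
    (v.ring.valuation (B.x - algebraMap k B.FunctionField a) < 1 ∧
      v.ring.valuation (B.y - algebraMap k B.FunctionField b) < 1) ↔ v = p

/-- `q` is the point of the curve over `x = ∞`: the only pole of `x`. -/
def IsPointAtInfinity (q : B.Point) : Prop :=
  ∀ v : B.Point, B.x ∉ v.ring ↔ v = q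

end HyperellipticCurve

/-- The `N`-periodic sequence with `ε_{N - j} = ε_j` for `0 ≤ j ≤ N` whose values for `j ≤ N / 2` are
`ε_j = j` if `j ≤ γ`, `ε_{γ + 1} = γ`, and `(ε_{γ + 2}, ε_{γ + 3}, …) = c`. -/
def profileDeterminedBy (γ N : ℕ) (c : List ℕ) (j : ℕ) : ℕ :=
  let i := min (j % N) (N - j % N)
  if i ≤ γ then i else if i = γ + 1 then γ else c.getD (i - (γ + 2)) 0

/-- The pairs `(θ_r, φ_r)` of Flynn's polynomials, for `r ≥ 1`; the value at `r = 0` is not used. -/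
noncomputable def flynnPair (k : Type*) [Field k] : ℕ → k[X] × k[X]
  | 0 => (1, 1)
  | 1 => (1, 1)
  | r + 2 =>
    ((X + 2) * (flynnPair k (r + 1)).1 + 2 * (X + 1) * (flynnPair k (r + 1)).2,
      2 * (flynnPair k (r + 1)).1 + (X + 2) * (flynnPair k (r + 1)).2)

/-- Flynn's polynomial `θ_r`. -/
noncomputable def flynnTheta (k : Type*) [Field k] (r : ℕ) : k[X] := (flynnPair k r).1

/-- Flynn's polynomial `φ_r`. -/
noncomputable def flynnPhi (k : Type*) [Field k] (r : ℕ) : k[X] := (flynnPair k r).2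

/-- `B` is the curve `y² + (φ_r(x) y - θ_r(x) x^γ) w(x) = x^(2γ+1) + x^(2γ)`, of genus `γ`. -/
def IsFlynnCurve {k : Type*} [Field k] [CharZero k] (B : HyperellipticCurve k) (γ r : ℕ)
    (w : k[X]) : Prop :=
  B.genus = γ ∧ B.h = flynnPhi k r * w ∧
    B.f = flynnTheta k r * X ^ γ * w + X ^ (2 * γ + 1) + X ^ (2 * γ)

/-- `B` is the curve `y² + (x³ + 4) y = x^(2γ+1) + x^(2γ-2) - (3x³ + 4) x^(γ-1)`, of genus `γ`. -/
def IsVariantCurve {k : Type*} [Field k] [CharZero k] (B : HyperellipticCurve k) (γ : ℕ) : Prop :=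
  B.genus = γ ∧ B.h = X ^ 3 + 4 ∧
    B.f = X ^ (2 * γ + 1) + X ^ (2 * γ - 2) - (3 * X ^ 3 + 4) * X ^ (γ - 1)

/-! All three curves have the shape `f = θ x^m + s x^(2m)` with `θ² - s h² = -x^n` and `h(0) ≠ 0`
(`TorsionPresentation`). The function `g = h y - θ x^m` then has norm `-x^(2m+n)` over `k[x]`, so
its zeros lie over `x = 0`. At the conjugate `(0, -h(0))` of `p` it takes the value `-h(0)² ≠ 0`, so
its divisor is `(2m+n)(p - q)`. For Flynn's polynomials `s = x + 1`, and the norm identity comes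
from `θ_r + φ_r w = (1 + w)^(2r-1)` with `w² = x + 1`, because `1 + w` has norm `-x`. The third
curve is the case `r = 2` in the variable `x³`.

The profile reduces to linear algebra. As `Θ_d` is stable under negation, `j[p - q] ∈ Θ_d` means
that some nonzero `a(x) + b(x) y` has a pole of order at most `d + j` at `q` and vanishes to order
at least `j` at `p` (`smul_mem_Theta_iff_exists_fn`). Pole orders can be read off degrees, since `x`
and `y` have poles of orders `2` and `2γ+1`, of opposite parity. For `j ≤ 2m+n`, working modulo `g`
replaces `y` by `θ x^m / h`, and the vanishing condition becomes `x^j ∣ a h + b θ x^m`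
(`smul_mem_Theta_iff`). When `d + j ≤ 2γ` this forces `b = 0` and then `x^j ∣ a`. For the other `j ≥
m`, dividing by `x^m` leaves a Padé problem: `-a/b` must agree with `θ/h`, which is `√(1+x)` or
`-√(1+x³)` modulo `x^n`, to order `j - m` (`mem_Theta`, `notMem_Theta`). Periodicity and `j ↦ N - j`
give the remaining values, and their being nonzero for `0 < j < N` gives the exact order.

Smoothness is the other difficulty. After `x = -t²` the discriminant factors as `A(t) A(-t)`. The
factors are coprime by a one-line elimination, and `A` has no double root by reduction at a place
above `2`, which works for all `γ` at once (`separable_flynn_aux`, `separable_variant`).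

Points are valuation rings, so the geometry used above is also proved: the points over affine
solutions and over infinity, degree zero of principal divisors, and that functions regular away from
`q` are of the form `a(x) + b(x) y`. -/

/-! ### Discrete valuation rings and their order functions -/

/-- Every nonzero element is a unit times a power of `π`, so the factorization criterion for
discrete valuation rings applies. It serves for valuation rings obtained from extension theorems,
about which nothing like noetherianity is known in advance. -/
theorem ValuationSubring.isDiscreteValuationRing_of_valuation_eq_zpow {K : Type*} [Field K]
    (O : ValuationSubring K) {π : K} (h0 : π ≠ 0) (h1 : O.valuation π < 1)
    (h : ∀ g : K, g ≠ 0 → ∃ n : ℤ, O.valuation g = O.valuation π ^ n) :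
    IsDiscreteValuationRing O := by
  have hπ : π ∈ O := (O.valuation_le_one_iff π).1 h1.le
  have hpos : 0 < O.valuation π := by simpa [zero_lt_iff] using h0
  have hlt : ∀ n : ℤ, O.valuation π ^ n ≤ 1 ↔ 0 ≤ n := fun n =>
    zpow_le_one_iff_right_of_lt_one₀ hpos h1
  have hunit : ∀ g : O, IsUnit g ↔ O.valuation (g : K) = 1 := fun g =>
    O.valuation_eq_one_iff g
  apply IsDiscreteValuationRing.ofHasUnitMulPowIrreducibleFactorization
  refine ⟨⟨π, hπ⟩, ⟨?_, ?_⟩, ?_⟩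
  · rw [hunit]; exact h1.ne
  · rintro a b hab
    have hab' : π = (a : K) * b := congrArg Subtype.val hab
    have ha : (a : K) ≠ 0 := by rintro e; simp [e] at hab'; exact h0 hab'
    have hb : (b : K) ≠ 0 := by rintro e; simp [e] at hab'; exact h0 hab'
    obtain ⟨n, hn⟩ := h a ha
    obtain ⟨m, hm⟩ := h b hb
    have hn0 : 0 ≤ n := by rw [← hlt, ← hn]; exact O.valuation_le_one a
    have hm0 : 0 ≤ m := by rw [← hlt, ← hm]; exact O.valuation_le_one b
    have hsum : O.valuation π ^ (1 : ℤ) = O.valuation π ^ (n + m) := by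
      rw [zpow_add₀ hpos.ne', ← hn, ← hm, ← map_mul, ← hab', zpow_one]
    have hs : (1 : ℤ) = n + m := zpow_right_injective₀ hpos h1.ne hsum
    rw [hunit, hunit, hn, hm]
    rcases (by omega : n = 0 ∨ m = 0) with rfl | rfl
    · left; simp
    · right; simp
  · intro g hg
    have hg' : (g : K) ≠ 0 := by simpa using hg
    obtain ⟨n, hn⟩ := h g hg'
    have hn0 : 0 ≤ n := by rw [← hlt, ← hn]; exact O.valuation_le_one g
    lift n to ℕ using hn0
    have hq : O.valuation ((g : K) / π ^ n) = 1 := by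
      rw [map_div₀, hn, map_pow, zpow_natCast, div_self (pow_ne_zero _ hpos.ne')]
    have hmem : (g : K) / π ^ n ∈ O := (O.valuation_le_one_iff _).1 hq.le
    have hu : IsUnit (⟨(g : K) / π ^ n, hmem⟩ : O) := (hunit _).2 hq
    refine ⟨n, hu.unit, ?_⟩
    apply Subtype.ext
    simp only [IsUnit.unit_spec, MulMemClass.coe_mul, SubmonoidClass.mk_pow]
    field_simp

namespace CurvePoint

variable {k K : Type*} [Field k] [Field K] [Algebra k K] (v : CurvePoint k K)

theorem ord_nonneg_of_mem {g : K} (hg : g ∈ v.ring) : 0 ≤ v.ord g := by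
  have h := (IsDiscreteValuationRing.maximalIdeal v.ring).valuation_le_one (K := K)
    (⟨g, hg⟩ : v.ring)
  change (IsDiscreteValuationRing.maximalIdeal v.ring).valuation K g ≤ 1 at h
  rw [ord, Left.nonneg_neg_iff]
  by_cases h0 : g = 0
  · simp [h0]
  · rw [WithZero.log_le_iff_le_exp (by simpa using h0)]
    simpa using h

theorem ord_pos_of_valuation_lt_one {g : K} (h0 : g ≠ 0) (hg : v.ring.valuation g < 1) :
    0 < v.ord g := by
  have hmem : g ∈ v.ring := (v.ring.valuation_le_one_iff g).1 hg.le
  have h := ((IsDiscreteValuationRing.maximalIdeal v.ring).valuation_lt_one_iff_mem (K := K)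
    (⟨g, hmem⟩ : v.ring)).2
      ((v.ring.valuation_lt_one_iff (⟨g, hmem⟩ : v.ring)).2 hg)
  change (IsDiscreteValuationRing.maximalIdeal v.ring).valuation K g < 1 at h
  rw [ord, Left.neg_pos_iff]
  rw [WithZero.log_lt_iff_lt_exp (by simpa using h0)]
  simpa using h

theorem ord_nonneg_iff {g : K} (h0 : g ≠ 0) : 0 ≤ v.ord g ↔ g ∈ v.ring := by
  refine ⟨fun h => ?_, v.ord_nonneg_of_mem⟩
  by_contra hg
  have h1 : v.ring.valuation g⁻¹ < 1 := by
    rw [map_inv₀]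
    apply inv_lt_one_of_one_lt₀
    rwa [← not_le, v.ring.valuation_le_one_iff]
  have := v.ord_pos_of_valuation_lt_one (inv_ne_zero h0) h1
  rw [ord_inv] at this
  omega

theorem ord_pos_iff {g : K} (h0 : g ≠ 0) : 0 < v.ord g ↔ v.ring.valuation g < 1 := by
  refine ⟨fun h => ?_, v.ord_pos_of_valuation_lt_one h0⟩
  by_contra hg
  have h1 : g⁻¹ ∈ v.ring := by
    rw [← v.ring.valuation_le_one_iff, map_inv₀]
    exact inv_le_one_of_one_le₀ (not_lt.1 hg)
  have := v.ord_nonneg_of_mem h1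
  rw [ord_inv] at this
  omega

theorem ord_eq_zero_iff {g : K} (h0 : g ≠ 0) : v.ord g = 0 ↔ v.ring.valuation g = 1 := by
  have h1 := v.ord_nonneg_iff h0
  have h2 := v.ord_pos_iff h0
  rw [← v.ring.valuation_le_one_iff] at h1
  constructor
  · intro h
    exact le_antisymm (h1.1 h.ge) (not_lt.1 fun h' => by have := h2.2 h'; omega)
  · intro h
    have a := h1.2 h.le
    have b : ¬ 0 < v.ord g := fun h' => by have := h2.1 h'; simp [h] at this
    omega

theorem ord_pow {g : K} (h0 : g ≠ 0) (n : ℕ) : v.ord (g ^ n) = n * v.ord g := by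
  induction n with
  | zero => simp [ord_one]
  | succ n ih => rw [pow_succ, ord_mul _ (pow_ne_zero _ h0) h0, ih]; push_cast; ring

theorem ord_zpow {g : K} (h0 : g ≠ 0) (n : ℤ) : v.ord (g ^ n) = n * v.ord g := by
  cases n with
  | ofNat n => simpa using v.ord_pow h0 n
  | negSucc n => rw [zpow_negSucc, ord_inv, ord_pow _ h0, Int.negSucc_eq]; push_cast; ring

theorem ord_div {g₁ g₂ : K} (h₁ : g₁ ≠ 0) (h₂ : g₂ ≠ 0) :
    v.ord (g₁ / g₂) = v.ord g₁ - v.ord g₂ := by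
  rw [div_eq_mul_inv, ord_mul _ h₁ (inv_ne_zero h₂), ord_inv, sub_eq_add_neg]

/-- The quotient is a unit. This transfers computations in the abstract value group of `v.ring` to
the integer order. -/
theorem ord_eq_of_valuation_eq {g₁ g₂ : K} (h₁ : g₁ ≠ 0) (h₂ : g₂ ≠ 0)
    (h : v.ring.valuation g₁ = v.ring.valuation g₂) : v.ord g₁ = v.ord g₂ := by
  have := (v.ord_eq_zero_iff (div_ne_zero h₁ h₂)).2 (by
    rw [map_div₀, h, div_self (by simpa using h₂)])
  rw [ord_div _ h₁ h₂] at this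
  omega

theorem exists_ord_eq_one : ∃ g : K, g ≠ 0 ∧ v.ord g = 1 := by
  obtain ⟨g, hg⟩ := (IsDiscreteValuationRing.maximalIdeal v.ring).valuation_exists_uniformizer K
  refine ⟨g, ?_, by rw [ord, hg]; simp⟩
  rintro rfl
  rw [map_zero] at hg
  exact WithZero.exp_ne_zero hg.symm

theorem ord_eq_one_of_valuation_eq_zpow {π : K} (h0 : π ≠ 0) (h1 : v.ring.valuation π < 1)
    (h : ∀ g : K, g ≠ 0 → ∃ n : ℤ, v.ring.valuation g = v.ring.valuation π ^ n) :
    v.ord π = 1 := by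
  obtain ⟨g, hg, hg1⟩ := v.exists_ord_eq_one
  obtain ⟨n, hn⟩ := h g hg
  rw [← map_zpow₀] at hn
  rw [v.ord_eq_of_valuation_eq hg (zpow_ne_zero _ h0) hn, v.ord_zpow h0] at hg1
  have := v.ord_pos_of_valuation_lt_one h0 h1
  exact Int.eq_one_or_neg_one_of_mul_eq_one' hg1 |>.elim (fun h => h.2) (fun h => by omega)

theorem le_ord_add {g₁ g₂ : K} {n : ℤ} (h₁ : g₁ ≠ 0 → n ≤ v.ord g₁) (h₂ : g₂ ≠ 0 → n ≤ v.ord g₂)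
    (h : g₁ + g₂ ≠ 0) : n ≤ v.ord (g₁ + g₂) := by
  by_cases e₁ : g₁ = 0
  · subst e₁; simp only [zero_add] at h ⊢; exact h₂ h
  by_cases e₂ : g₂ = 0
  · subst e₂; simp only [add_zero] at h ⊢; exact h₁ h
  have key : ∀ a b : K, a ≠ 0 → b ≠ 0 → a + b ≠ 0 → v.ord a ≤ v.ord b → v.ord a ≤ v.ord (a + b) := by
    intro a b ha hb hab hle
    have h1 : b / a ∈ v.ring := by
      rw [← v.ord_nonneg_iff (div_ne_zero hb ha), ord_div _ hb ha]; omega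
    have e : a + b = a * (1 + b / a) := by field_simp
    have h2 : 1 + b / a ≠ 0 := by rintro h2; rw [e, h2, mul_zero] at hab; exact hab rfl
    rw [e, ord_mul _ ha h2]
    have := v.ord_nonneg_of_mem (add_mem (one_mem _) h1)
    omega
  rcases le_total (v.ord g₁) (v.ord g₂) with hle | hle
  · exact (h₁ e₁).trans (key _ _ e₁ e₂ h hle)
  · rw [add_comm] at h ⊢
    exact (h₂ e₂).trans (key _ _ e₂ e₁ h hle)

theorem ord_neg (g : K) : v.ord (-g) = v.ord g := by
  simp [ord, Valuation.map_neg]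

theorem ord_algebraMap (c : k) : v.ord (algebraMap k K c) = 0 := by
  have h1 := v.ord_nonneg_of_mem (v.algebraMap_mem c)
  have h2 := v.ord_nonneg_of_mem (v.algebraMap_mem c⁻¹)
  rw [map_inv₀, ord_inv] at h2
  omega

end CurvePoint

/-! ### Transport of points along automorphisms of the function field -/

namespace CurvePoint

variable {k K : Type*} [Field k] [Field K] [Algebra k K]

/-- The preimage of a point under an automorphism of the function field. -/
noncomputable def comap (σ : K ≃ₐ[k] K) (v : CurvePoint k K) : CurvePoint k K where
  ring := v.ring.comap σ.toRingEquiv.toRingHom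
  algebraMap_mem c := by
    rw [ValuationSubring.mem_comap]
    simpa using v.algebraMap_mem c
  isDVR := by
    let e : v.ring ≃+* v.ring.comap σ.toRingEquiv.toRingHom :=
      { toFun := fun g => ⟨σ.symm g, by simp [ValuationSubring.mem_comap]⟩
        invFun := fun g => ⟨σ g, by simpa using ValuationSubring.mem_comap.1 g.2⟩
        left_inv := fun g => Subtype.ext (by simp)
        right_inv := fun g => Subtype.ext (by simp)
        map_mul' := fun a b => Subtype.ext (map_mul σ.symm (a : K) b)
        map_add' := fun a b => Subtype.ext (map_add σ.symm (a : K) b) }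
    exact IsDiscreteValuationRing.RingEquivClass.isDiscreteValuationRing e

theorem mem_comap_ring (σ : K ≃ₐ[k] K) (v : CurvePoint k K) (g : K) :
    g ∈ (v.comap σ).ring ↔ σ g ∈ v.ring := ValuationSubring.mem_comap

/-- Both orders are nonnegative on the same functions, so they are proportional with factor `v.ord
(σ π)`. The factor is nonnegative and divides `1`, because `v.ord` takes the value `1`. -/
theorem ord_comap (σ : K ≃ₐ[k] K) (v : CurvePoint k K) {g : K} (hg : g ≠ 0) :
    (v.comap σ).ord g = v.ord (σ g) := by
  have hσ : ∀ {g : K}, g ≠ 0 → σ g ≠ 0 := fun h => by simpa using h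
  have key : ∀ {g : K}, g ≠ 0 → (0 ≤ (v.comap σ).ord g ↔ 0 ≤ v.ord (σ g)) := fun h => by
    rw [ord_nonneg_iff _ h, ord_nonneg_iff _ (hσ h), mem_comap_ring]
  obtain ⟨π, hπ, hπ1⟩ := (v.comap σ).exists_ord_eq_one
  have all : ∀ {g : K}, g ≠ 0 → v.ord (σ g) = (v.comap σ).ord g * v.ord (σ π) := by
    intro g hg
    have h0 : π ^ (v.comap σ).ord g ≠ 0 := zpow_ne_zero _ hπ
    have e : (v.comap σ).ord (g / π ^ (v.comap σ).ord g) = 0 := by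
      rw [ord_div _ hg h0, ord_zpow _ hπ, hπ1]; ring
    have e' : (v.comap σ).ord (g / π ^ (v.comap σ).ord g)⁻¹ = 0 := by
      rw [ord_inv, e]; rfl
    have h1 := (key (div_ne_zero hg h0)).1 e.ge
    have h2 := (key (inv_ne_zero (div_ne_zero hg h0))).1 e'.ge
    rw [map_inv₀, ord_inv] at h2
    have h3 : v.ord (σ (g / π ^ (v.comap σ).ord g)) = 0 := by omega
    rw [map_div₀, ord_div _ (hσ hg) (hσ h0), map_zpow₀, ord_zpow _ (hσ hπ)] at h3
    omega
  obtain ⟨t, ht, ht1⟩ := v.exists_ord_eq_one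
  have h1 := all (g := σ.symm t) (by simpa using ht)
  rw [AlgEquiv.apply_symm_apply, ht1] at h1
  have h2 := (key hπ).1 (by omega)
  have h3 : v.ord (σ π) = 1 :=
    Int.eq_one_or_neg_one_of_mul_eq_one' h1.symm |>.elim (fun h => h.2) (fun h => by omega)
  rw [all hg, h3, mul_one]

end CurvePoint

/-! ### The function field over `k(x)`: normal form, norm and hyperelliptic involution -/

namespace HyperellipticCurve

variable {k : Type*} [Field k] [CharZero k] (B : HyperellipticCurve k)

theorem aeval_x (p : k[X]) :
    aeval B.x p = algebraMap B.CoordinateRing B.FunctionField (AdjoinRoot.of B.equation p) := by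
  induction p using Polynomial.induction_on' with
  | add p q hp hq => simp [hp, hq]
  | monomial n c =>
    rw [aeval_monomial, IsScalarTower.algebraMap_apply k B.CoordinateRing B.FunctionField, x,
      ← map_pow, ← map_mul, ← map_pow, ← C_mul_X_pow_eq_monomial, map_mul (AdjoinRoot.of B.equation)]
    rfl

/-- The function `a(x) + b(x) y`. -/
noncomputable def fn (a b : k[X]) : B.FunctionField := aeval B.x a + aeval B.x b * B.y

theorem eval₂_equation {S : Type*} [CommRing S] (φ : k[X] →+* S) (r : S) :
    B.equation.eval₂ φ r = r ^ 2 + φ B.h * r - φ B.f := by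
  rw [equation]
  simp only [eval₂_sub, eval₂_add, eval₂_mul, eval₂_pow, eval₂_X, eval₂_C]

theorem y_sq : B.y ^ 2 + aeval B.x B.h * B.y = aeval B.x B.f := by
  rw [aeval_x, aeval_x, y, ← map_pow, ← map_mul, ← map_add]
  congr 1
  have h := AdjoinRoot.eval₂_root B.equation
  rw [eval₂_equation] at h
  exact sub_eq_zero.1 h

theorem exists_eq_of_add (r : B.CoordinateRing) : ∃ a b : k[X],
    r = AdjoinRoot.of B.equation a + AdjoinRoot.of B.equation b * AdjoinRoot.root B.equation := by
  obtain ⟨p, rfl⟩ := AdjoinRoot.mk_surjective r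
  have hdeg : (p %ₘ B.equation).natDegree < 2 := by
    rw [← B.natDegree_equation]
    exact natDegree_modByMonic_lt _ B.monic_equation (by
      intro h; have := B.natDegree_equation; simp [h] at this)
  refine ⟨(p %ₘ B.equation).coeff 0, (p %ₘ B.equation).coeff 1, ?_⟩
  have e : AdjoinRoot.mk B.equation p = AdjoinRoot.mk B.equation (p %ₘ B.equation) := by
    rw [AdjoinRoot.mk_eq_mk]
    exact ⟨p /ₘ B.equation, by
      rw [sub_eq_iff_eq_add, add_comm]; exact (modByMonic_add_div p B.equation).symm⟩
  rw [e]
  conv_lhs => rw [(p %ₘ B.equation).as_sum_range' 2 hdeg]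
  simp only [Finset.sum_range_succ, Finset.sum_range_zero, zero_add, map_add,
    ← C_mul_X_pow_eq_monomial, pow_zero, mul_one, pow_one, map_mul, AdjoinRoot.mk_C,
    AdjoinRoot.mk_X]

theorem algebraMap_eq_fn (a b : k[X]) : algebraMap B.CoordinateRing B.FunctionField
    (AdjoinRoot.of B.equation a + AdjoinRoot.of B.equation b * AdjoinRoot.root B.equation) =
      B.fn a b := by
  rw [fn, aeval_x, aeval_x, y, map_add, map_mul]

theorem fn_eq_zero_iff {a b : k[X]} : B.fn a b = 0 ↔ a = 0 ∧ b = 0 := by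
  refine ⟨fun h => ?_, by rintro ⟨rfl, rfl⟩; simp [fn]⟩
  rw [← algebraMap_eq_fn, map_eq_zero_iff _ (IsFractionRing.injective _ _)] at h
  have e : AdjoinRoot.mk B.equation (C b * X + C a) = 0 := by
    rw [← h, map_add, map_mul, AdjoinRoot.mk_C, AdjoinRoot.mk_C, AdjoinRoot.mk_X, add_comm]
  rw [AdjoinRoot.mk_eq_zero] at e
  have e0 : C b * X + C a = 0 := by
    by_contra hne
    have h1 := natDegree_le_of_dvd e hne
    rw [B.natDegree_equation] at h1
    have h2 : (C b * X + C a).natDegree ≤ 1 := natDegree_linear_le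
    omega
  exact ⟨by simpa using congrArg (fun p : k[X][X] => p.coeff 0) e0,
    by simpa using congrArg (fun p : k[X][X] => p.coeff 1) e0⟩

theorem fn_zero_right (a : k[X]) : B.fn a 0 = aeval B.x a := by simp [fn]

theorem aeval_x_ne_zero {a : k[X]} (ha : a ≠ 0) : aeval B.x a ≠ 0 := by
  rw [← fn_zero_right, Ne, fn_eq_zero_iff]
  exact fun h => ha h.1

/-- The norm to `k[x]` of the function `a(x) + b(x) y`. -/
noncomputable def normPoly (a b : k[X]) : k[X] := a ^ 2 - a * b * B.h - b ^ 2 * B.f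

theorem fn_mul_conj (a b : k[X]) :
    B.fn a b * B.fn (a - b * B.h) (-b) = aeval B.x (B.normPoly a b) := by
  simp only [fn, normPoly, map_sub, map_mul, map_neg, map_pow, ← B.y_sq]
  ring

theorem normPoly_ne_zero {a b : k[X]} (h : B.fn a b ≠ 0) : B.normPoly a b ≠ 0 := by
  intro h0
  have := B.fn_mul_conj a b
  rw [h0, map_zero, mul_eq_zero, or_iff_right h, fn_eq_zero_iff] at this
  obtain ⟨h1, h2⟩ := this
  rw [neg_eq_zero] at h2
  subst h2
  simp only [zero_mul, sub_zero] at h1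
  exact h (by rw [h1, fn_eq_zero_iff]; simp)

/-- Multiplying numerator and denominator by the conjugate of the denominator turns the latter into
its norm, a polynomial in `x`. -/
theorem exists_eq_fn_div (g : B.FunctionField) :
    ∃ a b c : k[X], c ≠ 0 ∧ g = B.fn a b / aeval B.x c := by
  obtain ⟨r, s, hs, rfl⟩ := IsFractionRing.div_surjective (A := B.CoordinateRing) g
  have hs0 : algebraMap B.CoordinateRing B.FunctionField s ≠ 0 := by
    simpa using nonZeroDivisors.ne_zero hs
  obtain ⟨a, b, rfl⟩ := B.exists_eq_of_add r
  obtain ⟨c, d, rfl⟩ := B.exists_eq_of_add s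
  rw [algebraMap_eq_fn] at hs0
  rw [algebraMap_eq_fn, algebraMap_eq_fn]
  have h1 : B.fn (c - d * B.h) (-d) ≠ 0 := by
    intro h
    have := B.fn_mul_conj c d
    rw [h, mul_zero] at this
    exact B.aeval_x_ne_zero (B.normPoly_ne_zero hs0) this.symm
  refine ⟨a * (c - d * B.h) - b * d * B.f, b * (c - d * B.h) - a * d + b * d * B.h,
    B.normPoly c d, B.normPoly_ne_zero hs0, ?_⟩
  rw [← fn_mul_conj, div_eq_div_iff hs0 (mul_ne_zero hs0 h1)]
  simp only [fn, map_sub, map_mul, map_neg, map_add, ← B.y_sq]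
  ring

/-- The hyperelliptic involution on the coordinate ring. -/
noncomputable def involutionRing : B.CoordinateRing →+* B.CoordinateRing :=
  AdjoinRoot.lift (AdjoinRoot.of B.equation)
    (-AdjoinRoot.root B.equation - AdjoinRoot.of B.equation B.h) (by
      have h := AdjoinRoot.eval₂_root B.equation
      rw [eval₂_equation] at h ⊢
      linear_combination h)

theorem involutionRing_of (a : k[X]) :
    B.involutionRing (AdjoinRoot.of B.equation a) = AdjoinRoot.of B.equation a := by
  rw [involutionRing, AdjoinRoot.lift_of]

theorem involutionRing_root : B.involutionRing (AdjoinRoot.root B.equation) =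
    -AdjoinRoot.root B.equation - AdjoinRoot.of B.equation B.h := by
  rw [involutionRing, AdjoinRoot.lift_root]

theorem involutionRing_involutive (r : B.CoordinateRing) :
    B.involutionRing (B.involutionRing r) = r := by
  obtain ⟨a, b, rfl⟩ := B.exists_eq_of_add r
  simp only [map_add, map_mul, map_sub, map_neg, involutionRing_of, involutionRing_root]
  ring

/-- The hyperelliptic involution on the function field. -/
noncomputable def involution : B.FunctionField ≃ₐ[k] B.FunctionField :=
  AlgEquiv.ofRingEquiv (f := IsFractionRing.ringEquivOfRingEquiv (A := B.CoordinateRing)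
      (B := B.CoordinateRing)
      (RingEquiv.ofRingHom B.involutionRing B.involutionRing
        (RingHom.ext B.involutionRing_involutive)
        (RingHom.ext B.involutionRing_involutive))) (by
    intro c
    rw [IsScalarTower.algebraMap_apply k B.CoordinateRing B.FunctionField,
      IsFractionRing.ringEquivOfRingEquiv_algebraMap]
    congr 1
    exact B.involutionRing_of (C c))

theorem involution_algebraMap (r : B.CoordinateRing) :
    B.involution (algebraMap B.CoordinateRing B.FunctionField r) =
      algebraMap B.CoordinateRing B.FunctionField (B.involutionRing r) :=
  IsFractionRing.ringEquivOfRingEquiv_algebraMap (A := B.CoordinateRing) (B := B.CoordinateRing) _ r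

theorem involution_fn (a b : k[X]) : B.involution (B.fn a b) = B.fn (a - b * B.h) (-b) := by
  rw [← algebraMap_eq_fn, ← algebraMap_eq_fn, involution_algebraMap]
  simp only [map_add, map_mul, map_sub, map_neg, involutionRing_of, involutionRing_root]
  ring_nf

end HyperellipticCurve

/-! ### The point at infinity -/

namespace HyperellipticCurve

variable {k : Type*} [Field k] [CharZero k] (B : HyperellipticCurve k)

/-- The order of the pole of `a(x) + b(x) y` at infinity. -/
noncomputable def poleOrder (a b : k[X]) : ℕ :=
  open Classical in
  if b = 0 then 2 * a.natDegree else max (2 * a.natDegree) (2 * b.natDegree + 2 * B.genus + 1)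

theorem transcendental_x : Transcendental k B.x := by
  rintro ⟨p, hp, h⟩
  exact B.aeval_x_ne_zero hp h

theorem y_ne_zero : B.y ≠ 0 := by
  have h : B.fn 0 1 ≠ 0 := by simp [Ne, fn_eq_zero_iff]
  simpa [fn] using h

section Infinity

variable {O : ValuationSubring B.FunctionField}

theorem valuation_aeval_of_notMem (hk : ∀ c : k, algebraMap k B.FunctionField c ∈ O)
    (hx : B.x ∉ O) {a : k[X]} (ha : a ≠ 0) :
    O.valuation (aeval B.x a) = O.valuation B.x ^ a.natDegree := by
  have hv : O.valuation.IsTrivialOn k := ⟨fun c hc => by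
    apply le_antisymm ((O.valuation_le_one_iff _).2 (hk c))
    have h1 := (O.valuation_le_one_iff _).2 (hk c⁻¹)
    rw [map_inv₀, map_inv₀] at h1
    rwa [← inv_le_one₀ (by simpa [zero_lt_iff] using hc)]⟩
  exact Polynomial.valuation_aeval_eq_valuation_X_pow_natDegree_of_one_lt_valuation_X
    B.x (by rwa [← not_le, O.valuation_le_one_iff]) ha

/-- In `y (y + h) = f` the right side has size `|x|^(2γ+1)`, while `|h| ≤ |x|^γ`. Hence `|y| >
|x|^γ`, the term `h` is negligible beside `y`, and `|y|² = |f|`. -/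
theorem valuation_y_sq (hk : ∀ c : k, algebraMap k B.FunctionField c ∈ O)
    (hx : B.x ∉ O) : O.valuation B.y ^ 2 = O.valuation B.x ^ (2 * B.genus + 1) := by
  have h1 : 1 < O.valuation B.x := by rwa [← not_le, O.valuation_le_one_iff]
  have hf := B.valuation_aeval_of_notMem hk hx B.monic_f.ne_zero
  rw [B.natDegree_f] at hf
  have hh : O.valuation (aeval B.x B.h) ≤ O.valuation B.x ^ B.genus := by
    by_cases h0 : B.h = 0
    · simp [h0]
    · rw [B.valuation_aeval_of_notMem hk hx h0]
      exact pow_le_pow_right₀ h1.le B.natDegree_h_le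
  have e : B.y * (B.y + aeval B.x B.h) = aeval B.x B.f := by rw [← y_sq]; ring
  have hlt : O.valuation B.x ^ B.genus < O.valuation B.y := by
    by_contra hle
    rw [not_lt] at hle
    have h2 : O.valuation (aeval B.x B.f) ≤ O.valuation B.x ^ (2 * B.genus) := by
      rw [← e, map_mul, two_mul, pow_add]
      exact mul_le_mul' hle ((O.valuation.map_add _ _).trans (max_le hle hh))
    rw [hf] at h2
    exact absurd h2 (not_le.2 (pow_lt_pow_right₀ h1 (by omega)))
  rw [← hf, ← e, map_mul, O.valuation.map_add_eq_of_lt_left (hh.trans_lt hlt), sq]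

/-- The squares of `a(x)` and `b(x) y` have sizes that are an even and an odd power of `|x|`, so the
two terms cannot cancel. Squares are compared because the value group is not yet known to contain a
square root of `|x|`. -/
theorem valuation_fn_sq (hk : ∀ c : k, algebraMap k B.FunctionField c ∈ O)
    (hx : B.x ∉ O) {a b : k[X]} (h : B.fn a b ≠ 0) :
    O.valuation (B.fn a b) ^ 2 = O.valuation B.x ^ B.poleOrder a b := by
  have h1 : 1 < O.valuation B.x := by rwa [← not_le, O.valuation_le_one_iff]
  by_cases hb : b = 0
  · subst hb
    have ha : a ≠ 0 := by rintro rfl; simp [fn] at h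
    rw [fn_zero_right, B.valuation_aeval_of_notMem hk hx ha, poleOrder, if_pos rfl, ← pow_mul,
      mul_comm]
  have hby : O.valuation (aeval B.x b * B.y) ^ 2 =
      O.valuation B.x ^ (2 * b.natDegree + 2 * B.genus + 1) := by
    rw [map_mul, mul_pow, B.valuation_y_sq hk hx, B.valuation_aeval_of_notMem hk hx hb,
      ← pow_mul, ← pow_add]
    congr 1; omega
  rw [poleOrder, if_neg hb]
  by_cases ha : a = 0
  · subst ha
    rw [fn, map_zero, zero_add, hby]
    congr 1
  have ha2 : O.valuation (aeval B.x a) ^ 2 = O.valuation B.x ^ (2 * a.natDegree) := by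
    rw [B.valuation_aeval_of_notMem hk hx ha, ← pow_mul, mul_comm]
  rw [fn]
  rcases lt_or_gt_of_ne (show 2 * a.natDegree ≠ 2 * b.natDegree + 2 * B.genus + 1 by omega)
    with hlt | hlt
  · have : O.valuation (aeval B.x a) < O.valuation (aeval B.x b * B.y) := by
      apply lt_of_pow_lt_pow_left₀ 2 zero_le
      rw [ha2, hby]
      exact pow_lt_pow_right₀ h1 hlt
    rw [O.valuation.map_add_eq_of_lt_right this, hby, max_eq_right hlt.le]
  · have : O.valuation (aeval B.x b * B.y) < O.valuation (aeval B.x a) := by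
      apply lt_of_pow_lt_pow_left₀ 2 zero_le
      rw [ha2, hby]
      exact pow_lt_pow_right₀ h1 hlt
    rw [O.valuation.map_add_eq_of_lt_left this, ha2, max_eq_left hlt.le]

theorem valuation_fn_div_sq (hk : ∀ c : k, algebraMap k B.FunctionField c ∈ O)
    (hx : B.x ∉ O) {a b c : k[X]} (h : B.fn a b ≠ 0) (hc : c ≠ 0) :
    O.valuation (B.fn a b / aeval B.x c) ^ 2 =
      O.valuation B.x ^ ((B.poleOrder a b : ℤ) - 2 * c.natDegree) := by
  have hx0 : O.valuation B.x ≠ 0 := by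
    intro h0; rw [map_eq_zero] at h0; rw [h0] at hx; exact hx O.zero_mem
  rw [map_div₀, div_pow, B.valuation_fn_sq hk hx h, B.valuation_aeval_of_notMem hk hx hc,
    ← pow_mul, zpow_sub₀ hx0, zpow_natCast, mul_comm]
  congr 1

/-- The orders `-2` and `-(2γ+1)` of `x` and `y` make `x^γ / y` a uniformizer at infinity. -/
theorem valuation_eq_zpow_of_notMem (hk : ∀ c : k, algebraMap k B.FunctionField c ∈ O)
    (hx : B.x ∉ O) :
    O.valuation (B.x ^ B.genus / B.y) ^ 2 = (O.valuation B.x)⁻¹ ∧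
    ∀ g : B.FunctionField, g ≠ 0 →
      ∃ n : ℤ, O.valuation g = O.valuation (B.x ^ B.genus / B.y) ^ n := by
  have hx0 : O.valuation B.x ≠ 0 := by
    intro h0; rw [map_eq_zero] at h0; rw [h0] at hx; exact hx O.zero_mem
  have h1 : O.valuation (B.x ^ B.genus / B.y) ^ 2 = (O.valuation B.x)⁻¹ := by
    rw [map_div₀, div_pow, B.valuation_y_sq hk hx, map_pow, ← pow_mul, mul_comm, pow_succ]
    field_simp
  refine ⟨h1, fun g hg => ?_⟩
  obtain ⟨a, b, c, hc, rfl⟩ := B.exists_eq_fn_div g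
  have hab : B.fn a b ≠ 0 := by rintro h; simp [h] at hg
  refine ⟨-((B.poleOrder a b : ℤ) - 2 * c.natDegree), ?_⟩
  rw [← pow_left_inj₀ zero_le zero_le two_ne_zero, B.valuation_fn_div_sq hk hx hab hc]
  generalize (B.poleOrder a b : ℤ) - 2 * c.natDegree = e
  generalize O.valuation (B.x ^ B.genus / B.y) = z at h1 ⊢
  rw [← zpow_natCast, ← zpow_mul, mul_comm, zpow_mul, zpow_natCast, h1, inv_zpow', neg_neg]

end Infinity

/-- As `x` is transcendental, it is not in the integral closure of `k`, so some valuation ring over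
`k` omits it. For any such ring, membership of `(a + b y)/c` is decided by the sign of `poleOrder a
b - 2 deg c`, which gives uniqueness. -/
theorem exists_isPointAtInfinity : ∃ q : B.Point, B.IsPointAtInfinity q := by
  have hxR : B.x ∉ (integralClosure k B.FunctionField).toSubring := fun h =>
    B.transcendental_x (IsIntegral.isAlgebraic h)
  obtain ⟨O, hO, hx⟩ := Subring.exists_le_valuationSubring_of_isIntegrallyClosedIn hxR
  have hk : ∀ c : k, algebraMap k B.FunctionField c ∈ O := fun c =>
    hO (isIntegral_algebraMap (R := k) (A := B.FunctionField) (x := c))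
  have h1 : 1 < O.valuation B.x := by rwa [← not_le, O.valuation_le_one_iff]
  obtain ⟨h2, h3⟩ := B.valuation_eq_zpow_of_notMem hk hx
  have hx0 : B.x ≠ 0 := by rintro h; rw [h] at hx; exact hx O.zero_mem
  have hDVR := O.isDiscreteValuationRing_of_valuation_eq_zpow
    (div_ne_zero (pow_ne_zero B.genus hx0) B.y_ne_zero) (by
      rw [← not_le]; intro h
      have := one_le_pow₀ (n := 2) h
      rw [h2, one_le_inv₀ (zero_lt_one.trans h1)] at this
      exact absurd this (not_le.2 h1)) h3
  refine ⟨⟨O, hk, hDVR⟩, fun v => ⟨fun hv => ?_, by rintro rfl; exact hx⟩⟩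
  have h1v : 1 < v.ring.valuation B.x := by rwa [← not_le, v.ring.valuation_le_one_iff]
  ext g
  show g ∈ v.ring ↔ g ∈ O
  by_cases hg : g = 0
  · simp [hg]
  obtain ⟨a, b, c, hc, rfl⟩ := B.exists_eq_fn_div g
  have hab : B.fn a b ≠ 0 := by rintro h; simp [h] at hg
  rw [← v.ring.valuation_le_one_iff, ← O.valuation_le_one_iff,
    ← pow_le_one_iff_of_nonneg zero_le two_ne_zero,
    ← pow_le_one_iff_of_nonneg (a := O.valuation _) zero_le two_ne_zero,
    B.valuation_fn_div_sq v.algebraMap_mem hv hab hc, B.valuation_fn_div_sq hk hx hab hc,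
    zpow_le_one_iff_right₀ h1, zpow_le_one_iff_right₀ h1v]

variable {B}

theorem IsPointAtInfinity.x_notMem {q : B.Point} (hq : B.IsPointAtInfinity q) : B.x ∉ q.ring :=
  (hq q).2 rfl

theorem IsPointAtInfinity.ord_x {q : B.Point} (hq : B.IsPointAtInfinity q) : q.ord B.x = -2 := by
  have hx := hq.x_notMem
  have h1 : 1 < q.ring.valuation B.x := by rwa [← not_le, q.ring.valuation_le_one_iff]
  have hx0 : B.x ≠ 0 := by rintro h; rw [h] at hx; exact hx q.ring.zero_mem
  obtain ⟨h2, h3⟩ := B.valuation_eq_zpow_of_notMem q.algebraMap_mem hx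
  have hz := div_ne_zero (pow_ne_zero B.genus hx0) B.y_ne_zero
  have h4 := q.ord_eq_one_of_valuation_eq_zpow hz (by
      rw [← not_le]; intro h
      have := one_le_pow₀ (n := 2) h
      rw [h2, one_le_inv₀ (zero_lt_one.trans h1)] at this
      exact absurd this (not_le.2 h1)) h3
  have h5 := q.ord_eq_of_valuation_eq (pow_ne_zero 2 hz) (inv_ne_zero hx0)
    (by rw [map_pow, h2, map_inv₀])
  rw [q.ord_pow hz, q.ord_inv, h4] at h5
  push_cast at h5
  omega

theorem IsPointAtInfinity.ord_fn {q : B.Point} (hq : B.IsPointAtInfinity q) {a b : k[X]}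
    (h : B.fn a b ≠ 0) : q.ord (B.fn a b) = -B.poleOrder a b := by
  have hx := hq.x_notMem
  have hx0 : B.x ≠ 0 := by rintro h; rw [h] at hx; exact hx q.ring.zero_mem
  have h5 := q.ord_eq_of_valuation_eq (pow_ne_zero 2 h) (pow_ne_zero (B.poleOrder a b) hx0)
    (by rw [map_pow, map_pow, B.valuation_fn_sq q.algebraMap_mem hx h])
  rw [q.ord_pow h, q.ord_pow hx0, hq.ord_x] at h5
  push_cast at h5
  omega

end HyperellipticCurve

/-! ### Local structure at a point of the affine curve -/

namespace HyperellipticCurve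

variable {k : Type*} [Field k] [CharZero k] (B : HyperellipticCurve k)

/-- The pair `(a, b)` satisfies the affine equation of the curve. -/
def OnCurve (a b : k) : Prop := b ^ 2 + B.h.eval a * b = B.f.eval a

variable {B} {a b : k}

/-- Evaluation of regular functions at a point of the affine curve. -/
noncomputable def OnCurve.ev (hab : B.OnCurve a b) : B.CoordinateRing →+* k :=
  AdjoinRoot.lift (evalRingHom a) b (by
    rw [eval₂_equation, coe_evalRingHom, sub_eq_zero]
    exact hab)

theorem OnCurve.ev_of (hab : B.OnCurve a b) (p : k[X]) :
    hab.ev (AdjoinRoot.of B.equation p) = p.eval a := by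
  rw [ev, AdjoinRoot.lift_of, coe_evalRingHom]

theorem OnCurve.ev_root (hab : B.OnCurve a b) : hab.ev (AdjoinRoot.root B.equation) = b := by
  rw [ev, AdjoinRoot.lift_root]

theorem of_injective : Function.Injective (AdjoinRoot.of B.equation) := by
  rw [injective_iff_map_eq_zero]
  intro p hp
  by_contra h
  apply B.aeval_x_ne_zero h
  rw [aeval_x, hp, map_zero]

theorem OnCurve.exists_sub_ev_eq (hab : B.OnCurve a b) (r : B.CoordinateRing) :
    ∃ u w : B.CoordinateRing, r = AdjoinRoot.of B.equation (C (hab.ev r)) +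
      AdjoinRoot.of B.equation (X - C a) * u +
      (AdjoinRoot.root B.equation - AdjoinRoot.of B.equation (C b)) * w := by
  obtain ⟨c, d, rfl⟩ := B.exists_eq_of_add r
  obtain ⟨c', hc⟩ := X_sub_C_dvd_sub_C_eval (a := a) (p := c)
  obtain ⟨d', hd⟩ := X_sub_C_dvd_sub_C_eval (a := a) (p := d)
  rw [sub_eq_iff_eq_add] at hc hd
  refine ⟨AdjoinRoot.of B.equation c' + AdjoinRoot.of B.equation d' * AdjoinRoot.root B.equation,
    AdjoinRoot.of B.equation (C (d.eval a)), ?_⟩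
  rw [map_add, map_mul, hab.ev_of, hab.ev_of, hab.ev_root]
  conv_lhs => rw [hc, hd]
  simp only [map_add, map_mul]
  ring

theorem root_sq : AdjoinRoot.root B.equation ^ 2 +
    AdjoinRoot.of B.equation B.h * AdjoinRoot.root B.equation = AdjoinRoot.of B.equation B.f := by
  have h := AdjoinRoot.eval₂_root B.equation
  rw [eval₂_equation] at h
  exact sub_eq_zero.1 h

/-- `π` generates the maximal ideal of the local ring at `(a, b)`, in which `x - a` is associated
to `π ^ e`. -/
structure OnCurve.IsUniformizer (hab : B.OnCurve a b) (π : B.CoordinateRing) (e : ℕ) : Prop where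
  ev_eq_zero : hab.ev π = 0
  exists_mul_eq : ∀ r, hab.ev r = 0 → ∃ s t, hab.ev s ≠ 0 ∧ s * r = π * t
  exists_mul_eq_pow : ∃ s t, hab.ev s ≠ 0 ∧ hab.ev t ≠ 0 ∧
    s * AdjoinRoot.of B.equation (X - C a) = π ^ e * t
  e_pos : 0 < e

/-- Subtracting the equation at `(a, b)` gives `(y - b)(y + b + h) = (x - a)(f₁ - b h₁)`, where
`h₁`, `f₁` are difference quotients. If `2b + h(a) ≠ 0`, the second factor on the left is a local
unit and `x - a` generates. Otherwise the relation becomes `(y - b)² = (x - a) · unit`. -/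
theorem OnCurve.isUniformizer_or (hab : B.OnCurve a b) :
    (2 * b + B.h.eval a ≠ 0 ∧
      hab.IsUniformizer (AdjoinRoot.of B.equation (X - C a)) 1) ∨
    (2 * b + B.h.eval a = 0 ∧
      hab.IsUniformizer (AdjoinRoot.root B.equation - AdjoinRoot.of B.equation (C b)) 2) := by
  obtain ⟨h₁, hh⟩ := X_sub_C_dvd_sub_C_eval (a := a) (p := B.h)
  obtain ⟨f₁, hf⟩ := X_sub_C_dvd_sub_C_eval (a := a) (p := B.f)
  rw [sub_eq_iff_eq_add] at hh hf
  have hab' : C b ^ 2 + C (B.h.eval a) * C b = C (B.f.eval a) := by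
    rw [← C_pow, ← C_mul, ← C_add]; exact congrArg C hab
  have hab'' := congrArg (AdjoinRoot.of B.equation) hab'
  have hh' := congrArg (AdjoinRoot.of B.equation) hh
  have hf' := congrArg (AdjoinRoot.of B.equation) hf
  have hroot := root_sq (B := B)
  simp only [map_add, map_mul, map_pow] at hab'' hh' hf'
  set Y := AdjoinRoot.root B.equation
  set o := AdjoinRoot.of B.equation
  have key : (Y - o (C b)) * (Y + o (C b) + o B.h) = o (X - C a) * (o f₁ - o (C b) * o h₁) := by
    linear_combination hroot + hf' - o (C b) * hh' - hab''
  have evX : hab.ev (o (X - C a)) = 0 := by simp [o, hab.ev_of]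
  have evY : hab.ev (Y - o (C b)) = 0 := by simp [o, Y, hab.ev_of, hab.ev_root]
  by_cases h0 : 2 * b + B.h.eval a = 0
  · right
    have h0' := congrArg (fun z => o (C z)) h0
    simp only [map_add, map_mul, map_zero] at h0'
    have e2 : o (C 2) = 2 := map_ofNat (o.comp C) 2
    rw [e2] at h0'
    have key2 : (o f₁ - o (C b) * o h₁ - o h₁ * (Y - o (C b))) * o (X - C a) =
        (Y - o (C b)) ^ 2 := by
      linear_combination -key + (Y - o (C b)) * hh' + (Y - o (C b)) * h0'
    -- Nonsingularity enters here: if `f₁ - b h₁` vanished at the point, then `a` would be a common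
    -- root of `h² + 4f` and its derivative.
    have hne : hab.ev (o f₁ - o (C b) * o h₁ - o h₁ * (Y - o (C b))) ≠ 0 := by
      rw [map_sub, map_mul _ _ (Y - o (C b)), evY, mul_zero, sub_zero, map_sub, map_mul]
      simp only [o, hab.ev_of, eval_C]
      intro hz
      obtain ⟨u, w, huw⟩ := B.separable_disc
      have := congrArg (eval a) huw
      have hd : (derivative (B.h ^ 2 + 4 * B.f)).eval a = 0 := by
        have ed : derivative (B.h ^ 2 + 4 * B.f) =
            2 * B.h * derivative B.h + 4 * derivative B.f := by
          have e4 : (4 : k[X]) = C 4 := (map_ofNat C 4).symm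
          rw [e4]
          simp only [map_add, derivative_sq, derivative_C_mul]
          rw [map_ofNat C 2]
        have e1 : (derivative B.h).eval a = h₁.eval a := by
          conv_lhs => rw [hh]
          simp [derivative_mul]
        have e3 : (derivative B.f).eval a = f₁.eval a := by
          conv_lhs => rw [hf]
          simp [derivative_mul]
        rw [ed]
        simp only [eval_add, eval_mul, eval_ofNat, e1, e3]
        linear_combination 2 * h₁.eval a * h0 + 4 * hz
      have hd0 : (B.h ^ 2 + 4 * B.f).eval a = 0 := by
        have hab2 : b ^ 2 + B.h.eval a * b = B.f.eval a := hab
        simp only [eval_add, eval_mul, eval_ofNat, eval_pow, ← hab2]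
        linear_combination (2 * b + B.h.eval a) * h0
      rw [eval_add, eval_mul, eval_mul, hd, hd0] at this
      simp at this
    refine ⟨h0, evY, fun r hr => ?_, ⟨_, 1, hne, by simp, by rw [key2, mul_one]⟩, two_pos⟩
    obtain ⟨u, w, huw⟩ := hab.exists_sub_ev_eq r
    rw [hr, map_zero, map_zero, zero_add] at huw
    refine ⟨_, (Y - o (C b)) * u + (o f₁ - o (C b) * o h₁ - o h₁ * (Y - o (C b))) * w, hne, ?_⟩
    rw [huw]
    linear_combination u * key2
  · left
    refine ⟨h0, evX, fun r hr => ?_, ⟨1, 1, by simp, by simp, by ring⟩, one_pos⟩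
    obtain ⟨u, w, huw⟩ := hab.exists_sub_ev_eq r
    rw [hr, map_zero, map_zero, zero_add] at huw
    refine ⟨Y + o (C b) + o B.h, (Y + o (C b) + o B.h) * u + (o f₁ - o (C b) * o h₁) * w, ?_, ?_⟩
    · simp only [map_add, o, Y, hab.ev_of, hab.ev_root, eval_C]
      intro h; apply h0; rw [← h]; ring
    · rw [huw]
      linear_combination w * key

/-- The valuation ring `O` is centered at the point `(a, b)`. -/
structure IsCentered (O : ValuationSubring B.FunctionField) (a b : k) : Prop where
  algebraMap_mem : ∀ c : k, algebraMap k B.FunctionField c ∈ O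
  x_lt : O.valuation (B.x - algebraMap k B.FunctionField a) < 1
  y_lt : O.valuation (B.y - algebraMap k B.FunctionField b) < 1

namespace IsCentered

variable {O : ValuationSubring B.FunctionField}

theorem x_mem (h : IsCentered O a b) : B.x ∈ O := by
  have := add_mem ((O.valuation_le_one_iff _).1 h.x_lt.le) (h.algebraMap_mem a)
  rwa [sub_add_cancel] at this

theorem y_mem (h : IsCentered O a b) : B.y ∈ O := by
  have := add_mem ((O.valuation_le_one_iff _).1 h.y_lt.le) (h.algebraMap_mem b)
  rwa [sub_add_cancel] at this

end IsCentered

theorem aeval_mem {O : ValuationSubring B.FunctionField}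
    (hk : ∀ c : k, algebraMap k B.FunctionField c ∈ O) (hx : B.x ∈ O) (p : k[X]) :
    aeval B.x p ∈ O := by
  rw [aeval_eq_sum_range]
  exact sum_mem fun i _ => by
    rw [Algebra.smul_def]; exact mul_mem (hk _) (pow_mem hx _)

theorem y_mem_of_x_mem {O : ValuationSubring B.FunctionField}
    (hk : ∀ c : k, algebraMap k B.FunctionField c ∈ O) (hx : B.x ∈ O) : B.y ∈ O := by
  by_contra hy
  have hy1 : 1 < O.valuation B.y := by rwa [← not_le, O.valuation_le_one_iff]
  have hh := (O.valuation_le_one_iff _).2 (aeval_mem hk hx B.h)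
  have hf := (O.valuation_le_one_iff _).2 (aeval_mem hk hx B.f)
  have e : B.y * (B.y + aeval B.x B.h) = aeval B.x B.f := by rw [← y_sq]; ring
  rw [← e, map_mul, O.valuation.map_add_eq_of_lt_left (hh.trans_lt hy1)] at hf
  exact absurd hf (not_le.2 (one_lt_mul hy1.le hy1))

theorem algebraMap_mem_of_x_mem {O : ValuationSubring B.FunctionField}
    (hk : ∀ c : k, algebraMap k B.FunctionField c ∈ O) (hx : B.x ∈ O) (r : B.CoordinateRing) :
    algebraMap B.CoordinateRing B.FunctionField r ∈ O := by
  obtain ⟨c, d, rfl⟩ := B.exists_eq_of_add r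
  rw [algebraMap_eq_fn, fn]
  exact add_mem (aeval_mem hk hx c) (mul_mem (aeval_mem hk hx d) (y_mem_of_x_mem hk hx))

theorem algebraMap_of_X_sub_C (a : k) : algebraMap B.CoordinateRing B.FunctionField
    (AdjoinRoot.of B.equation (X - C a)) = B.x - algebraMap k B.FunctionField a := by
  rw [← aeval_x]; simp

theorem algebraMap_root_sub (b : k) : algebraMap B.CoordinateRing B.FunctionField
    (AdjoinRoot.root B.equation - AdjoinRoot.of B.equation (C b)) =
      B.y - algebraMap k B.FunctionField b := by
  rw [map_sub, ← aeval_x]; simp [y]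

namespace IsCentered

variable {O : ValuationSubring B.FunctionField}

theorem valuation_lt_one (h : IsCentered O a b) (hab : B.OnCurve a b) {r : B.CoordinateRing}
    (hr : hab.ev r = 0) : O.valuation (algebraMap B.CoordinateRing B.FunctionField r) < 1 := by
  obtain ⟨u, w, huw⟩ := hab.exists_sub_ev_eq r
  rw [hr, map_zero, map_zero, zero_add] at huw
  rw [huw, map_add, map_mul, map_mul, algebraMap_of_X_sub_C, algebraMap_root_sub]
  have hu := (O.valuation_le_one_iff _).2 (algebraMap_mem_of_x_mem h.algebraMap_mem h.x_mem u)
  have hw := (O.valuation_le_one_iff _).2 (algebraMap_mem_of_x_mem h.algebraMap_mem h.x_mem w)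
  apply O.valuation.map_add_lt
  · rw [map_mul]; exact mul_lt_one_of_lt_of_le h.x_lt hu
  · rw [map_mul]; exact mul_lt_one_of_lt_of_le h.y_lt hw

theorem valuation_eq_one (h : IsCentered O a b) (hab : B.OnCurve a b) {r : B.CoordinateRing}
    (hr : hab.ev r ≠ 0) : O.valuation (algebraMap B.CoordinateRing B.FunctionField r) = 1 := by
  apply le_antisymm
    ((O.valuation_le_one_iff _).2 (algebraMap_mem_of_x_mem h.algebraMap_mem h.x_mem r))
  by_contra hlt
  rw [not_le] at hlt
  have h1 := h.valuation_lt_one hab (r := r - AdjoinRoot.of B.equation (C (hab.ev r)))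
    (by rw [map_sub, hab.ev_of, eval_C, sub_self])
  have h2 := O.valuation.map_sub_lt hlt h1
  rw [← map_sub, sub_sub_cancel, ← aeval_x, aeval_C] at h2
  have h3 := (O.valuation_le_one_iff _).2 (h.algebraMap_mem (hab.ev r)⁻¹)
  have h4 := mul_lt_one_of_lt_of_le h2 h3
  rw [← map_mul, ← map_mul, mul_inv_cancel₀ hr, map_one, map_one] at h4
  exact lt_irrefl _ h4

/-- The value of the equation at `(a, b)` is a combination of `x - a` and `y - b` with integral
coefficients. It is therefore a constant of valuation less than `1`, hence zero. -/
theorem onCurve (h : IsCentered O a b) : B.OnCurve a b := by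
  by_contra hne
  have hc : b ^ 2 + B.h.eval a * b - B.f.eval a ≠ 0 := sub_ne_zero.2 hne
  obtain ⟨h₁, hh⟩ := X_sub_C_dvd_sub_C_eval (a := a) (p := B.h)
  obtain ⟨f₁, hf⟩ := X_sub_C_dvd_sub_C_eval (a := a) (p := B.f)
  rw [sub_eq_iff_eq_add] at hh hf
  have hh' := congrArg (aeval B.x) hh
  have hf' := congrArg (aeval B.x) hf
  simp only [map_add, map_mul, map_sub, aeval_X, aeval_C] at hh' hf'
  have e : algebraMap k B.FunctionField (b ^ 2 + B.h.eval a * b - B.f.eval a) =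
      (B.x - algebraMap k B.FunctionField a) * (aeval B.x f₁ - B.y * aeval B.x h₁) -
      (B.y - algebraMap k B.FunctionField b) *
        (B.y + algebraMap k B.FunctionField b + algebraMap k B.FunctionField (B.h.eval a)) := by
    have := B.y_sq
    simp only [map_add, map_mul, map_sub, map_pow]
    linear_combination this - B.y * hh' + hf'
  have hA := (O.valuation_le_one_iff _).2 (sub_mem (aeval_mem h.algebraMap_mem h.x_mem f₁)
    (mul_mem h.y_mem (aeval_mem h.algebraMap_mem h.x_mem h₁)))
  have hB := (O.valuation_le_one_iff _).2 (add_mem (add_mem h.y_mem (h.algebraMap_mem b))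
    (h.algebraMap_mem (B.h.eval a)))
  have h2 : O.valuation (algebraMap k B.FunctionField
      (b ^ 2 + B.h.eval a * b - B.f.eval a)) < 1 := by
    rw [e]
    apply O.valuation.map_sub_lt
    · rw [map_mul]; exact mul_lt_one_of_lt_of_le h.x_lt hA
    · rw [map_mul]; exact mul_lt_one_of_lt_of_le h.y_lt hB
  have h3 := (O.valuation_le_one_iff _).2
    (h.algebraMap_mem (b ^ 2 + B.h.eval a * b - B.f.eval a)⁻¹)
  have h4 := mul_lt_one_of_lt_of_le h2 h3
  rw [← map_mul, ← map_mul, mul_inv_cancel₀ hc, map_one, map_one] at h4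
  exact lt_irrefl _ h4

end IsCentered

/-- The kernel of evaluation at `(a, b)` is a proper ideal of the coordinate ring, so some valuation
ring of the function field contains the coordinate ring and has this ideal among its nonunits. -/
theorem OnCurve.exists_isCentered (hab : B.OnCurve a b) :
    ∃ O : ValuationSubring B.FunctionField, IsCentered O a b := by
  let A := (algebraMap B.CoordinateRing B.FunctionField).range
  let e : B.CoordinateRing ≃+* A :=
    RingEquiv.ofBijective (algebraMap B.CoordinateRing B.FunctionField).rangeRestrict
      ⟨fun r s hrs => IsFractionRing.injective B.CoordinateRing B.FunctionField
        (congrArg Subtype.val hrs), RingHom.rangeRestrict_surjective _⟩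
  obtain ⟨O, hO, hI⟩ := Ideal.image_subset_nonunits_valuationSubring
    (RingHom.ker (hab.ev.comp e.symm.toRingHom)) (RingHom.ker_ne_top _)
  have hev : ∀ r : B.CoordinateRing, hab.ev r = 0 →
      O.valuation (algebraMap B.CoordinateRing B.FunctionField r) < 1 := by
    intro r hr
    rw [← ValuationSubring.mem_nonunits_iff]
    refine hI ⟨e r, ?_, rfl⟩
    simpa [RingHom.mem_ker] using hr
  refine ⟨O, fun c => hO ⟨AdjoinRoot.of B.equation (C c), ?_⟩, ?_, ?_⟩
  · rw [← aeval_x, aeval_C]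
  · rw [← algebraMap_of_X_sub_C]
    exact hev _ (by simp [hab.ev_of])
  · rw [← algebraMap_root_sub]
    exact hev _ (by simp [hab.ev_of, hab.ev_root])

end HyperellipticCurve

/-! ### Points of the curve and affine solutions -/

namespace HyperellipticCurve

variable {k : Type*} [Field k] [CharZero k] {B : HyperellipticCurve k} {a b : k}

namespace OnCurve

variable {hab : B.OnCurve a b} {π : B.CoordinateRing} {e : ℕ}

theorem ne_zero_of_ev_ne_zero (hab : B.OnCurve a b) {s : B.CoordinateRing} (hs : hab.ev s ≠ 0) :
    s ≠ 0 := by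
  rintro rfl; simp at hs

theorem IsUniformizer.ne_zero (hπ : hab.IsUniformizer π e) : π ≠ 0 := by
  rintro rfl
  obtain ⟨s, t, hs, ht, hst⟩ := hπ.exists_mul_eq_pow
  rw [zero_pow hπ.e_pos.ne', zero_mul, mul_eq_zero] at hst
  rcases hst with h | h
  · exact hab.ne_zero_of_ev_ne_zero hs h
  · exact X_sub_C_ne_zero a (of_injective (by rw [h, map_zero]))

/-- Division by `π` is repeated: either a cofactor that does not vanish at the point appears, or `m`
divisions succeed. -/
theorem IsUniformizer.exists_mul_eq_pow_or (hπ : hab.IsUniformizer π e) (r : B.CoordinateRing)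
    (m : ℕ) : (∃ n s t, hab.ev s ≠ 0 ∧ hab.ev t ≠ 0 ∧ s * r = π ^ n * t) ∨
      ∃ s t, hab.ev s ≠ 0 ∧ s * r = π ^ m * t := by
  induction m with
  | zero => exact Or.inr ⟨1, r, by simp, by simp⟩
  | succ m ih =>
    rcases ih with h | ⟨s, t, hs, hst⟩
    · exact Or.inl h
    · by_cases ht : hab.ev t = 0
      · obtain ⟨s', t', hs', ht'⟩ := hπ.exists_mul_eq t ht
        refine Or.inr ⟨s' * s, t', by rw [map_mul]; exact mul_ne_zero hs' hs, ?_⟩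
        rw [mul_assoc, hst, mul_left_comm, ht', pow_succ, mul_assoc]
      · exact Or.inl ⟨m, s, t, hs, ht, hst⟩

theorem IsUniformizer.valuation_eq (hab : B.OnCurve a b)
    {O : ValuationSubring B.FunctionField} (hO : IsCentered O a b)
    {r s t : B.CoordinateRing} {n : ℕ} (hs : hab.ev s ≠ 0) (ht : hab.ev t ≠ 0)
    (h : s * r = π ^ n * t) :
    O.valuation (algebraMap B.CoordinateRing B.FunctionField r) =
      O.valuation (algebraMap B.CoordinateRing B.FunctionField π) ^ n := by
  have := congrArg (fun z => O.valuation (algebraMap B.CoordinateRing B.FunctionField z)) h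
  simpa only [map_mul, map_pow, hO.valuation_eq_one hab hs, hO.valuation_eq_one hab ht, one_mul,
    mul_one] using this

theorem IsUniformizer.exists_factor (hπ : hab.IsUniformizer π e)
    {O : ValuationSubring B.FunctionField} (hO : IsCentered O a b) {r : B.CoordinateRing}
    (hr : r ≠ 0) : ∃ n s t, hab.ev s ≠ 0 ∧ hab.ev t ≠ 0 ∧ s * r = π ^ n * t := by
  obtain ⟨c, d, rfl⟩ := B.exists_eq_of_add r
  have hcd : B.fn c d ≠ 0 := by
    rwa [← algebraMap_eq_fn, Ne, map_eq_zero_iff _ (IsFractionRing.injective _ _)]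
  have hN := B.normPoly_ne_zero hcd
  obtain ⟨N', hN1, hN2⟩ := exists_eq_pow_rootMultiplicity_mul_and_not_dvd _ hN a
  rw [dvd_iff_isRoot, IsRoot.def] at hN2
  set m := (B.normPoly c d).rootMultiplicity a
  -- The norm of `r` is `(x - a)^m` times a local unit, so it has order `e * m`. As the conjugate of
  -- `r` is integral, `r` cannot be divisible by a higher power of `π`.
  rcases hπ.exists_mul_eq_pow_or _ (e * m + 1) with h | ⟨s, t, hs, hst⟩
  · exact h
  exfalso
  have h0 : O.valuation (algebraMap B.CoordinateRing B.FunctionField π) ≠ 0 := by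
    simpa using hπ.ne_zero
  have h1 := hO.valuation_lt_one hab hπ.ev_eq_zero
  have h2 := congrArg (fun z => O.valuation (algebraMap B.CoordinateRing B.FunctionField z)) hst
  simp only [map_mul, map_pow, hO.valuation_eq_one hab hs, one_mul, algebraMap_eq_fn] at h2
  have ht := (O.valuation_le_one_iff _).2 (algebraMap_mem_of_x_mem hO.algebraMap_mem hO.x_mem t)
  obtain ⟨s', t', hs', ht', hst'⟩ := hπ.exists_mul_eq_pow
  have h3 := IsUniformizer.valuation_eq hab hO hs' ht' hst'
  have h4 := congrArg O.valuation (B.fn_mul_conj c d)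
  rw [hN1, aeval_x, map_mul (AdjoinRoot.of B.equation), map_mul, map_mul, map_mul, map_pow,
    map_pow, map_pow, h3, hO.valuation_eq_one hab (r := AdjoinRoot.of B.equation N')
      (by rwa [hab.ev_of]), mul_one, ← pow_mul, ← algebraMap_eq_fn B (c - d * B.h)] at h4
  have h5 := (O.valuation_le_one_iff _).2 (algebraMap_mem_of_x_mem hO.algebraMap_mem hO.x_mem
    (AdjoinRoot.of B.equation (c - d * B.h) +
      AdjoinRoot.of B.equation (-d) * AdjoinRoot.root B.equation))
  have h6 : O.valuation (algebraMap B.CoordinateRing B.FunctionField π) ^ (e * m) ≤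
      O.valuation (algebraMap B.CoordinateRing B.FunctionField π) ^ (e * m + 1) := by
    rw [← h4]
    refine (mul_le_of_le_one_right' h5).trans ?_
    rw [h2]
    exact mul_le_of_le_one_right' ht
  exact absurd h6 (not_le.2 (pow_lt_pow_right_of_lt_one₀ (zero_lt_iff.2 h0) h1 (Nat.lt_succ_self _)))

/-- Every nonzero function is a power of a uniformizer times a unit; this does not depend on the
valuation ring. -/
theorem IsUniformizer.exists_zpow (hπ : hab.IsUniformizer π e) {g : B.FunctionField}
    (hg : g ≠ 0) : ∃ n : ℤ, ∀ O : ValuationSubring B.FunctionField, IsCentered O a b →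
      O.valuation g = O.valuation (algebraMap B.CoordinateRing B.FunctionField π) ^ n := by
  obtain ⟨O', hO'⟩ := hab.exists_isCentered
  obtain ⟨r, s, hs, rfl⟩ := IsFractionRing.div_surjective (A := B.CoordinateRing) g
  have hr : r ≠ 0 := by rintro rfl; simp at hg
  obtain ⟨n, s₁, t₁, hs₁, ht₁, h₁⟩ := hπ.exists_factor hO' hr
  obtain ⟨m, s₂, t₂, hs₂, ht₂, h₂⟩ := hπ.exists_factor hO' (nonZeroDivisors.ne_zero hs)
  refine ⟨n - m, fun O hO => ?_⟩
  have h0 : O.valuation (algebraMap B.CoordinateRing B.FunctionField π) ≠ 0 := by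
    simpa using hπ.ne_zero
  rw [map_div₀, IsUniformizer.valuation_eq hab hO hs₁ ht₁ h₁,
    IsUniformizer.valuation_eq hab hO hs₂ ht₂ h₂, zpow_sub₀ h0, zpow_natCast, zpow_natCast]

/-- The exponent in `IsUniformizer.exists_zpow` is the same for all valuation rings centered at `(a,
b)`. So they all coincide, and the common ring is discrete. -/
theorem exists_isAffinePoint (hab : B.OnCurve a b) : ∃ v : B.Point, B.IsAffinePoint v a b := by
  obtain ⟨π, e, hπ⟩ : ∃ π e, hab.IsUniformizer π e := by
    rcases hab.isUniformizer_or with h | h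
    · exact ⟨_, _, h.2⟩
    · exact ⟨_, _, h.2⟩
  obtain ⟨O, hO⟩ := hab.exists_isCentered
  have hπ0 : algebraMap B.CoordinateRing B.FunctionField π ≠ 0 := by simpa using hπ.ne_zero
  have hDVR := O.isDiscreteValuationRing_of_valuation_eq_zpow hπ0
    (hO.valuation_lt_one hab hπ.ev_eq_zero)
    (fun g hg => (hπ.exists_zpow hg).imp fun n hn => hn O hO)
  refine ⟨⟨O, hO.algebraMap_mem, hDVR⟩, fun v => ⟨fun hv => ?_, ?_⟩⟩
  · have hv' : IsCentered v.ring a b := ⟨v.algebraMap_mem, hv.1, hv.2⟩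
    ext g
    show g ∈ v.ring ↔ g ∈ O
    by_cases hg : g = 0
    · simp [hg]
    obtain ⟨n, hn⟩ := hπ.exists_zpow hg
    have h1 : 0 < O.valuation (algebraMap B.CoordinateRing B.FunctionField π) := by
      rw [zero_lt_iff]; simpa using hπ.ne_zero
    have h2 : 0 < v.ring.valuation (algebraMap B.CoordinateRing B.FunctionField π) := by
      rw [zero_lt_iff]; simpa using hπ.ne_zero
    rw [← v.ring.valuation_le_one_iff, ← O.valuation_le_one_iff, hn _ hO, hn _ hv',
      zpow_le_one_iff_right_of_lt_one₀ h1 (hO.valuation_lt_one hab hπ.ev_eq_zero),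
      zpow_le_one_iff_right_of_lt_one₀ h2 (hv'.valuation_lt_one hab hπ.ev_eq_zero)]
  · rintro rfl
    exact ⟨hO.x_lt, hO.y_lt⟩

end OnCurve

namespace IsAffinePoint

variable {v : B.Point}

theorem isCentered (hv : B.IsAffinePoint v a b) : IsCentered v.ring a b :=
  ⟨v.algebraMap_mem, ((hv v).2 rfl).1, ((hv v).2 rfl).2⟩

theorem onCurve (hv : B.IsAffinePoint v a b) : B.OnCurve a b := hv.isCentered.onCurve

theorem ord_uniformizer (hv : B.IsAffinePoint v a b) {π : B.CoordinateRing} {e : ℕ}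
    (hπ : hv.onCurve.IsUniformizer π e) :
    v.ord (algebraMap B.CoordinateRing B.FunctionField π) = 1 ∧
      v.ord (B.x - algebraMap k B.FunctionField a) = e := by
  have hπ0 : algebraMap B.CoordinateRing B.FunctionField π ≠ 0 := by simpa using hπ.ne_zero
  have h1 := v.ord_eq_one_of_valuation_eq_zpow hπ0
    (hv.isCentered.valuation_lt_one hv.onCurve hπ.ev_eq_zero)
    (fun g hg => (hπ.exists_zpow hg).imp fun n hn => hn _ hv.isCentered)
  refine ⟨h1, ?_⟩
  obtain ⟨s, t, hs, ht, hst⟩ := hπ.exists_mul_eq_pow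
  have h2 := OnCurve.IsUniformizer.valuation_eq _ hv.isCentered hs ht hst
  rw [algebraMap_of_X_sub_C, ← map_pow] at h2
  rw [v.ord_eq_of_valuation_eq ?_ (pow_ne_zero _ hπ0) h2, v.ord_pow hπ0, h1, mul_one]
  rw [← algebraMap_of_X_sub_C, ← aeval_x]
  exact B.aeval_x_ne_zero (X_sub_C_ne_zero a)

theorem ord_x_sub (hv : B.IsAffinePoint v a b) (h : 2 * b + B.h.eval a ≠ 0) :
    v.ord (B.x - algebraMap k B.FunctionField a) = 1 := by
  rcases hv.onCurve.isUniformizer_or with h' | h'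
  · exact_mod_cast (hv.ord_uniformizer h'.2).2
  · exact absurd h'.1 h

theorem ord_x_sub_of_ramified (hv : B.IsAffinePoint v a b) (h : 2 * b + B.h.eval a = 0) :
    v.ord (B.x - algebraMap k B.FunctionField a) = 2 ∧
      v.ord (B.y - algebraMap k B.FunctionField b) = 1 := by
  rcases hv.onCurve.isUniformizer_or with h' | h'
  · exact absurd h h'.1
  · rw [← algebraMap_root_sub]
    exact ⟨by exact_mod_cast (hv.ord_uniformizer h'.2).2, (hv.ord_uniformizer h'.2).1⟩

theorem x_mem (hv : B.IsAffinePoint v a b) : B.x ∈ v.ring := hv.isCentered.x_mem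

theorem valuation_fn_lt_one_iff (hv : B.IsAffinePoint v a b) (c d : k[X]) :
    v.ring.valuation (B.fn c d) < 1 ↔ c.eval a + d.eval a * b = 0 := by
  have e : hv.onCurve.ev (AdjoinRoot.of B.equation c +
      AdjoinRoot.of B.equation d * AdjoinRoot.root B.equation) = c.eval a + d.eval a * b := by
    simp [OnCurve.ev_of, OnCurve.ev_root]
  rw [← algebraMap_eq_fn, ← e]
  refine ⟨fun h => ?_, hv.isCentered.valuation_lt_one _⟩
  by_contra hne
  exact h.ne (hv.isCentered.valuation_eq_one _ hne)

end IsAffinePoint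

theorem fn_mem {v : B.Point} (hx : B.x ∈ v.ring) (c d : k[X]) : B.fn c d ∈ v.ring := by
  rw [← algebraMap_eq_fn]
  exact algebraMap_mem_of_x_mem v.algebraMap_mem hx _

theorem IsPointAtInfinity.x_mem_iff {q : B.Point} (hq : B.IsPointAtInfinity q) {v : B.Point} :
    B.x ∈ v.ring ↔ v ≠ q := by
  rw [Ne, ← hq v, not_not]

theorem OnCurve.conj (hab : B.OnCurve a b) : B.OnCurve a (-b - B.h.eval a) := by
  rw [OnCurve, ← hab]; ring

section AlgClosed

variable [IsAlgClosed k]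

theorem exists_onCurve (B : HyperellipticCurve k) (a : k) : ∃ b, B.OnCurve a b := by
  obtain ⟨z, hz⟩ := IsAlgClosed.exists_eq_mul_self (B.h.eval a ^ 2 + 4 * B.f.eval a)
  refine ⟨(z - B.h.eval a) / 2, ?_⟩
  rw [OnCurve]
  field_simp
  linear_combination -hz

/-- Over an algebraically closed field the polynomial splits, and a product of integral elements is
a nonunit only if one of its linear factors is. -/
theorem exists_valuation_x_sub_lt_one {O : ValuationSubring B.FunctionField}
    (hk : ∀ c : k, algebraMap k B.FunctionField c ∈ O) (hx : B.x ∈ O) (n : ℕ) :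
    ∀ p : k[X], p.natDegree = n → p ≠ 0 → O.valuation (aeval B.x p) < 1 →
      ∃ a, O.valuation (B.x - algebraMap k B.FunctionField a) < 1 := by
  induction n with
  | zero =>
    intro p hp h0 hlt
    rw [eq_C_of_natDegree_eq_zero hp, aeval_C] at hlt
    have hc : p.coeff 0 ≠ 0 := by
      intro h; apply h0; rw [eq_C_of_natDegree_eq_zero hp, h, C_0]
    have h3 := (O.valuation_le_one_iff _).2 (hk (p.coeff 0)⁻¹)
    have h4 := mul_lt_one_of_lt_of_le hlt h3
    rw [← map_mul, ← map_mul, mul_inv_cancel₀ hc, map_one, map_one] at h4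
    exact absurd h4 (lt_irrefl _)
  | succ n ih =>
    intro p hp h0 hlt
    obtain ⟨a, ha⟩ := IsAlgClosed.exists_root p
      (by rw [degree_eq_natDegree h0, hp]; exact_mod_cast Nat.succ_ne_zero n)
    obtain ⟨p', rfl⟩ := dvd_iff_isRoot.2 ha
    by_cases hlt' : O.valuation (B.x - algebraMap k B.FunctionField a) < 1
    · exact ⟨a, hlt'⟩
    · have hp' : p' ≠ 0 := right_ne_zero_of_mul h0
      refine ih p' ?_ hp' ?_
      · rw [natDegree_mul (X_sub_C_ne_zero a) hp', natDegree_X_sub_C] at hp; omega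
      · have e1 := le_antisymm ((O.valuation_le_one_iff _).2 (sub_mem hx (hk a))) (not_lt.1 hlt')
        rw [map_mul, map_mul, map_sub, aeval_X, aeval_C, e1, one_mul] at hlt
        exact hlt

/-- A uniformizer written as `(c + d y)/s` shows that some `c + d y` vanishes at `v`. Its norm then
vanishes too, which locates a root `a` of `x`. Since `x - a` divides the product of `y - b` and `y +
b + h(a)`, one of these vanishes at `v`. -/
theorem exists_isAffinePoint_of_x_mem {v : B.Point} (hx : B.x ∈ v.ring) :
    ∃ a b, B.IsAffinePoint v a b := by
  obtain ⟨g, hg, hg1⟩ := v.exists_ord_eq_one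
  obtain ⟨c, d, s, hs, rfl⟩ := B.exists_eq_fn_div g
  have hcd : B.fn c d ≠ 0 := by rintro h; simp [h] at hg
  have hs' := B.aeval_x_ne_zero hs
  rw [v.ord_div hcd hs'] at hg1
  have h1 := v.ord_nonneg_of_mem (aeval_mem v.algebraMap_mem hx s)
  have h2 : 0 < v.ord (B.fn c d) := by omega
  rw [v.ord_pos_iff hcd] at h2
  have h3 := (v.ring.valuation_le_one_iff _).2 (fn_mem hx (c - d * B.h) (-d))
  have h4 := mul_lt_one_of_lt_of_le h2 h3
  rw [← map_mul, fn_mul_conj] at h4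
  obtain ⟨a, ha⟩ := exists_valuation_x_sub_lt_one v.algebraMap_mem hx _ _ rfl
    (B.normPoly_ne_zero hcd) h4
  obtain ⟨b, hb⟩ := B.exists_onCurve a
  have hy := y_mem_of_x_mem v.algebraMap_mem hx
  have key : v.ring.valuation ((B.y - algebraMap k B.FunctionField b) *
      (B.y - algebraMap k B.FunctionField (-b - B.h.eval a))) < 1 := by
    obtain ⟨h₁, hh⟩ := X_sub_C_dvd_sub_C_eval (a := a) (p := B.h)
    obtain ⟨f₁, hf⟩ := X_sub_C_dvd_sub_C_eval (a := a) (p := B.f)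
    rw [sub_eq_iff_eq_add] at hh hf
    have hh' := congrArg (aeval B.x) hh
    have hf' := congrArg (aeval B.x) hf
    simp only [map_add, map_mul, map_sub, aeval_X, aeval_C] at hh' hf'
    have hb' := congrArg (algebraMap k B.FunctionField) hb
    simp only [map_add, map_mul, map_pow] at hb'
    have e : (B.y - algebraMap k B.FunctionField b) *
        (B.y - algebraMap k B.FunctionField (-b - B.h.eval a)) =
        (B.x - algebraMap k B.FunctionField a) * (aeval B.x f₁ - B.y * aeval B.x h₁) := by
      have := B.y_sq
      simp only [map_sub, map_neg]
      linear_combination this - B.y * hh' + hf' - hb'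
    rw [e, map_mul]
    exact mul_lt_one_of_lt_of_le ha ((v.ring.valuation_le_one_iff _).2
      (sub_mem (aeval_mem v.algebraMap_mem hx f₁)
        (mul_mem hy (aeval_mem v.algebraMap_mem hx h₁))))
  have hex : ∃ b, B.OnCurve a b ∧ v.ring.valuation (B.y - algebraMap k B.FunctionField b) < 1 := by
    by_cases h5 : v.ring.valuation (B.y - algebraMap k B.FunctionField b) < 1
    · exact ⟨b, hb, h5⟩
    · refine ⟨_, hb.conj, ?_⟩
      have e1 := le_antisymm ((v.ring.valuation_le_one_iff _).2 (sub_mem hy (v.algebraMap_mem b)))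
        (not_lt.1 h5)
      rwa [map_mul, e1, one_mul] at key
  obtain ⟨b, hb, hb'⟩ := hex
  obtain ⟨w, hw⟩ := hb.exists_isAffinePoint
  have : v = w := (hw v).1 ⟨ha, hb'⟩
  exact ⟨a, b, this ▸ hw⟩

end AlgClosed

end HyperellipticCurve

/-! ### Principal divisors and functions regular on the affine curve -/

theorem IsDivisorOf.mul {k K : Type*} [Field k] [Field K] [Algebra k K] {D₁ D₂ : CurveDivisor k K}
    {g₁ g₂ : K} (h₁ : IsDivisorOf D₁ g₁) (h₂ : IsDivisorOf D₂ g₂) :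
    IsDivisorOf (D₁ + D₂) (g₁ * g₂) :=
  ⟨mul_ne_zero h₁.1 h₂.1, fun v => by
    rw [Finsupp.add_apply, h₁.2, h₂.2, v.ord_mul h₁.1 h₂.1]⟩

theorem isDivisorOf_zero_algebraMap {k K : Type*} [Field k] [Field K] [Algebra k K] {c : k}
    (hc : c ≠ 0) : IsDivisorOf (0 : CurveDivisor k K) (algebraMap k K c) :=
  ⟨by simpa using hc, fun v => by rw [v.ord_algebraMap c]; rfl⟩

namespace HyperellipticCurve

variable {k : Type*} [Field k] [CharZero k] {B : HyperellipticCurve k} {a b : k}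

theorem x_sub_eq_fn (a : k) : B.x - algebraMap k B.FunctionField a = B.fn (X - C a) 0 := by
  rw [fn_zero_right]; simp

theorem y_sub_eq_fn (b : k) : B.y - algebraMap k B.FunctionField b = B.fn (-C b) 1 := by
  simp [fn]; ring

theorem x_sub_ne_zero (a : k) : B.x - algebraMap k B.FunctionField a ≠ 0 := by
  rw [x_sub_eq_fn, Ne, fn_eq_zero_iff]
  exact fun h => X_sub_C_ne_zero a h.1

theorem y_sub_ne_zero (b : k) : B.y - algebraMap k B.FunctionField b ≠ 0 := by
  rw [y_sub_eq_fn, Ne, fn_eq_zero_iff]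
  exact fun h => one_ne_zero h.2

theorem IsAffinePoint.coord_eq {v : B.Point} (hv : B.IsAffinePoint v a b) {a' b' : k}
    (hv' : B.IsAffinePoint v a' b') : a = a' ∧ b = b' := by
  have h1 := hv'.isCentered.x_lt
  have h2 := hv'.isCentered.y_lt
  rw [x_sub_eq_fn, hv.valuation_fn_lt_one_iff] at h1
  rw [y_sub_eq_fn, hv.valuation_fn_lt_one_iff] at h2
  simp only [eval_sub, eval_X, eval_C, eval_zero, zero_mul, add_zero, eval_neg, eval_one,
    one_mul] at h1 h2
  exact ⟨sub_eq_zero.1 h1, by linear_combination h2⟩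

theorem IsAffinePoint.ext {v w : B.Point} (hv : B.IsAffinePoint v a b)
    (hw : B.IsAffinePoint w a b) : v = w :=
  (hw v).1 ((hv v).2 rfl)

theorem IsAffinePoint.ord_aeval_eq_zero {v : B.Point} (hv : B.IsAffinePoint v a b) {p : k[X]}
    (hp : p.eval a ≠ 0) : v.ord (aeval B.x p) = 0 := by
  have h0 : p ≠ 0 := by rintro rfl; simp at hp
  have h1 := v.ord_nonneg_of_mem (aeval_mem v.algebraMap_mem hv.x_mem p)
  have h2 : ¬ 0 < v.ord (aeval B.x p) := by
    rw [v.ord_pos_iff (B.aeval_x_ne_zero h0), ← fn_zero_right, hv.valuation_fn_lt_one_iff]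
    simpa using hp
  omega

theorem OnCurve.eq_or_eq_conj (hab : B.OnCurve a b) {b' : k} (hab' : B.OnCurve a b') :
    b' = b ∨ b' = -b - B.h.eval a := by
  have : (b' - b) * (b' - (-b - B.h.eval a)) = 0 := by
    have h1 : b ^ 2 + B.h.eval a * b = B.f.eval a := hab
    have h2 : b' ^ 2 + B.h.eval a * b' = B.f.eval a := hab'
    linear_combination h2 - h1
  rcases mul_eq_zero.1 this with h | h
  · exact Or.inl (sub_eq_zero.1 h)
  · exact Or.inr (sub_eq_zero.1 h)

section AlgClosed

variable [IsAlgClosed k] {q : B.Point}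

theorem isDivisorOf_x_sub (hq : B.IsPointAtInfinity q) {v w : B.Point}
    (hv : B.IsAffinePoint v a b) (hw : B.IsAffinePoint w a (-b - B.h.eval a)) :
    IsDivisorOf (Finsupp.single v 1 + Finsupp.single w 1 - Finsupp.single q 2)
      (B.x - algebraMap k B.FunctionField a) := by
  classical
  refine ⟨x_sub_ne_zero a, fun u => ?_⟩
  have hvq : v ≠ q := hq.x_mem_iff.1 hv.x_mem
  have hwq : w ≠ q := hq.x_mem_iff.1 hw.x_mem
  simp only [Finsupp.sub_apply, Finsupp.add_apply]
  by_cases huq : u = q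
  · subst huq
    have hne := x_sub_ne_zero (B := B) a
    rw [x_sub_eq_fn] at hne ⊢
    rw [hq.ord_fn hne, poleOrder, if_pos rfl, natDegree_X_sub_C, Finsupp.single_eq_of_ne hvq.symm,
      Finsupp.single_eq_of_ne hwq.symm, Finsupp.single_eq_same]
    rfl
  rw [Finsupp.single_eq_of_ne huq, sub_zero]
  obtain ⟨a', b', hu⟩ := exists_isAffinePoint_of_x_mem (hq.x_mem_iff.2 huq)
  by_cases ha : a' = a
  · subst ha
    rcases hv.onCurve.eq_or_eq_conj hu.onCurve with rfl | rfl
    · obtain rfl := hu.ext hv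
      by_cases h0 : 2 * b' + B.h.eval a' = 0
      · have e : -b' - B.h.eval a' = b' := by linear_combination -h0
        rw [e] at hw
        rw [hw.ext hu, Finsupp.single_eq_same, (hu.ord_x_sub_of_ramified h0).1]
        rfl
      · have hne : u ≠ w := by
          rintro rfl
          apply h0
          linear_combination (hu.coord_eq hw).2
        rw [Finsupp.single_eq_same, Finsupp.single_eq_of_ne hne, hu.ord_x_sub h0]
        rfl
    · obtain rfl := hu.ext hw
      by_cases h0 : 2 * (-b - B.h.eval a') + B.h.eval a' = 0
      · have e : -b - B.h.eval a' = b := by linear_combination h0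
        rw [e] at h0 hu
        rw [hv.ext hu, Finsupp.single_eq_same, (hu.ord_x_sub_of_ramified h0).1]
        rfl
      · have hne : u ≠ v := by
          rintro rfl
          apply h0
          linear_combination (hu.coord_eq hv).2
        rw [Finsupp.single_eq_same, Finsupp.single_eq_of_ne hne, hu.ord_x_sub h0]
        rfl
  · have huv : u ≠ v := by rintro rfl; exact ha (hu.coord_eq hv).1
    have huw : u ≠ w := by rintro rfl; exact ha (hu.coord_eq hw).1
    rw [Finsupp.single_eq_of_ne huv, Finsupp.single_eq_of_ne huw]
    have := hu.ord_aeval_eq_zero (p := X - C a) (by simpa [sub_eq_zero] using ha)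
    rw [map_sub, aeval_X, aeval_C] at this
    rw [this]
    rfl

theorem exists_isDivisorOf_aeval (hq : B.IsPointAtInfinity q) (n : ℕ) :
    ∀ p : k[X], p.natDegree = n → p ≠ 0 →
      ∃ D : CurveDivisor k B.FunctionField, IsDivisorOf D (aeval B.x p) ∧ D.degree = 0 := by
  induction n with
  | zero =>
    intro p hp h0
    rw [eq_C_of_natDegree_eq_zero hp, aeval_C]
    exact ⟨0, isDivisorOf_zero_algebraMap fun h => h0 (by
      rw [eq_C_of_natDegree_eq_zero hp, h, C_0]), by simp⟩
  | succ n ih =>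
    intro p hp h0
    obtain ⟨a, ha⟩ := IsAlgClosed.exists_root p
      (by rw [degree_eq_natDegree h0, hp]; exact_mod_cast Nat.succ_ne_zero n)
    obtain ⟨p', rfl⟩ := dvd_iff_isRoot.2 ha
    have hp' : p' ≠ 0 := right_ne_zero_of_mul h0
    obtain ⟨D, hD, hD0⟩ := ih p' (by
      rw [natDegree_mul (X_sub_C_ne_zero a) hp', natDegree_X_sub_C] at hp; omega) hp'
    obtain ⟨b, hb⟩ := B.exists_onCurve a
    obtain ⟨v, hv⟩ := hb.exists_isAffinePoint
    obtain ⟨w, hw⟩ := hb.conj.exists_isAffinePoint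
    refine ⟨Finsupp.single v 1 + Finsupp.single w 1 - Finsupp.single q 2 + D, ?_, ?_⟩
    · rw [map_mul, map_sub, aeval_X, aeval_C]
      exact (isDivisorOf_x_sub hq hv hw).mul hD
    · rw [map_add, hD0, map_sub, map_add]
      simp

/-- The divisor plus its image under the hyperelliptic involution is the divisor of the norm, a
product of functions `x - a` and a constant, hence of degree `0`. The involution preserves degree,
so twice the degree vanishes. The norm also shows that the support is finite. -/
theorem exists_isDivisorOf_fn (hq : B.IsPointAtInfinity q) {c d : k[X]} (h : B.fn c d ≠ 0) :
    ∃ D : CurveDivisor k B.FunctionField, IsDivisorOf D (B.fn c d) ∧ D.degree = 0 := by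
  classical
  obtain ⟨E, hE, hE0⟩ := exists_isDivisorOf_aeval hq _ _ rfl (B.normPoly_ne_zero h)
  have h' : B.fn (c - d * B.h) (-d) ≠ 0 := by
    intro h0
    have := B.fn_mul_conj c d
    rw [h0, mul_zero] at this
    exact B.aeval_x_ne_zero (B.normPoly_ne_zero h) this.symm
  have hmul : ∀ v : B.Point, v.ord (B.fn c d) + v.ord (B.fn (c - d * B.h) (-d)) = E v := by
    intro v
    rw [hE.2, ← fn_mul_conj, v.ord_mul h h']
  have hfin : ∀ v : B.Point, v.ord (B.fn c d) ≠ 0 → v ∈ insert q E.support := by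
    intro v hv
    rw [Finset.mem_insert, Finsupp.mem_support_iff]
    by_contra hcon
    rw [not_or, not_not] at hcon
    have hx := hq.x_mem_iff.2 hcon.1
    have h1 := v.ord_nonneg_of_mem (fn_mem hx c d)
    have h2 := v.ord_nonneg_of_mem (fn_mem hx (c - d * B.h) (-d))
    have := hmul v
    omega
  let D : CurveDivisor k B.FunctionField :=
    Finsupp.onFinset (insert q E.support) (fun v => v.ord (B.fn c d)) hfin
  have hD : IsDivisorOf D (B.fn c d) := ⟨h, fun v => Finsupp.onFinset_apply⟩
  let τ : B.Point ≃ B.Point :=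
    { toFun := CurvePoint.comap B.involution
      invFun := CurvePoint.comap B.involution.symm
      left_inv := fun v => by
        ext g; simp [CurvePoint.mem_comap_ring]
      right_inv := fun v => by
        ext g; simp [CurvePoint.mem_comap_ring] }
  have hsum : D + Finsupp.mapDomain τ.symm D = E := by
    ext v
    rw [Finsupp.add_apply, Finsupp.mapDomain_equiv_apply, hD.2, hD.2, ← hmul, ← involution_fn]
    congr 1
    exact CurvePoint.ord_comap _ _ h
  refine ⟨D, hD, ?_⟩
  have hdeg := congrArg Finsupp.degree hsum
  rw [map_add, Finsupp.degree_mapDomain, hE0] at hdeg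
  omega

/-- If the fibre over `a` has two points, then `c(a) + d(a) b = 0` at both, which gives `d(a) = 0`.
At a ramified point `x - a` has order `2` and `y - b` order `1`. Writing `c + d y = (x - a) p + d (y
- b)`, a value `d(a) ≠ 0` would force order `1`. -/
theorem dvd_of_div_mem {c d : k[X]}
    (h : ∀ v : B.Point, B.x ∈ v.ring →
      B.fn c d / (B.x - algebraMap k B.FunctionField a) ∈ v.ring) :
    (X - C a) ∣ c ∧ (X - C a) ∣ d := by
  by_cases hcd : B.fn c d = 0
  · rw [fn_eq_zero_iff] at hcd
    rw [hcd.1, hcd.2]; simp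
  obtain ⟨b, hb⟩ := B.exists_onCurve a
  have hzero : ∀ {b}, B.OnCurve a b → c.eval a + d.eval a * b = 0 := by
    intro b hb
    obtain ⟨v, hv⟩ := hb.exists_isAffinePoint
    rw [← hv.valuation_fn_lt_one_iff, ← v.ord_pos_iff hcd]
    have h1 := v.ord_nonneg_of_mem (h v hv.x_mem)
    rw [v.ord_div hcd (x_sub_ne_zero a)] at h1
    have h2 := (v.ord_pos_iff (x_sub_ne_zero a)).2 hv.isCentered.x_lt
    omega
  have hd : d.eval a = 0 := by
    by_cases h0 : 2 * b + B.h.eval a = 0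
    · by_contra hd
      obtain ⟨v, hv⟩ := hb.exists_isAffinePoint
      obtain ⟨hx2, hy1⟩ := hv.ord_x_sub_of_ramified h0
      have h1 := v.ord_nonneg_of_mem (h v hv.x_mem)
      rw [v.ord_div hcd (x_sub_ne_zero a), hx2] at h1
      obtain ⟨p, hp⟩ := dvd_iff_isRoot.2 (show IsRoot (c + C b * d) a by
        have := hzero hb
        simp only [IsRoot.def, eval_add, eval_mul, eval_C]
        linear_combination this)
      have hd0 : d ≠ 0 := by rintro rfl; simp at hd
      have e : B.fn c d + -((B.x - algebraMap k B.FunctionField a) * aeval B.x p) =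
          aeval B.x d * (B.y - algebraMap k B.FunctionField b) := by
        have := congrArg (aeval B.x) hp
        simp only [map_add, map_mul, map_sub, aeval_X, aeval_C] at this
        rw [← this, fn]; ring
      have h2 : (2 : ℤ) ≤ v.ord (aeval B.x d * (B.y - algebraMap k B.FunctionField b)) := by
        rw [← e]
        refine v.le_ord_add (fun _ => by omega) (fun hne => ?_) ?_
        · rw [v.ord_neg, v.ord_mul (x_sub_ne_zero a) (right_ne_zero_of_mul (neg_ne_zero.1 hne)), hx2]
          have := v.ord_nonneg_of_mem (aeval_mem v.algebraMap_mem hv.x_mem p)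
          omega
        · rw [e]; exact mul_ne_zero (B.aeval_x_ne_zero hd0) (y_sub_ne_zero b)
      rw [v.ord_mul (B.aeval_x_ne_zero hd0) (y_sub_ne_zero b), hy1, hv.ord_aeval_eq_zero hd] at h2
      omega
    · have h1 := hzero hb
      have h2 := hzero hb.conj
      have : d.eval a * (2 * b + B.h.eval a) = 0 := by linear_combination h1 - h2
      exact (mul_eq_zero.1 this).resolve_right h0
  have hc := hzero hb
  rw [hd, zero_mul, add_zero] at hc
  exact ⟨dvd_iff_isRoot.2 hc, dvd_iff_isRoot.2 hd⟩

theorem exists_eq_fn_of_mem (n : ℕ) : ∀ c d s : k[X], s.natDegree = n → s ≠ 0 →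
    (∀ v : B.Point, B.x ∈ v.ring → B.fn c d / aeval B.x s ∈ v.ring) →
      ∃ c' d', B.fn c d / aeval B.x s = B.fn c' d' := by
  induction n with
  | zero =>
    intro c d s hs h0 _
    have hc : s.coeff 0 ≠ 0 := fun h => h0 (by rw [eq_C_of_natDegree_eq_zero hs, h, C_0])
    refine ⟨C (s.coeff 0)⁻¹ * c, C (s.coeff 0)⁻¹ * d, ?_⟩
    rw [eq_C_of_natDegree_eq_zero hs]
    simp only [coeff_C_zero, fn, map_mul, aeval_C, map_inv₀]
    field_simp
  | succ n ih =>
    intro c d s hs h0 h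
    obtain ⟨a, ha⟩ := IsAlgClosed.exists_root s
      (by rw [degree_eq_natDegree h0, hs]; exact_mod_cast Nat.succ_ne_zero n)
    obtain ⟨s', rfl⟩ := dvd_iff_isRoot.2 ha
    have hs' : s' ≠ 0 := right_ne_zero_of_mul h0
    have hs'x := B.aeval_x_ne_zero hs'
    have ha0 := x_sub_ne_zero (B := B) a
    obtain ⟨⟨c', rfl⟩, ⟨d', rfl⟩⟩ := dvd_of_div_mem (B := B) (a := a) (c := c) (d := d) (by
      intro v hv
      have := mul_mem (h v hv) (aeval_mem v.algebraMap_mem hv s')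
      rw [map_mul, map_sub, aeval_X, aeval_C] at this
      convert this using 1
      field_simp)
    have e : B.fn ((X - C a) * c') ((X - C a) * d') / aeval B.x ((X - C a) * s') =
        B.fn c' d' / aeval B.x s' := by
      simp only [fn, map_mul, map_sub, aeval_X, aeval_C]
      field_simp
    rw [e] at h ⊢
    exact ih c' d' s' (by
      rw [natDegree_mul (X_sub_C_ne_zero a) hs', natDegree_X_sub_C] at hs; omega) hs' h

/-- This is the normality of the affine curve: the linear factors of the denominator cancel one
after another by `dvd_of_div_mem`. -/
theorem exists_eq_fn {g : B.FunctionField} (h : ∀ v : B.Point, B.x ∈ v.ring → g ∈ v.ring) :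
    ∃ c d, g = B.fn c d := by
  obtain ⟨c, d, s, hs, rfl⟩ := B.exists_eq_fn_div g
  exact exists_eq_fn_of_mem _ c d s rfl hs h

end AlgClosed

end HyperellipticCurve

/-! ### Divisor classes and the sets `Θ_d` -/

section Jacobian

variable {k K : Type*} [Field k] [Field K] [Algebra k K]

theorem exists_eq_sum_single {σ : Type*} (d : ℕ) : ∀ D : σ →₀ ℤ, (∀ v, 0 ≤ D v) →
    D.degree = d → ∃ p : Fin d → σ, D = ∑ i, Finsupp.single (p i) 1 := by
  classical
  induction d with
  | zero =>
    intro D h0 hd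
    refine ⟨Fin.elim0, ?_⟩
    rw [Finsupp.degree_apply, Nat.cast_zero, Finset.sum_eq_zero_iff_of_nonneg (fun v _ => h0 v)] at hd
    ext v
    by_cases hv : v ∈ D.support
    · simpa using hd v hv
    · simpa using hv
  | succ d ih =>
    intro D h0 hd
    obtain ⟨v, hv⟩ : ∃ v, 0 < D v := by
      by_contra hcon
      push Not at hcon
      have : D = 0 := Finsupp.ext fun v => le_antisymm (hcon v) (h0 v)
      rw [this, map_zero] at hd
      push_cast at hd
      omega
    obtain ⟨p, hp⟩ := ih (D - Finsupp.single v 1) (fun w => by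
      by_cases hw : w = v
      · subst hw; simp; omega
      · simpa [Finsupp.single_eq_of_ne hw] using h0 w) (by
      rw [map_sub, hd, Finsupp.degree_single]; push_cast; ring)
    refine ⟨Fin.cons v p, ?_⟩
    rw [Fin.sum_univ_succ]
    simp only [Fin.cons_zero, Fin.cons_succ]
    rw [← hp]; abel

theorem curveJacobian_mk_eq_zero_iff (y : degreeZeroDivisors k K) :
    (QuotientAddGroup.mk y : CurveJacobian k K) = 0 ↔ ∃ g : K, IsDivisorOf (y : CurveDivisor k K) g := by
  rw [QuotientAddGroup.eq_zero_iff, AddSubgroup.mem_addSubgroupOf]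
  rfl

/-- The divisor `p - q`. -/
noncomputable def pointDiff (p q : CurvePoint k K) : degreeZeroDivisors k K :=
  ⟨Finsupp.single p 1 - Finsupp.single q 1, by simp [degreeZeroDivisors, AddMonoidHom.mem_ker]⟩

theorem pointClass_eq_mk (p q : CurvePoint k K) :
    pointClass p q = QuotientAddGroup.mk' _ (pointDiff p q) := rfl

/-- Written as a vanishing sum, the condition on the points `r i` asks for a function with poles
only at `q`; this is why `-(j • [p - q])` is what gets represented in `Θ_d`. -/
theorem sum_pointClass_add_eq_zero_iff {d : ℕ} (r : Fin d → CurvePoint k K) (p q : CurvePoint k K)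
    (j : ℕ) : ∑ i, pointClass (r i) q + j • pointClass p q = 0 ↔
      ∃ g : K, IsDivisorOf (∑ i, Finsupp.single (r i) 1 + Finsupp.single p (j : ℤ) -
        Finsupp.single q ((d : ℤ) + j)) g := by
  simp only [pointClass_eq_mk, ← map_sum, ← map_nsmul, ← map_add]
  rw [QuotientAddGroup.mk'_apply, curveJacobian_mk_eq_zero_iff]
  have e : ((∑ i, pointDiff (r i) q + j • pointDiff p q : degreeZeroDivisors k K) :
      CurveDivisor k K) = ∑ i, Finsupp.single (r i) 1 + Finsupp.single p (j : ℤ) -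
        Finsupp.single q ((d : ℤ) + j) := by
    simp only [AddSubgroup.coe_add, AddSubgroup.val_finsetSum, AddSubgroup.coe_nsmul, pointDiff,
      Finset.sum_sub_distrib, smul_sub, Finset.sum_const, Finset.card_univ, Fintype.card_fin,
      Finsupp.smul_single, Finsupp.single_add]
    simp
    abel
  rw [e]

theorem pointClass_self (q : CurvePoint k K) : pointClass q q = 0 := by
  rw [pointClass_eq_mk, pointDiff]
  simp only [sub_self]
  exact map_zero _

theorem zero_mem_Theta (q : CurvePoint k K) (d : ℕ) : (0 : CurveJacobian k K) ∈ Theta q d :=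
  ⟨fun _ => q, by simp [pointClass_self]⟩

theorem smul_mem_Theta (p q : CurvePoint k K) (d : ℕ) : d • pointClass p q ∈ Theta q d :=
  ⟨fun _ => p, by simp⟩

theorem ne_zero_of_mem_ThetaStrict {q : CurvePoint k K} {d : ℕ} {z : CurveJacobian k K}
    (hd : d ≠ 0) (hz : z ∈ ThetaStrict q d) : z ≠ 0 := by
  obtain ⟨d, rfl⟩ := Nat.exists_eq_succ_of_ne_zero hd
  rintro rfl
  exact hz.2 (zero_mem_Theta q d)

end Jacobian

/-! ### Torsion functions and the criterion for `j [p - q] ∈ Θ_d` -/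

namespace HyperellipticCurve

variable {k : Type*} [Field k] [CharZero k] {B : HyperellipticCurve k} {p q : B.Point}

theorem IsAffinePoint.ord_x (hp : B.IsAffinePoint p 0 0) (hh : B.h.eval 0 ≠ 0) :
    p.ord B.x = 1 := by
  simpa using hp.ord_x_sub (by simpa using hh)

theorem x_ne_zero : B.x ≠ 0 := by simpa using x_sub_ne_zero (B := B) 0

theorem IsAffinePoint.le_ord_aeval_iff (hp : B.IsAffinePoint p 0 0) (hh : B.h.eval 0 ≠ 0)
    {c : k[X]} (hc : c ≠ 0) (j : ℕ) : (j : ℤ) ≤ p.ord (aeval B.x c) ↔ X ^ j ∣ c := by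
  obtain ⟨c', hc1, hc2⟩ := exists_eq_pow_rootMultiplicity_mul_and_not_dvd c hc 0
  rw [dvd_iff_isRoot, IsRoot.def] at hc2
  have h1 : p.ord (aeval B.x c) = c.rootMultiplicity 0 := by
    conv_lhs => rw [hc1]
    have hc' : c' ≠ 0 := by rintro rfl; simp at hc2
    rw [C_0, sub_zero, map_mul, map_pow, aeval_X, p.ord_mul (pow_ne_zero _ x_ne_zero)
      (B.aeval_x_ne_zero hc'), p.ord_pow x_ne_zero, hp.ord_x hh, hp.ord_aeval_eq_zero hc2]
    ring
  rw [h1, Nat.cast_le, le_rootMultiplicity_iff hc, C_0, sub_zero]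

/-- A presentation `f = θ x^m + s x^(2m)` with `θ² - s h² = -x^n`, which makes the function
`h y - θ x^m` vanish only at `(0, 0)`. -/
structure TorsionPresentation (B : HyperellipticCurve k) (m n : ℕ) (θ s : k[X]) : Prop where
  m_pos : 0 < m
  eval_h : B.h.eval 0 ≠ 0
  f_eq : B.f = θ * X ^ m + s * X ^ (2 * m)
  norm_eq : θ ^ 2 - s * B.h ^ 2 = -X ^ n

namespace TorsionPresentation

variable {m n : ℕ} {θ s : k[X]}

theorem onCurve (hB : TorsionPresentation B m n θ s) : B.OnCurve 0 0 := by
  simp [OnCurve, hB.f_eq, hB.m_pos.ne']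

theorem fn_ne_zero (hB : TorsionPresentation B m n θ s) : B.fn (-(θ * X ^ m)) B.h ≠ 0 := by
  rw [Ne, fn_eq_zero_iff]
  rintro ⟨-, h⟩
  apply hB.eval_h; rw [h, eval_zero]

theorem normPoly_eq (hB : TorsionPresentation B m n θ s) :
    B.normPoly (-(θ * X ^ m)) B.h = -X ^ (2 * m + n) := by
  rw [normPoly, hB.f_eq]
  linear_combination X ^ (2 * m) * hB.norm_eq

end TorsionPresentation

section AlgClosed

variable [IsAlgClosed k]

/-- The conjugate point works: `x - a` has divisor `v + w - 2q`. -/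
theorem exists_pointClass_eq_neg (hq : B.IsPointAtInfinity q) (v : B.Point) :
    ∃ w : B.Point, pointClass w q = -pointClass v q := by
  by_cases hv : v = q
  · exact ⟨q, by rw [hv, pointClass_self, neg_zero]⟩
  obtain ⟨a, b, hab⟩ := exists_isAffinePoint_of_x_mem (hq.x_mem_iff.2 hv)
  obtain ⟨w, hw⟩ := hab.onCurve.conj.exists_isAffinePoint
  refine ⟨w, eq_neg_of_add_eq_zero_left ?_⟩
  have := (sum_pointClass_add_eq_zero_iff (fun _ : Fin 1 => w) v q 1).2
    ⟨_, by
      have h := isDivisorOf_x_sub hq hab hw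
      convert h using 1
      simp [add_comm]⟩
  simpa using this

theorem neg_mem_Theta (hq : B.IsPointAtInfinity q) {d : ℕ} {z : CurveJacobian k B.FunctionField}
    (hz : z ∈ Theta q d) : -z ∈ Theta q d := by
  obtain ⟨r, rfl⟩ := hz
  choose σ hσ using exists_pointClass_eq_neg hq
  exact ⟨fun i => σ (r i), by simp [hσ]⟩

theorem neg_mem_Theta_iff (hq : B.IsPointAtInfinity q) {d : ℕ}
    {z : CurveJacobian k B.FunctionField} : -z ∈ Theta q d ↔ z ∈ Theta q d :=
  ⟨fun h => by simpa using neg_mem_Theta hq h, neg_mem_Theta hq⟩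

theorem neg_mem_ThetaStrict (hq : B.IsPointAtInfinity q) {d : ℕ}
    {z : CurveJacobian k B.FunctionField} (hz : z ∈ ThetaStrict q d) : -z ∈ ThetaStrict q d := by
  cases d with
  | zero => exact neg_mem_Theta hq hz
  | succ d => exact ⟨neg_mem_Theta hq hz.1, fun h => hz.2 ((neg_mem_Theta_iff hq).1 h)⟩

/-- After negation, membership asks for a function with divisor `r₁ + ⋯ + r_d + j p - (d + j) q`.
Such a function is regular on the affine curve, hence of the form `a + b y`. Conversely, the two
inequalities make `div + (d + j) q - j p` effective of degree `d`. -/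
theorem smul_mem_Theta_iff_exists_fn (hq : B.IsPointAtInfinity q) (hpq : p ≠ q) (d j : ℕ) :
    j • pointClass p q ∈ Theta q d ↔ ∃ a b : k[X], B.fn a b ≠ 0 ∧ B.poleOrder a b ≤ d + j ∧
      (j : ℤ) ≤ p.ord (B.fn a b) := by
  classical
  rw [← neg_mem_Theta_iff hq]
  have hiff : -(j • pointClass p q) ∈ Theta q d ↔ ∃ r : Fin d → B.Point,
      ∑ i, pointClass (r i) q + j • pointClass p q = 0 := by
    simp only [Theta, Set.mem_range, add_eq_zero_iff_eq_neg]
  rw [hiff]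
  constructor
  · rintro ⟨r, hr⟩
    rw [sum_pointClass_add_eq_zero_iff] at hr
    obtain ⟨g, hg0, hg⟩ := hr
    have hnonneg : ∀ v : B.Point, 0 ≤ (∑ i, Finsupp.single (r i) (1 : ℤ)) v := fun v => by
      rw [Finsupp.finsetSum_apply]
      refine Finset.sum_nonneg fun i _ => ?_
      rw [Finsupp.single_apply]; split_ifs <;> simp
    obtain ⟨a, b, rfl⟩ := exists_eq_fn (g := g) (by
      intro v hv
      rw [hq.x_mem_iff] at hv
      rw [← v.ord_nonneg_iff hg0, ← hg, Finsupp.sub_apply, Finsupp.add_apply,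
        Finsupp.single_eq_of_ne hv, sub_zero]
      refine add_nonneg (hnonneg v) ?_
      rw [Finsupp.single_apply]; split_ifs <;> simp)
    refine ⟨a, b, hg0, ?_, ?_⟩
    · have h1 := hg q
      rw [hq.ord_fn hg0, Finsupp.sub_apply, Finsupp.add_apply, Finsupp.single_eq_of_ne hpq.symm,
        Finsupp.single_eq_same] at h1
      have := hnonneg q
      omega
    · rw [← hg, Finsupp.sub_apply, Finsupp.add_apply, Finsupp.single_eq_of_ne hpq,
        Finsupp.single_eq_same]
      have := hnonneg p
      omega
  · rintro ⟨a, b, h0, hpole, hord⟩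
    obtain ⟨D, hD, hdeg⟩ := exists_isDivisorOf_fn hq h0
    obtain ⟨r, hr⟩ := exists_eq_sum_single d
      (D - Finsupp.single p (j : ℤ) + Finsupp.single q ((d : ℤ) + j)) (fun v => by
        rw [Finsupp.add_apply, Finsupp.sub_apply, hD.2]
        by_cases hvq : v = q
        · subst hvq
          rw [hq.ord_fn h0, Finsupp.single_eq_of_ne hpq.symm, Finsupp.single_eq_same]
          omega
        · rw [Finsupp.single_eq_of_ne hvq]
          by_cases hvp : v = p
          · subst hvp; rw [Finsupp.single_eq_same]; omega
          · rw [Finsupp.single_eq_of_ne hvp]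
            have := v.ord_nonneg_of_mem (fn_mem (hq.x_mem_iff.2 hvq) a b)
            omega) (by
        rw [map_add, map_sub, hdeg, Finsupp.degree_single, Finsupp.degree_single]; ring)
    refine ⟨r, (sum_pointClass_add_eq_zero_iff r p q j).2 ⟨B.fn a b, ?_⟩⟩
    rw [← hr]
    convert hD using 1
    abel

namespace TorsionPresentation

variable {m n : ℕ} {θ s : k[X]}

/-- The norm `-x^(2m+n)` confines the zeros to the fibre over `0`. At `p` the conjugate function is
nonzero, so all of the norm's order falls on the function itself; at the conjugate of `p` the
function is nonzero. Degree zero fixes the coefficient of `q`. -/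
theorem isDivisorOf (hB : TorsionPresentation B m n θ s) (hp : B.IsAffinePoint p 0 0)
    (hq : B.IsPointAtInfinity q) :
    IsDivisorOf ((2 * m + n) • (Finsupp.single p 1 - Finsupp.single q 1))
      (B.fn (-(θ * X ^ m)) B.h) := by
  classical
  obtain ⟨D, hD, hdeg⟩ := exists_isDivisorOf_fn hq hB.fn_ne_zero
  have hconj := B.fn_mul_conj (-(θ * X ^ m)) B.h
  rw [hB.normPoly_eq, map_neg, map_pow, aeval_X] at hconj
  have h0 := hB.fn_ne_zero
  have hx0 := x_ne_zero (B := B)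
  have h0' : B.fn (-(θ * X ^ m) - B.h * B.h) (-B.h) ≠ 0 := by
    intro h
    rw [h, mul_zero] at hconj
    exact neg_ne_zero.2 (pow_ne_zero _ hx0) hconj.symm
  have hsum : ∀ v : B.Point, v.ord (B.fn (-(θ * X ^ m)) B.h) +
      v.ord (B.fn (-(θ * X ^ m) - B.h * B.h) (-B.h)) = (2 * m + n : ℕ) * v.ord B.x := fun v => by
    rw [← v.ord_mul h0 h0', hconj, v.ord_neg, v.ord_pow hx0]
  have hpq : p ≠ q := hq.x_mem_iff.1 hp.x_mem
  have hDp : D p = (2 * m + n : ℕ) := by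
    have h1 := hsum p
    have h2 : ¬ 0 < p.ord (B.fn (-(θ * X ^ m) - B.h * B.h) (-B.h)) := by
      rw [p.ord_pos_iff h0', hp.valuation_fn_lt_one_iff]
      simpa [hB.m_pos.ne'] using hB.eval_h
    have h3 := p.ord_nonneg_of_mem (fn_mem hp.x_mem (-(θ * X ^ m) - B.h * B.h) (-B.h))
    rw [hp.ord_x hB.eval_h] at h1
    rw [hD.2]
    omega
  have hDv : ∀ v, v ≠ p → v ≠ q → D v = 0 := by
    intro v hvp hvq
    have hx := hq.x_mem_iff.2 hvq
    obtain ⟨a, b, hv⟩ := exists_isAffinePoint_of_x_mem hx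
    rw [hD.2]
    have h3 := v.ord_nonneg_of_mem (fn_mem hx (-(θ * X ^ m)) B.h)
    by_cases ha : a = 0
    · subst ha
      rcases hB.onCurve.eq_or_eq_conj hv.onCurve with rfl | rfl
      · exact absurd (hv.ext hp) hvp
      · have h2 : ¬ 0 < v.ord (B.fn (-(θ * X ^ m)) B.h) := by
          rw [v.ord_pos_iff h0, hv.valuation_fn_lt_one_iff]
          simpa [hB.m_pos.ne'] using hB.eval_h
        omega
    · have h1 := hsum v
      have h2 := hv.ord_aeval_eq_zero (p := X) (by simpa using ha)
      rw [aeval_X] at h2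
      have h4 := v.ord_nonneg_of_mem (fn_mem hx (-(θ * X ^ m) - B.h * B.h) (-B.h))
      rw [h2, mul_zero] at h1
      omega
  have hDeq : D = Finsupp.single p ((2 * m + n : ℕ) : ℤ) + Finsupp.single q (D q) := by
    ext v
    rw [Finsupp.add_apply]
    by_cases hvp : v = p
    · subst hvp
      rw [Finsupp.single_eq_same, Finsupp.single_eq_of_ne hpq, hDp, add_zero]
    · by_cases hvq : v = q
      · subst hvq
        rw [Finsupp.single_eq_same, Finsupp.single_eq_of_ne hpq.symm, zero_add]
      · rw [Finsupp.single_eq_of_ne hvp, Finsupp.single_eq_of_ne hvq, hDv v hvp hvq, add_zero]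
  rw [hDeq, map_add, Finsupp.degree_single, Finsupp.degree_single] at hdeg
  have e : (2 * m + n) • (Finsupp.single p 1 - Finsupp.single q 1) = D := by
    rw [hDeq, eq_neg_of_add_eq_zero_right hdeg, Finsupp.single_neg, ← sub_eq_add_neg, smul_sub,
      Finsupp.smul_single, Finsupp.smul_single]
    simp
  rw [e]
  exact hD

theorem smul_eq_zero (hB : TorsionPresentation B m n θ s) (hp : B.IsAffinePoint p 0 0)
    (hq : B.IsPointAtInfinity q) : (2 * m + n) • pointClass p q = 0 := by
  rw [pointClass_eq_mk, ← map_nsmul, QuotientAddGroup.mk'_apply, curveJacobian_mk_eq_zero_iff]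
  exact ⟨_, hB.isDivisorOf hp hq⟩

/-- The identity `h (a + b y) = (a h + b θ x^m) + b (h y - θ x^m)` removes `y`: its last term
vanishes to order at least `2m + n ≥ j`. Since `h` is a unit and `x` a uniformizer at `p`, the
condition becomes divisibility by `X ^ j`. -/
theorem le_ord_fn_iff (hB : TorsionPresentation B m n θ s) (hp : B.IsAffinePoint p 0 0)
    (hq : B.IsPointAtInfinity q) {a b : k[X]} (hab : B.fn a b ≠ 0) {j : ℕ} (hj : j ≤ 2 * m + n) :
    (j : ℤ) ≤ p.ord (B.fn a b) ↔ X ^ j ∣ a * B.h + b * θ * X ^ m := by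
  classical
  have hpq : p ≠ q := hq.x_mem_iff.1 hp.x_mem
  have hh0 : B.h ≠ 0 := by
    intro h; apply hB.eval_h; rw [h, eval_zero]
  have hhx := B.aeval_x_ne_zero hh0
  have h1 : (j : ℤ) ≤ p.ord (B.fn a b) ↔ (j : ℤ) ≤ p.ord (aeval B.x B.h * B.fn a b) := by
    rw [p.ord_mul hhx hab, hp.ord_aeval_eq_zero hB.eval_h, zero_add]
  have hg : (j : ℤ) ≤ p.ord (B.fn (-(θ * X ^ m)) B.h) := by
    rw [← (hB.isDivisorOf hp hq).2]
    simp [Finsupp.single_eq_of_ne hpq]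
    exact_mod_cast hj
  have hbg : aeval B.x b * B.fn (-(θ * X ^ m)) B.h ≠ 0 →
      (j : ℤ) ≤ p.ord (aeval B.x b * B.fn (-(θ * X ^ m)) B.h) := fun hne => by
    rw [p.ord_mul (left_ne_zero_of_mul hne) hB.fn_ne_zero]
    have := p.ord_nonneg_of_mem (aeval_mem p.algebraMap_mem hp.x_mem b)
    omega
  have e : aeval B.x B.h * B.fn a b = aeval B.x (a * B.h + b * θ * X ^ m) +
      aeval B.x b * B.fn (-(θ * X ^ m)) B.h := by
    simp only [fn, map_add, map_mul, map_neg]; ring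
  rw [h1]
  constructor
  · intro h
    by_cases hc : a * B.h + b * θ * X ^ m = 0
    · rw [hc]; exact dvd_zero _
    rw [← hp.le_ord_aeval_iff hB.eval_h hc]
    have e' : aeval B.x (a * B.h + b * θ * X ^ m) = aeval B.x B.h * B.fn a b +
      -(aeval B.x b * B.fn (-(θ * X ^ m)) B.h) := by rw [e]; ring
    rw [e']
    refine p.le_ord_add (fun _ => h) (fun hne => ?_) (by rw [← e']; exact B.aeval_x_ne_zero hc)
    rw [p.ord_neg]
    exact hbg (neg_ne_zero.1 hne)
  · intro h
    rw [e]
    refine p.le_ord_add (fun hne => ?_) hbg (by rw [← e]; exact mul_ne_zero hhx hab)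
    have hc : a * B.h + b * θ * X ^ m ≠ 0 := by
      intro h0; rw [h0, map_zero] at hne; exact hne rfl
    rwa [hp.le_ord_aeval_iff hB.eval_h hc]

theorem smul_mem_Theta_iff (hB : TorsionPresentation B m n θ s) (hp : B.IsAffinePoint p 0 0)
    (hq : B.IsPointAtInfinity q) {j : ℕ} (hj : j ≤ 2 * m + n) (d : ℕ) :
    j • pointClass p q ∈ Theta q d ↔ ∃ a b : k[X], (a ≠ 0 ∨ b ≠ 0) ∧ 2 * a.natDegree ≤ d + j ∧
      (b ≠ 0 → 2 * b.natDegree + 2 * B.genus + 1 ≤ d + j) ∧ X ^ j ∣ a * B.h + b * θ * X ^ m := by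
  rw [smul_mem_Theta_iff_exists_fn hq (hq.x_mem_iff.1 hp.x_mem)]
  refine exists_congr fun a => exists_congr fun b => ?_
  have h1 : B.fn a b ≠ 0 ↔ (a ≠ 0 ∨ b ≠ 0) := by rw [Ne, fn_eq_zero_iff]; tauto
  have h2 : B.poleOrder a b ≤ d + j ↔ 2 * a.natDegree ≤ d + j ∧
      (b ≠ 0 → 2 * b.natDegree + 2 * B.genus + 1 ≤ d + j) := by
    rw [poleOrder]
    split_ifs with hb <;> simp [hb]
  rw [h2, and_assoc, ← h1]
  exact and_congr_right fun hab => by rw [hB.le_ord_fn_iff hp hq hab hj]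

end TorsionPresentation

end AlgClosed

end HyperellipticCurve

/-! ### From the criterion to Padé problems and profiles -/

namespace HyperellipticCurve.TorsionPresentation

variable {k : Type*} [Field k] [CharZero k] {B : HyperellipticCurve k}
  {p q : B.Point} {m n : ℕ} {θ s : k[X]}

theorem isCoprime_X_pow_h (hB : TorsionPresentation B m n θ s) (j : ℕ) :
    IsCoprime (X ^ j) B.h := by
  apply IsCoprime.pow_left
  rw [(prime_X (R := k)).irreducible.coprime_iff_not_dvd, X_dvd_iff, coeff_zero_eq_eval_zero]
  exact hB.eval_h

variable [IsAlgClosed k]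

/-- A pole of order at most `2γ` excludes `y`, so `b = 0`. Then `X ^ j ∣ a`, while `deg a ≤ (d +
j)/2 < j`. -/
theorem notMem_Theta_of_add_le (hB : TorsionPresentation B m n θ s) (hp : B.IsAffinePoint p 0 0)
    (hq : B.IsPointAtInfinity q) {j d : ℕ} (hj : j ≤ 2 * m + n) (hdj : d < j)
    (h : d + j ≤ 2 * B.genus) : j • pointClass p q ∉ Theta q d := by
  rw [hB.smul_mem_Theta_iff hp hq hj]
  rintro ⟨a, b, hab, ha, hb, hdvd⟩
  have hb0 : b = 0 := by
    by_contra hne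
    have := hb hne
    omega
  subst hb0
  rw [zero_mul, zero_mul, add_zero] at hdvd
  have h1 := (hB.isCoprime_X_pow_h j).dvd_of_dvd_mul_right hdvd
  have h2 := natDegree_le_of_dvd h1 (by simpa using hab)
  rw [natDegree_X_pow] at h2
  omega

theorem mem_ThetaStrict_of_le_genus (hB : TorsionPresentation B m n θ s)
    (hp : B.IsAffinePoint p 0 0) (hq : B.IsPointAtInfinity q) {j : ℕ} (hj : j ≤ 2 * m + n)
    (h : j ≤ B.genus) : j • pointClass p q ∈ ThetaStrict q j := by
  cases j with
  | zero => exact smul_mem_Theta p q 0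
  | succ j =>
    exact ⟨smul_mem_Theta p q _, hB.notMem_Theta_of_add_le hp hq hj (by omega) (by omega)⟩

/-- As `h(0) ≠ 0`, the divisibility forces `X ^ m ∣ a`. The quantified `a` is the quotient by `X ^
m`, which accounts for `natDegree + m` in its bound. -/
theorem notMem_Theta (hB : TorsionPresentation B m n θ s) (hp : B.IsAffinePoint p 0 0)
    (hq : B.IsPointAtInfinity q) {j d : ℕ} (hj : j ≤ 2 * m + n) (hm : m ≤ j)
    (h : ∀ a b : k[X], (a ≠ 0 → 2 * (a.natDegree + m) ≤ d + j) →
      (b ≠ 0 → 2 * b.natDegree + 2 * B.genus + 1 ≤ d + j) →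
      X ^ (j - m) ∣ a * B.h + b * θ → a = 0 ∧ b = 0) : j • pointClass p q ∉ Theta q d := by
  rw [hB.smul_mem_Theta_iff hp hq hj]
  rintro ⟨a, b, hab, ha, hb, hdvd⟩
  have hX : (X : k[X]) ^ m ≠ 0 := pow_ne_zero _ X_ne_zero
  obtain ⟨a, rfl⟩ : X ^ m ∣ a := by
    refine (hB.isCoprime_X_pow_h m).dvd_of_dvd_mul_right ?_
    rw [← dvd_add_left (Dvd.intro_left _ rfl : X ^ m ∣ b * θ * X ^ m)]
    exact (pow_dvd_pow _ hm).trans hdvd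
  have e : X ^ m * a * B.h + b * θ * X ^ m = X ^ m * (a * B.h + b * θ) := by ring
  rw [e, ← Nat.add_sub_cancel' hm, pow_add, mul_dvd_mul_iff_left hX] at hdvd
  obtain ⟨rfl, rfl⟩ := h a b (fun h0 => by
    rw [natDegree_mul hX h0, natDegree_X_pow] at ha; omega) hb hdvd
  simp at hab

theorem mem_Theta (hB : TorsionPresentation B m n θ s) (hp : B.IsAffinePoint p 0 0)
    (hq : B.IsPointAtInfinity q) {j d : ℕ} (hj : j ≤ 2 * m + n) (hm : m ≤ j) (a b : k[X])
    (hb0 : b ≠ 0) (ha : 2 * (a.natDegree + m) ≤ d + j)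
    (hb : 2 * b.natDegree + 2 * B.genus + 1 ≤ d + j)
    (h : X ^ (j - m) ∣ a * B.h + b * θ) : j • pointClass p q ∈ Theta q d := by
  rw [hB.smul_mem_Theta_iff hp hq hj]
  refine ⟨X ^ m * a, b, Or.inr hb0, ?_, fun _ => hb, ?_⟩
  · have := natDegree_mul_le (p := X ^ m) (q := a)
    rw [natDegree_X_pow] at this
    omega
  · have e : X ^ m * a * B.h + b * θ * X ^ m = X ^ m * (a * B.h + b * θ) := by ring
    rw [e, ← Nat.add_sub_cancel' hm, pow_add]
    exact mul_dvd_mul_left _ h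

/-- Multiples up to `M = (N - 1)/2` suffice: `N - j` is handled by negation, and larger `j` by
periodicity. A multiple lying in a stratum of nonzero index is nonzero, so no smaller `j > 0` kills
the class. -/
theorem addOrderOf_and_isMultiplicationProfile (hB : TorsionPresentation B m n θ s)
    (hp : B.IsAffinePoint p 0 0) (hq : B.IsPointAtInfinity q) {M : ℕ} (hM : 2 * m + n = 2 * M + 1)
    (hγ : B.genus + 1 ≤ M) {c : List ℕ} (h1 : (B.genus + 1) • pointClass p q ∈ Theta q B.genus)
    (h2 : ∀ i, B.genus + 2 ≤ i → i ≤ M → c.getD (i - (B.genus + 2)) 0 ≠ 0 ∧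
      i • pointClass p q ∈ ThetaStrict q (c.getD (i - (B.genus + 2)) 0)) :
    addOrderOf (pointClass p q) = 2 * m + n ∧ IsMultiplicationProfile q (pointClass p q)
      (profileDeterminedBy B.genus (2 * m + n) c) := by
  set x := pointClass p q
  set e : ℕ → ℕ := fun i => if i ≤ B.genus then i else if i = B.genus + 1 then B.genus
    else c.getD (i - (B.genus + 2)) 0 with he
  have hN : (2 * m + n) • x = 0 := hB.smul_eq_zero hp hq
  have hγ2 := B.two_le_genus
  have base : ∀ i, i ≤ M → i • x ∈ ThetaStrict q (e i) ∧ (i ≠ 0 → e i ≠ 0) := by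
    intro i hi
    by_cases hi1 : i ≤ B.genus
    · simp only [he, if_pos hi1]
      exact ⟨hB.mem_ThetaStrict_of_le_genus hp hq (by omega) hi1, id⟩
    by_cases hi2 : i = B.genus + 1
    · subst hi2
      simp only [he, if_neg hi1, if_true]
      refine ⟨?_, fun _ => by omega⟩
      obtain ⟨γ, hγ'⟩ := Nat.exists_eq_succ_of_ne_zero (show B.genus ≠ 0 by omega)
      rw [hγ'] at h1 ⊢
      exact ⟨h1, hB.notMem_Theta_of_add_le hp hq (by omega) (by omega) (by omega)⟩
    · simp only [he, if_neg hi1, if_neg hi2]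
      exact ⟨(h2 i (by omega) hi).2, fun _ => (h2 i (by omega) hi).1⟩
  have hmod : ∀ j, j • x = (j % (2 * m + n)) • x := by
    intro j
    conv_lhs => rw [← Nat.mod_add_div j (2 * m + n), add_smul, mul_comm (2 * m + n) (j / _), mul_smul, hN, smul_zero,
      add_zero]
  have all : ∀ j, j • x ∈
      ThetaStrict q (e (min (j % (2 * m + n)) (2 * m + n - j % (2 * m + n)))) := by
    intro j
    rw [hmod j]
    have hlt := Nat.mod_lt j (show 0 < 2 * m + n by omega)
    generalize j % (2 * m + n) = i at hlt ⊢
    by_cases hi : i ≤ M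
    · rw [min_eq_left (by omega)]
      exact (base i hi).1
    · rw [min_eq_right (by omega)]
      have h3 : i • x = -((2 * m + n - i) • x) := by
        rw [eq_neg_iff_add_eq_zero, ← add_smul, Nat.add_sub_cancel' hlt.le, hN]
      rw [h3]
      exact neg_mem_ThetaStrict hq (base _ (by omega)).1
  refine ⟨?_, fun j _ => all j⟩
  rw [addOrderOf_eq_iff (by omega)]
  refine ⟨hN, fun j hj hj0 => ?_⟩
  refine ne_zero_of_mem_ThetaStrict ((base _ ?_).2 ?_) (all j)
  · rw [Nat.mod_eq_of_lt hj]; omega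
  · rw [Nat.mod_eq_of_lt hj]; omega

end HyperellipticCurve.TorsionPresentation

/-! ### Separability of the discriminants by reduction at a place above `2` -/

section Separability

variable {k : Type*} [Field k]

/-- There is a place of a field of characteristic zero above `2`: a valuation ring `O` with a map to
a field in which `2 = 0`. -/
theorem exists_place_above_two (k : Type*) [Field k] [CharZero k] :
    ∃ (O : ValuationSubring k) (ρ : O →+* IsLocalRing.ResidueField O),
      (2 : IsLocalRing.ResidueField O) = 0 ∧ ∀ t : k, (∃ r : O, algebraMap O k r = t) ∨
        ∃ u : O, t * algebraMap O k u = 1 ∧ ρ u = 0 := by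
  let A := (Int.castRingHom k).range
  have h2 : (2 : k) ∈ A := ⟨2, by simp⟩
  obtain ⟨O, hO, hI⟩ := Ideal.image_subset_nonunits_valuationSubring (A := A)
    (Ideal.span {⟨2, h2⟩}) (by
      rw [Ne, Ideal.span_singleton_eq_top]
      intro hu
      obtain ⟨⟨_, n, rfl⟩, hn⟩ := isUnit_iff_exists_inv.1 hu
      have h := congrArg Subtype.val hn
      have h' : ((2 * n : ℤ) : k) = (1 : ℤ) := by push_cast; exact h
      have := Int.cast_injective h'
      omega)
  refine ⟨O, IsLocalRing.residue O, ?_, fun t => ?_⟩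
  · have h3 : (2 : k) ∈ O.nonunits := hI ⟨⟨2, h2⟩, Ideal.subset_span rfl, rfl⟩
    rw [← map_ofNat (IsLocalRing.residue O) 2, IsLocalRing.residue_eq_zero_iff,
      O.valuation_lt_one_iff]
    exact O.mem_nonunits_iff.1 h3
  · by_cases ht : t ∈ O
    · exact Or.inl ⟨⟨t, ht⟩, rfl⟩
    right
    have h0 : t ≠ 0 := by rintro rfl; exact ht O.zero_mem
    have h1 : O.valuation t⁻¹ < 1 := by
      rw [map_inv₀]
      apply inv_lt_one_of_one_lt₀
      rwa [← not_le, O.valuation_le_one_iff]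
    refine ⟨⟨t⁻¹, (O.valuation_le_one_iff _).1 h1.le⟩, mul_inv_cancel₀ h0, ?_⟩
    rw [IsLocalRing.residue_eq_zero_iff, O.valuation_lt_one_iff]
    exact h1

/-- A double root `z = -t²` of `D` makes both `A(t) A(-t)` and its derivative vanish at `t`. The
roots of `A` are simple and never roots of `A(-t)`, which rules this out, also at `t = 0`. -/
theorem separable_of_comp_neg_sq [IsAlgClosed k] [CharZero k] {D A : k[X]}
    (hD : D.comp (-X ^ 2) = A * A.comp (-X))
    (hA : ∀ t, A.eval t = 0 → A.eval (-t) ≠ 0)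
    (hA' : ∀ t, A.eval t = 0 → (derivative A).eval t ≠ 0) : D.Separable := by
  rw [Polynomial.Separable, Polynomial.isCoprime_iff_aeval_ne_zero_of_isAlgClosed k k]
  intro z
  by_contra hcon
  push Not at hcon
  simp only [coe_aeval_eq_eval] at hcon
  obtain ⟨t, ht⟩ := IsAlgClosed.exists_pow_nat_eq (-z) (n := 2) two_pos
  have hz : z = -t ^ 2 := by rw [ht, neg_neg]
  have h1 := congrArg (eval t) hD
  have h2 := congrArg (fun p => eval t (derivative p)) hD
  simp only [derivative_comp, derivative_mul, eval_comp, eval_mul, eval_neg, eval_pow, eval_X,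
    eval_add, ← hz, hcon.1, hcon.2, mul_zero, derivative_neg, derivative_X, eval_one] at h1 h2
  have key : ∀ t, A.eval t = 0 → (derivative A).eval t * A.eval (-t) = 0 → False :=
    fun t h h' => (mul_ne_zero (hA' t h) (hA t h)) h'
  rcases mul_eq_zero.1 h1.symm with h | h
  · rw [h] at h2
    exact key t h (by linear_combination -h2)
  · rw [h] at h2
    exact key (-t) h (by rw [neg_neg]; linear_combination h2)

/-- With `x = -t²` one has `x + 1 = (1 - t)(1 + t)`, and the identities for `φ` and `θ` factor the
discriminant as `A(t) A(-t)` with `A = ψ² + 2(-1)^γ (1 + t) t^(2γ)`. Eliminating `t^(2γ)` between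
`A(t) = 0` and `A(-t) = 0` leaves `c t^i = 0`. The final hypothesis `h` excludes double roots of
`A`; it is the part that depends on arithmetic. -/
theorem separable_flynn_aux [CharZero k] [IsAlgClosed k] {γ : ℕ} {φ θ ψ : k[X]} {c : k} {i : ℕ}
    (hφ : φ.comp (-X ^ 2) = ψ * ψ.comp (-X))
    (hθ : 2 * θ.comp (-X ^ 2) = (1 - X) * ψ ^ 2 + (1 + X) * ψ.comp (-X) ^ 2)
    (hc : c ≠ 0) (hψc : (1 - X) * ψ ^ 2 - (1 + X) * ψ.comp (-X) ^ 2 = C c * X ^ i)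
    (hψ0 : ψ.eval 0 ≠ 0) (hψ1 : ψ.eval (-1) ≠ 0) (hγ : 0 < γ)
    (h : ∀ t : k, ψ.eval t ^ 2 = -2 * (-1) ^ γ * (1 + t) * t ^ (2 * γ) →
      2 * t * (1 + t) * (derivative ψ).eval t = (2 * γ + (2 * γ + 1) * t) * ψ.eval t → False) :
    (φ ^ 2 + 4 * (θ * X ^ γ * 1 + X ^ (2 * γ + 1) + X ^ (2 * γ))).Separable := by
  have hA : ∀ t : k, (ψ ^ 2 + 2 * (-1) ^ γ * (1 + X) * X ^ (2 * γ)).eval t =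
      ψ.eval t ^ 2 + 2 * (-1) ^ γ * (1 + t) * t ^ (2 * γ) := fun t => by simp
  refine separable_of_comp_neg_sq (A := ψ ^ 2 + 2 * (-1) ^ γ * (1 + X) * X ^ (2 * γ)) ?_ ?_ ?_
  · have e1 : (-X ^ 2 : k[X]) ^ γ = (-1) ^ γ * X ^ (2 * γ) := by rw [neg_pow, ← pow_mul]
    have e2 : (-X ^ 2 : k[X]) ^ (2 * γ) = X ^ (2 * γ) * X ^ (2 * γ) := by
      rw [pow_mul (-X ^ 2 : k[X]) 2 γ, neg_sq, ← pow_mul, ← pow_mul, ← pow_add]; congr 1; ring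
    have e3 : ((-1 : k[X]) ^ γ) * (-1) ^ γ = 1 := by rw [← pow_add, ← two_mul]; simp
    have e4 : (-X : k[X]) ^ (2 * γ) = X ^ (2 * γ) := by rw [pow_mul, neg_sq, ← pow_mul]
    simp only [add_comp, mul_comp, pow_comp, X_comp, neg_comp, one_comp, ofNat_comp, hφ, mul_one,
      pow_succ _ (2 * γ), e1, e2, e4]
    linear_combination 2 * (-1) ^ γ * X ^ (2 * γ) * hθ -
      4 * (1 - X ^ 2) * X ^ (2 * γ) * X ^ (2 * γ) * e3
  · intro t h1 h2
    rw [hA] at h1 h2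
    have h3 := congrArg (eval t) hψc
    simp only [eval_sub, eval_mul, eval_add, eval_one, eval_X, eval_pow, eval_comp, eval_neg,
      eval_C] at h3
    have e4 : (-t) ^ (2 * γ) = t ^ (2 * γ) := by rw [pow_mul, neg_sq, ← pow_mul]
    rw [e4] at h2
    have h4 : c * t ^ i = 0 := by
      rw [← h3]; linear_combination (1 - t) * h1 - (1 + t) * h2
    have h5 : t = 0 := eq_zero_of_pow_eq_zero ((mul_eq_zero.1 h4).resolve_left hc)
    subst h5
    rw [zero_pow (by omega), mul_zero, add_zero] at h1
    exact hψ0 (pow_eq_zero_iff two_ne_zero |>.1 h1)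
  · intro t h1 h2
    rw [hA] at h1
    obtain ⟨g, rfl⟩ := Nat.exists_eq_succ_of_ne_zero hγ.ne'
    have e : derivative (ψ ^ 2 + 2 * (-1) ^ (g + 1) * (1 + X) * X ^ (2 * (g + 1))) =
        2 * ψ * derivative ψ + 2 * (-1) ^ (g + 1) * (X ^ (2 * (g + 1)) +
          (1 + X) * (2 * ((g : k[X]) + 1) * X ^ (2 * g + 1))) := by
      have c2 : (C (2 : k) : k[X]) = 2 := map_ofNat C 2
      have e1 : (2 * (-1) ^ (g + 1) : k[X]) = C (2 * (-1) ^ (g + 1)) := by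
        rw [C_mul, C_pow, C_neg, C_1, c2]
      rw [mul_assoc _ (1 + X : k[X]), e1, map_add, derivative_C_mul, derivative_mul, derivative_sq,
        c2, derivative_add, derivative_one, derivative_X, derivative_X_pow]
      push_cast
      simp only [C_mul, C_add, C_pow, C_neg, C_1, C_eq_natCast, c2]
      rw [show 2 * (g + 1) - 1 = 2 * g + 1 by omega]
      ring
    rw [Nat.succ_eq_add_one, e] at h2
    simp only [eval_add, eval_mul, eval_pow, eval_X, eval_one, eval_ofNat, eval_neg,
      eval_natCast] at h2
    rw [Nat.succ_eq_add_one] at h1 h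
    -- The power `t^(2γ)` is eliminated between `A` and `A'` through the logarithmic derivative of
    -- `(1 + t) t^(2γ)`, whose numerator over `t(1 + t)` is `2γ + (2γ+1)t`.
    have h3 : ψ.eval t * (2 * t * (1 + t) * (derivative ψ).eval t -
        (2 * ((g + 1 : ℕ) : k) + (2 * ((g + 1 : ℕ) : k) + 1) * t) * ψ.eval t) = 0 := by
      push_cast
      linear_combination t * (1 + t) * h2 - (2 * (g + 1) + (2 * (g + 1) + 1) * t) * h1
    rcases mul_eq_zero.1 h3 with h4 | h4
    · rw [h4, zero_pow two_ne_zero, zero_add] at h1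
      have h5 : (1 + t) * t ^ (2 * (g + 1)) = 0 := by
        have : (2 * (-1) ^ (g + 1) : k) ≠ 0 := by simp
        rw [mul_assoc] at h1
        exact (mul_eq_zero.1 h1).resolve_left this
      rcases mul_eq_zero.1 h5 with h6 | h6
      · rw [eq_neg_of_add_eq_zero_right h6] at h4
        exact hψ1 h4
      · rw [eq_zero_of_pow_eq_zero h6] at h4
        exact hψ0 h4
    · exact h t (by linear_combination h1) (by linear_combination h4)

/-- The factorization is the one used for Flynn's curves with `t³` in place of `t` and `ψ = 2 + t³`;
the sign of the cross term changes because `θ = -(3x³ + 4)`. -/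
theorem separable_variant [CharZero k] [IsAlgClosed k] {m : ℕ} (hm : 3 ≤ m) :
    ((X ^ 3 + 4) ^ 2 + 4 * (X ^ (2 * m + 3) + X ^ (2 * m) - (3 * X ^ 3 + 4) * X ^ m) :
      k[X]).Separable := by
  have hA : ∀ t : k, ((2 + X ^ 3) ^ 2 - 2 * (-1) ^ m * (1 + X ^ 3) * X ^ (2 * m) : k[X]).eval t =
      (2 + t ^ 3) ^ 2 - 2 * (-1) ^ m * (1 + t ^ 3) * t ^ (2 * m) := fun t => by simp
  refine separable_of_comp_neg_sq
    (A := (2 + X ^ 3) ^ 2 - 2 * (-1) ^ m * (1 + X ^ 3) * X ^ (2 * m)) ?_ ?_ ?_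
  · have e1 : (-X ^ 2 : k[X]) ^ m = (-1) ^ m * X ^ (2 * m) := by rw [neg_pow, ← pow_mul]
    have e2 : (-X ^ 2 : k[X]) ^ (2 * m) = X ^ (2 * m) * X ^ (2 * m) := by
      rw [pow_mul (-X ^ 2 : k[X]) 2 m, neg_sq, ← pow_mul, ← pow_mul, ← pow_add]; congr 1; ring
    have e3 : ((-1 : k[X]) ^ m) * (-1) ^ m = 1 := by rw [← pow_add, ← two_mul]; simp
    have e4 : (-X : k[X]) ^ (2 * m) = X ^ (2 * m) := by rw [pow_mul, neg_sq, ← pow_mul]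
    simp only [add_comp, sub_comp, mul_comp, pow_comp, X_comp, neg_comp, one_comp, ofNat_comp,
      pow_add _ (2 * m) 3, e1, e2, e4]
    linear_combination -4 * (1 - X ^ 6) * X ^ (2 * m) * X ^ (2 * m) * e3
  · intro t h1 h2
    rw [hA] at h1 h2
    have e4 : (-t) ^ (2 * m) = t ^ (2 * m) := by rw [pow_mul, neg_sq, ← pow_mul]
    rw [e4] at h2
    have h4 : (-2 : k) * t ^ 9 = 0 := by linear_combination (1 - t ^ 3) * h1 - (1 + t ^ 3) * h2
    have h5 : t = 0 := eq_zero_of_pow_eq_zero ((mul_eq_zero.1 h4).resolve_left (by norm_num))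
    subst h5
    rw [zero_pow (by omega : 2 * m ≠ 0)] at h1
    norm_num at h1
  · intro u h1 h2
    rw [hA] at h1
    obtain ⟨g, rfl⟩ := Nat.exists_eq_add_of_le' hm
    have e : derivative ((2 + X ^ 3) ^ 2 - 2 * (-1) ^ (g + 3) * (1 + X ^ 3) * X ^ (2 * (g + 3)) :
        k[X]) = 6 * X ^ 2 * (2 + X ^ 3) - 2 * (-1) ^ (g + 3) * (3 * X ^ 2 * X ^ (2 * (g + 3)) +
          (1 + X ^ 3) * (2 * ((g : k[X]) + 3) * X ^ (2 * g + 5))) := by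
      have c2 : (C (2 : k) : k[X]) = 2 := map_ofNat C 2
      have c3 : (C (3 : k) : k[X]) = 3 := map_ofNat C 3
      have e1 : (2 * (-1) ^ (g + 3) : k[X]) = C (2 * (-1) ^ (g + 3)) := by
        rw [C_mul, C_pow, C_neg, C_1, c2]
      rw [mul_assoc _ (1 + X ^ 3 : k[X]), e1, map_sub, derivative_C_mul, derivative_mul,
        derivative_sq, c2, derivative_add, derivative_add, derivative_one,
        derivative_X_pow, derivative_X_pow, derivative_ofNat]
      push_cast
      simp only [C_mul, C_add, C_pow, C_neg, C_1, C_eq_natCast, c2, c3]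
      rw [show 2 * (g + 3) - 1 = 2 * g + 5 by omega]
      ring
    rw [e] at h2
    simp only [eval_add, eval_sub, eval_mul, eval_pow, eval_X, eval_one, eval_ofNat, eval_neg,
      eval_natCast] at h2
    have h3 : (2 + u ^ 3) * (6 * u ^ 3 * (1 + u ^ 3) -
        (2 * (g + 3) + (2 * (g + 3) + 3) * u ^ 3) * (2 + u ^ 3)) = 0 := by
      linear_combination u * (1 + u ^ 3) * h2 - (2 * (g + 3) + (2 * (g + 3) + 3) * u ^ 3) * h1
    rcases mul_eq_zero.1 h3 with h4 | h4
    · have h5 : u ^ 3 = -2 := by linear_combination h4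
      rw [h5] at h1
      norm_num at h1
      rw [h1] at h5
      norm_num at h5
    obtain ⟨O, ρ, hO, hρ⟩ := exists_place_above_two k
    have hinj := IsFractionRing.injective O k
    -- This scaling cancels the factor `4` from both equations and leaves `(1 + τ)²` equal to `2`
    -- times an expression in `τ` and `u`. If both are integral above `2`, then `τ ≡ -1`, which
    -- contradicts `hR` modulo `2`.
    obtain ⟨τ, hτ⟩ : ∃ τ : k, u ^ 3 = 2 * τ := ⟨u ^ 3 / 2, by field_simp⟩
    have hR : (2 * (g + 3) - 3) * τ ^ 2 + 3 * (g + 3) * τ + (g + 3) = 0 := by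
      rw [hτ] at h4
      have : (4 : k) * ((2 * (g + 3) - 3) * τ ^ 2 + 3 * (g + 3) * τ + (g + 3)) = 0 := by
        linear_combination -h4
      exact (mul_eq_zero.1 this).resolve_left (by norm_num)
    have hE : (1 + τ) ^ 2 = 2 * (-1) ^ (g + 3) * (1 + 2 * τ) * τ ^ 2 * u ^ (2 * g) := by
      have e5 : u ^ (2 * (g + 3)) = 4 * τ ^ 2 * u ^ (2 * g) := by
        rw [show 2 * (g + 3) = 3 * 2 + 2 * g by ring, pow_add, pow_mul, hτ]; ring
      rw [e5, hτ] at h1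
      have : (4 : k) * ((1 + τ) ^ 2 - 2 * (-1) ^ (g + 3) * (1 + 2 * τ) * τ ^ 2 * u ^ (2 * g)) = 0 := by
        linear_combination h1
      exact sub_eq_zero.1 ((mul_eq_zero.1 this).resolve_left (by norm_num))
    obtain ⟨τ, rfl⟩ | ⟨v, hv, hv0⟩ := hρ τ
    swap
    -- If `τ` is not integral, its inverse `v` reduces to `0`, but the leading coefficient of `hR`
    -- in `τ` is the odd number `2g + 3`.
    · have h6 : (2 * (g + 3) - 3 + 3 * (g + 3) * v + (g + 3) * v ^ 2 : O) = 0 := by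
        apply hinj
        simp only [map_add, map_sub, map_mul, map_pow, map_natCast, map_ofNat, map_zero]
        linear_combination (algebraMap O k v) ^ 2 * hR - ((2 * (g + 3) - 3) *
          (τ * algebraMap O k v + 1) + 3 * (g + 3) * algebraMap O k v) * hv
      have h7 := congrArg ρ h6
      simp only [map_add, map_sub, map_mul, map_pow, map_natCast, map_ofNat, hv0, map_zero] at h7
      exact one_ne_zero (α := IsLocalRing.ResidueField O) (by linear_combination h7 - (g + 1) * hO)
    obtain ⟨u, rfl⟩ | ⟨v, hv, hv0⟩ := hρ u
    swap
    · have h6 : 2 * τ * v ^ 3 = 1 := by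
        apply hinj
        simp only [map_mul, map_pow, map_ofNat, map_one]
        rw [← hτ, ← mul_pow, hv, one_pow]
      have h7 := congrArg ρ h6
      simp only [map_mul, map_pow, hv0, map_one] at h7
      simp at h7
    have hR' : ((2 * (g + 3) - 3) * τ ^ 2 + 3 * (g + 3) * τ + (g + 3) : O) = 0 := by
      apply hinj
      simp only [map_add, map_sub, map_mul, map_pow, map_natCast, map_ofNat, map_zero]
      exact hR
    have hE' : (1 + τ) ^ 2 = 2 * (-1) ^ (g + 3) * (1 + 2 * τ) * τ ^ 2 * u ^ (2 * g) := by
      apply hinj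
      simp only [map_add, map_mul, map_pow, map_neg, map_ofNat, map_one]
      exact hE
    have h7 := congrArg ρ hR'
    have h8 := congrArg ρ hE'
    simp only [map_add, map_sub, map_mul, map_pow, map_natCast, map_ofNat, map_zero, map_one,
      map_neg] at h7 h8
    rw [hO] at h8
    have h9 : ρ τ = -1 := by
      have : (1 + ρ τ) ^ 2 = 0 := by rw [h8]; ring
      linear_combination (pow_eq_zero_iff two_ne_zero).1 this
    rw [h9] at h7
    exact one_ne_zero (α := IsLocalRing.ResidueField O) (by linear_combination -h7 - hO)

end Separability

/-! ### Flynn's polynomials and their discriminants -/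

section Flynn

variable (k : Type*) [Field k]

theorem flynnPair_add_two (r : ℕ) : flynnPair k (r + 2) =
    ((X + 2) * (flynnPair k (r + 1)).1 + 2 * (X + 1) * (flynnPair k (r + 1)).2,
      2 * (flynnPair k (r + 1)).1 + (X + 2) * (flynnPair k (r + 1)).2) := by
  rw [flynnPair]

theorem flynnPair_four : flynnPair k 4 =
    (7 * X ^ 3 + 56 * X ^ 2 + 112 * X + 64, X ^ 3 + 24 * X ^ 2 + 80 * X + 64) := by
  simp only [flynnPair, Prod.mk.injEq]
  constructor <;> ring

theorem flynnPair_five : flynnPair k 5 =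
    (9 * X ^ 4 + 120 * X ^ 3 + 432 * X ^ 2 + 576 * X + 256,
      X ^ 4 + 40 * X ^ 3 + 240 * X ^ 2 + 448 * X + 256) := by
  rw [flynnPair_add_two, flynnPair_four, Prod.mk.injEq]
  constructor <;> ring

theorem flynnTheta_four : flynnTheta k 4 = 7 * X ^ 3 + 56 * X ^ 2 + 112 * X + 64 := by
  rw [flynnTheta, flynnPair_four]

theorem flynnPhi_four : flynnPhi k 4 = X ^ 3 + 24 * X ^ 2 + 80 * X + 64 := by
  rw [flynnPhi, flynnPair_four]

theorem flynnTheta_five : flynnTheta k 5 =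
    9 * X ^ 4 + 120 * X ^ 3 + 432 * X ^ 2 + 576 * X + 256 := by
  rw [flynnTheta, flynnPair_five]

theorem flynnPhi_five : flynnPhi k 5 =
    X ^ 4 + 40 * X ^ 3 + 240 * X ^ 2 + 448 * X + 256 := by
  rw [flynnPhi, flynnPair_five]

variable {k} [CharZero k] [IsAlgClosed k] {γ : ℕ}

/-- With `α = √(1+t)`, `β = √(1-t)` and `w = αβ`, one has `2(1 + w) = (α + β)²`. Splitting `((1 +
w)^7 - (1 - w)^7)/(2w)` as a difference of squares gives `φ = ψ(t) ψ(-t)`, where `ψ = ((α+β)^7 -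
(α-β)^7)/(16β)`. The constant `-2 t^7` comes from `(α² - β²)^7 = (2t)^7`. -/
theorem separable_flynn_four (hγ : 3 ≤ γ) : ((flynnPhi k 4) ^ 2 +
    4 * (flynnTheta k 4 * X ^ γ * 1 + X ^ (2 * γ + 1) + X ^ (2 * γ))).Separable := by
  rw [flynnPhi_four, flynnTheta_four]
  refine separable_flynn_aux (ψ := 8 + 4 * X - 4 * X ^ 2 - X ^ 3) (c := -2) (i := 7)
    ?_ ?_ (by norm_num) ?_ (by norm_num) (by norm_num) (by omega) ?_
  · simp only [add_comp, sub_comp, mul_comp, pow_comp, X_comp, ofNat_comp]; ring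
  · simp only [add_comp, sub_comp, mul_comp, pow_comp, X_comp, ofNat_comp]; ring
  · have c2 : (C (2 : k) : k[X]) = 2 := map_ofNat C 2
    simp only [add_comp, sub_comp, mul_comp, pow_comp, X_comp, ofNat_comp, C_neg, c2]; ring
  intro t h1 h2
  -- Since `ψ(2τ) = 8(1 + τ - 2τ² - τ³)`, dividing the first equation by `64`, possible because `γ ≥
  -- 3`, leaves a factor `2` on the right. Modulo `2` this makes `1 + τ - 2τ² - τ³` vanish.
  obtain ⟨τ, rfl⟩ : ∃ τ : k, t = 2 * τ := ⟨t / 2, by field_simp⟩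
  obtain ⟨g, rfl⟩ := Nat.exists_eq_add_of_le' hγ
  have c4 : (C (4 : k) : k[X]) = 4 := map_ofNat C 4
  have hd : (derivative (8 + 4 * X - 4 * X ^ 2 - X ^ 3 : k[X])).eval (2 * τ) =
      4 * (1 - 4 * τ - 3 * τ ^ 2) := by
    simp only [← c4, derivative_add, derivative_sub, derivative_C_mul, derivative_X_pow,
      derivative_X, derivative_ofNat]
    simp
    ring
  rw [hd] at h2
  simp only [eval_add, eval_sub, eval_mul, eval_pow, eval_X, eval_ofNat] at h1 h2
  have hR : τ * (1 + 2 * τ) * (1 - 4 * τ - 3 * τ ^ 2) - (g + 3 + (2 * (g + 3) + 1) * τ) *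
      (1 + τ - 2 * τ ^ 2 - τ ^ 3) = 0 := by
    push_cast at h2
    have : (16 : k) * (τ * (1 + 2 * τ) * (1 - 4 * τ - 3 * τ ^ 2) -
      (g + 3 + (2 * (g + 3) + 1) * τ) * (1 + τ - 2 * τ ^ 2 - τ ^ 3)) = 0 := by
      linear_combination h2
    exact (mul_eq_zero.1 this).resolve_left (by norm_num)
  have hE : (1 + τ - 2 * τ ^ 2 - τ ^ 3) ^ 2 =
      2 * (-(-1) ^ (g + 3) * (1 + 2 * τ) * 4 ^ g * τ ^ (2 * (g + 3))) := by
    have e : (2 * τ) ^ (2 * (g + 3)) = 64 * 4 ^ g * τ ^ (2 * (g + 3)) := by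
      have : (2 : k) ^ (2 * (g + 3)) = 64 * 4 ^ g := by rw [pow_mul, pow_add]; norm_num; ring
      rw [mul_pow, this]
    rw [e] at h1
    have : (64 : k) * ((1 + τ - 2 * τ ^ 2 - τ ^ 3) ^ 2 -
        2 * (-(-1) ^ (g + 3) * (1 + 2 * τ) * 4 ^ g * τ ^ (2 * (g + 3)))) = 0 := by
      linear_combination h1
    exact sub_eq_zero.1 ((mul_eq_zero.1 this).resolve_left (by norm_num))
  obtain ⟨O, ρ, hO, hρ⟩ := exists_place_above_two k
  have hinj := IsFractionRing.injective O k
  obtain ⟨τ, rfl⟩ | ⟨v, hv, hv0⟩ := hρ τ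
  swap
  -- This is `hR` rewritten for `v = τ⁻¹`. If `v` reduces to `0`, it reads `2g + 1 = 0` in a field
  -- where `2 = 0`.
  · have h6 : ((v + 2) * (v ^ 2 - 4 * v - 3) - ((g + 3) * v + (2 * (g + 3) + 1)) *
        (v ^ 3 + v ^ 2 - 2 * v - 1) : O) = 0 := by
      apply hinj
      simp only [map_add, map_sub, map_mul, map_pow, map_natCast, map_ofNat, map_zero, map_one]
      have hv1 : algebraMap O k v ≠ 0 := right_ne_zero_of_mul_eq_one hv
      rw [eq_inv_of_mul_eq_one_left hv] at hR
      field_simp at hR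
      linear_combination hR
    have h7 := congrArg ρ h6
    simp only [map_add, map_sub, map_mul, map_pow, map_natCast, map_ofNat, hv0, map_zero,
      map_one] at h7
    exact one_ne_zero (α := IsLocalRing.ResidueField O) (by linear_combination h7 - g * hO)
  have hR' : (τ * (1 + 2 * τ) * (1 - 4 * τ - 3 * τ ^ 2) - (g + 3 + (2 * (g + 3) + 1) * τ) *
      (1 + τ - 2 * τ ^ 2 - τ ^ 3) : O) = 0 := by
    apply hinj
    simp only [map_add, map_sub, map_mul, map_pow, map_natCast, map_ofNat, map_zero, map_one]
    exact hR
  have hE' : (1 + τ - 2 * τ ^ 2 - τ ^ 3) ^ 2 =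
      2 * (-(-1) ^ (g + 3) * (1 + 2 * τ) * 4 ^ g * τ ^ (2 * (g + 3))) := by
    apply hinj
    simp only [map_add, map_sub, map_mul, map_pow, map_neg, map_ofNat, map_one]
    exact hE
  have h7 := congrArg ρ hR'
  have h8 := congrArg ρ hE'
  simp only [map_add, map_sub, map_mul, map_pow, map_natCast, map_ofNat, map_zero, map_one,
    map_neg] at h7 h8
  rw [hO, zero_mul, zero_mul, sub_zero, pow_eq_zero_iff two_ne_zero] at h8
  generalize ρ τ = t at h7 h8
  -- Modulo `2` and the vanishing cubic, the derivative equation keeps only `t(1 + t²)`. Neither `0`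
  -- nor `-1` is a root of the cubic.
  have h9 : t * (1 + t) ^ 2 = 0 := by
    linear_combination h7 + (g + 3 + (2 * (g + 3) + 1) * t) * h8 +
      (2 * t ^ 2 + 6 * t ^ 3 + 3 * t ^ 4 - t ^ 2 * (g + 3 + (2 * (g + 3) + 1) * t)) * hO
  rcases mul_eq_zero.1 h9 with h10 | h10
  · rw [h10] at h8; simp at h8
  · have h11 : t = -1 := by linear_combination (pow_eq_zero_iff two_ne_zero).1 h10
    rw [h11] at h8
    exact one_ne_zero (α := IsLocalRing.ResidueField O) (by linear_combination h8)

/-- The polynomial `ψ` is `((α+β)^9 - (α-β)^9)/(32β)` with `α = √(1+t)`, `β = √(1-t)`. Now `ψ(2τ)`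
is divisible by `16`, and `γ ≥ 4` leaves the spare factor `2`. Modulo `2` the derivative equation
reduces to `τ = 0`, which is not a root of the reduced quartic. -/
theorem separable_flynn_five (hγ : 4 ≤ γ) : ((flynnPhi k 5) ^ 2 +
    4 * (flynnTheta k 5 * X ^ γ * 1 + X ^ (2 * γ + 1) + X ^ (2 * γ))).Separable := by
  rw [flynnPhi_five, flynnTheta_five]
  refine separable_flynn_aux (ψ := 16 + 8 * X - 12 * X ^ 2 - 4 * X ^ 3 + X ^ 4) (c := -2) (i := 9)
    ?_ ?_ (by norm_num) ?_ (by norm_num) (by norm_num) (by omega) ?_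
  · simp only [add_comp, sub_comp, mul_comp, pow_comp, X_comp, ofNat_comp]; ring
  · simp only [add_comp, sub_comp, mul_comp, pow_comp, X_comp, ofNat_comp]; ring
  · have c2 : (C (2 : k) : k[X]) = 2 := map_ofNat C 2
    simp only [add_comp, sub_comp, mul_comp, pow_comp, X_comp, ofNat_comp, C_neg, c2]; ring
  intro t h1 h2
  obtain ⟨τ, rfl⟩ : ∃ τ : k, t = 2 * τ := ⟨t / 2, by field_simp⟩
  obtain ⟨g, rfl⟩ := Nat.exists_eq_add_of_le' hγ
  have c4 : (C (4 : k) : k[X]) = 4 := map_ofNat C 4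
  have c8 : (C (8 : k) : k[X]) = 8 := map_ofNat C 8
  have c12 : (C (12 : k) : k[X]) = 12 := map_ofNat C 12
  have hd : (derivative (16 + 8 * X - 12 * X ^ 2 - 4 * X ^ 3 + X ^ 4 : k[X])).eval (2 * τ) =
      8 * (1 - 6 * τ - 6 * τ ^ 2 + 4 * τ ^ 3) := by
    simp only [← c4, ← c8, ← c12, derivative_add, derivative_sub, derivative_C_mul, derivative_X_pow,
      derivative_X, derivative_ofNat]
    simp
    ring
  rw [hd] at h2
  simp only [eval_add, eval_sub, eval_mul, eval_pow, eval_X, eval_ofNat] at h1 h2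
  have hR : τ * (1 + 2 * τ) * (1 - 6 * τ - 6 * τ ^ 2 + 4 * τ ^ 3) - (g + 4 + (2 * (g + 4) + 1) * τ) *
      (1 + τ - 3 * τ ^ 2 - 2 * τ ^ 3 + τ ^ 4) = 0 := by
    push_cast at h2
    have : (32 : k) * (τ * (1 + 2 * τ) * (1 - 6 * τ - 6 * τ ^ 2 + 4 * τ ^ 3) -
      (g + 4 + (2 * (g + 4) + 1) * τ) * (1 + τ - 3 * τ ^ 2 - 2 * τ ^ 3 + τ ^ 4)) = 0 := by
      linear_combination h2
    exact (mul_eq_zero.1 this).resolve_left (by norm_num)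
  have hE : (1 + τ - 3 * τ ^ 2 - 2 * τ ^ 3 + τ ^ 4) ^ 2 =
      2 * (-(-1) ^ (g + 4) * (1 + 2 * τ) * 4 ^ g * τ ^ (2 * (g + 4))) := by
    have e : (2 * τ) ^ (2 * (g + 4)) = 256 * 4 ^ g * τ ^ (2 * (g + 4)) := by
      have : (2 : k) ^ (2 * (g + 4)) = 256 * 4 ^ g := by rw [pow_mul, pow_add]; norm_num; ring
      rw [mul_pow, this]
    rw [e] at h1
    have : (256 : k) * ((1 + τ - 3 * τ ^ 2 - 2 * τ ^ 3 + τ ^ 4) ^ 2 -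
        2 * (-(-1) ^ (g + 4) * (1 + 2 * τ) * 4 ^ g * τ ^ (2 * (g + 4)))) = 0 := by
      linear_combination h1
    exact sub_eq_zero.1 ((mul_eq_zero.1 this).resolve_left (by norm_num))
  obtain ⟨O, ρ, hO, hρ⟩ := exists_place_above_two k
  have hinj := IsFractionRing.injective O k
  obtain ⟨τ, rfl⟩ | ⟨v, hv, hv0⟩ := hρ τ
  swap
  · have h6 : ((v + 2) * (v ^ 3 - 6 * v ^ 2 - 6 * v + 4) - ((g + 4) * v + (2 * (g + 4) + 1)) *
        (v ^ 4 + v ^ 3 - 3 * v ^ 2 - 2 * v + 1) : O) = 0 := by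
      apply hinj
      simp only [map_add, map_sub, map_mul, map_pow, map_natCast, map_ofNat, map_zero, map_one]
      have hv1 : algebraMap O k v ≠ 0 := right_ne_zero_of_mul_eq_one hv
      rw [eq_inv_of_mul_eq_one_left hv] at hR
      field_simp at hR
      linear_combination hR
    have h7 := congrArg ρ h6
    simp only [map_add, map_sub, map_mul, map_pow, map_natCast, map_ofNat, hv0, map_zero,
      map_one] at h7
    exact one_ne_zero (α := IsLocalRing.ResidueField O) (by linear_combination -h7 - g * hO)
  have hR' : (τ * (1 + 2 * τ) * (1 - 6 * τ - 6 * τ ^ 2 + 4 * τ ^ 3) - (g + 4 + (2 * (g + 4) + 1) * τ) *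
      (1 + τ - 3 * τ ^ 2 - 2 * τ ^ 3 + τ ^ 4) : O) = 0 := by
    apply hinj
    simp only [map_add, map_sub, map_mul, map_pow, map_natCast, map_ofNat, map_zero, map_one]
    exact hR
  have hE' : (1 + τ - 3 * τ ^ 2 - 2 * τ ^ 3 + τ ^ 4) ^ 2 =
      2 * (-(-1) ^ (g + 4) * (1 + 2 * τ) * 4 ^ g * τ ^ (2 * (g + 4))) := by
    apply hinj
    simp only [map_add, map_sub, map_mul, map_pow, map_neg, map_ofNat, map_one]
    exact hE
  have h7 := congrArg ρ hR'
  have h8 := congrArg ρ hE'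
  simp only [map_add, map_sub, map_mul, map_pow, map_natCast, map_ofNat, map_zero, map_one,
    map_neg] at h7 h8
  rw [hO, zero_mul, zero_mul, sub_zero, pow_eq_zero_iff two_ne_zero] at h8
  generalize ρ τ = t at h7 h8
  have h9 : t = 0 := by
    linear_combination h7 + (g + 4 + (2 * (g + 4) + 1) * t) * h8 +
      (2 * t ^ 2 + 9 * t ^ 3 + 4 * t ^ 4 - 4 * t ^ 5 -
        t ^ 3 * (g + 4 + (2 * (g + 4) + 1) * t)) * hO
  rw [h9] at h8
  simp at h8

end Flynn

/-! ### The three families of curves and their profiles -/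

theorem mem_ThetaStrict_of_notMem {k K : Type*} [Field k] [Field K] [Algebra k K]
    {q : CurvePoint k K} {d : ℕ} {z : CurveJacobian k K} (hd : d ≠ 0) (h₁ : z ∈ Theta q d)
    (h₂ : z ∉ Theta q (d - 1)) : z ∈ ThetaStrict q d := by
  obtain ⟨d, rfl⟩ := Nat.exists_eq_succ_of_ne_zero hd
  exact ⟨h₁, h₂⟩

namespace Polynomial

variable {R : Type*} [CommRing R]

theorem eq_zero_of_coeff_eq_zero_of_natDegree_le_two {a : R[X]} (h : a.natDegree ≤ 2)
    (h0 : a.coeff 0 = 0) (h1 : a.coeff 1 = 0) (h2 : a.coeff 2 = 0) : a = 0 := by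
  ext i
  match i with
  | 0 => exact h0
  | 1 => exact h1
  | 2 => exact h2
  | i + 3 => exact coeff_eq_zero_of_natDegree_lt (by omega)

theorem coeff_mul_two (a b : R[X]) : (a * b).coeff 2 =
    a.coeff 0 * b.coeff 2 + a.coeff 1 * b.coeff 1 + a.coeff 2 * b.coeff 0 := by
  simp [coeff_mul, Finset.Nat.antidiagonal_succ]; ring

theorem coeff_mul_three (a b : R[X]) : (a * b).coeff 3 = a.coeff 0 * b.coeff 3 +
    a.coeff 1 * b.coeff 2 + a.coeff 2 * b.coeff 1 + a.coeff 3 * b.coeff 0 := by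
  simp [coeff_mul, Finset.Nat.antidiagonal_succ]; ring

end Polynomial

namespace HyperellipticCurve

variable {k : Type*} [Field k] [CharZero k]

/-- The curve `y² + φ y = θ x^γ + x^(2γ+1) + x^(2γ)`. -/
noncomputable def ofThetaPhi (γ : ℕ) (φ θ : k[X]) (hγ : 2 ≤ γ) (hφ : φ.natDegree ≤ γ)
    (hθ : θ.natDegree ≤ γ)
    (hsep : (φ ^ 2 + 4 * (θ * X ^ γ * 1 + X ^ (2 * γ + 1) + X ^ (2 * γ))).Separable) :
    HyperellipticCurve k :=
  have hdeg : (θ * X ^ γ * 1 + X ^ (2 * γ)).degree < ((2 * γ + 1 : ℕ) : WithBot ℕ) := by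
    rw [mul_one]
    refine lt_of_le_of_lt degree_le_natDegree (Nat.cast_lt.2 ?_)
    refine lt_of_le_of_lt (natDegree_add_le _ _) ?_
    have := natDegree_mul_le (p := θ) (q := X ^ γ)
    rw [natDegree_X_pow] at this ⊢
    omega
  have e : θ * X ^ γ * 1 + X ^ (2 * γ + 1) + X ^ (2 * γ) =
      X ^ (2 * γ + 1) + (θ * X ^ γ * 1 + X ^ (2 * γ)) := by ring
  { genus := γ
    h := φ
    -- The factor `1` is the `w` of `IsFlynnCurve`, kept so that the defining equation of `f` holds
    -- by `rfl`.
    f := θ * X ^ γ * 1 + X ^ (2 * γ + 1) + X ^ (2 * γ)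
    two_le_genus := hγ
    natDegree_h_le := hφ
    monic_f := by rw [e]; exact monic_X_pow_add hdeg
    natDegree_f := by
      rw [e, natDegree_add_eq_left_of_degree_lt (by rwa [degree_X_pow]), natDegree_X_pow]
    separable_disc := hsep }

/-- The curve `y² + (x³ + 4) y = x^(2γ+1) + x^(2γ-2) - (3x³ + 4) x^(γ-1)`. -/
noncomputable def variantCurve [IsAlgClosed k] (γ : ℕ) (hγ : 4 ≤ γ) : HyperellipticCurve k :=
  have hdeg : (X ^ (2 * γ - 2) - (3 * X ^ 3 + 4) * X ^ (γ - 1) : k[X]).degree <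
      ((2 * γ + 1 : ℕ) : WithBot ℕ) := by
    refine lt_of_le_of_lt degree_le_natDegree (Nat.cast_lt.2 ?_)
    refine lt_of_le_of_lt (natDegree_sub_le _ _) ?_
    have h1 := natDegree_mul_le (p := (3 * X ^ 3 + 4 : k[X])) (q := X ^ (γ - 1))
    have h2 : (3 * X ^ 3 + 4 : k[X]).natDegree ≤ 3 := by compute_degree
    rw [natDegree_X_pow] at h1 ⊢
    omega
  have e : (X ^ (2 * γ + 1) + X ^ (2 * γ - 2) - (3 * X ^ 3 + 4) * X ^ (γ - 1) : k[X]) =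
      X ^ (2 * γ + 1) + (X ^ (2 * γ - 2) - (3 * X ^ 3 + 4) * X ^ (γ - 1)) := by ring
  { genus := γ
    h := X ^ 3 + 4
    f := X ^ (2 * γ + 1) + X ^ (2 * γ - 2) - (3 * X ^ 3 + 4) * X ^ (γ - 1)
    two_le_genus := by omega
    natDegree_h_le := by
      have : (X ^ 3 + 4 : k[X]).natDegree ≤ 3 := by compute_degree
      omega
    monic_f := by rw [e]; exact monic_X_pow_add hdeg
    natDegree_f := by
      rw [e, natDegree_add_eq_left_of_degree_lt (by rwa [degree_X_pow]), natDegree_X_pow]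
    separable_disc := by
      have := separable_variant (k := k) (m := γ - 1) (by omega)
      rwa [show 2 * (γ - 1) + 3 = 2 * γ + 1 by omega,
        show 2 * (γ - 1) = 2 * γ - 2 by omega] at this }

variable {B : HyperellipticCurve k}

/-- The norm identity is the norm of `θ + φ w = (1 + w)^7` with `w² = x + 1`. -/
theorem torsionPresentation_flynn_four (hγ : 3 ≤ B.genus) (hB : IsFlynnCurve B B.genus 4 1) :
    TorsionPresentation B B.genus 7 (flynnTheta k 4) (X + 1) where
  m_pos := by omega
  eval_h := by rw [hB.2.1, flynnPhi_four]; simp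
  f_eq := by rw [hB.2.2]; ring
  norm_eq := by rw [hB.2.1, flynnTheta_four, flynnPhi_four]; ring

theorem torsionPresentation_flynn_five (hγ : 4 ≤ B.genus) (hB : IsFlynnCurve B B.genus 5 1) :
    TorsionPresentation B B.genus 9 (flynnTheta k 5) (X + 1) where
  m_pos := by omega
  eval_h := by rw [hB.2.1, flynnPhi_five]; simp
  f_eq := by rw [hB.2.2]; ring
  norm_eq := by rw [hB.2.1, flynnTheta_five, flynnPhi_five]; ring

/-- Here `(3x³ + 4) + (x³ + 4) w = (1 + w)³` with `w² = x³ + 1`, and `1 + w` has norm `-x³`. This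
explains `n = 9`; together with `m = γ - 1` it gives torsion order `2γ + 7`. -/
theorem torsionPresentation_variant (hγ : 4 ≤ B.genus) (hB : IsVariantCurve B B.genus) :
    TorsionPresentation B (B.genus - 1) 9 (-(3 * X ^ 3 + 4)) (X ^ 3 + 1) where
  m_pos := by omega
  eval_h := by rw [hB.2.1]; simp
  f_eq := by
    rw [hB.2.2, show 2 * B.genus + 1 = 2 * (B.genus - 1) + 3 by omega,
      show 2 * B.genus - 2 = 2 * (B.genus - 1) by omega]
    ring
  norm_eq := by rw [hB.2.1]; ring

variable [IsAlgClosed k] {p q : B.Point}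

/-- Because `θ/h ≡ √(1+x)` modulo `x^7`, the witnesses are the Padé approximants of `√(1+x)`: `1`,
`(2 + x)/2` and `(4 + 3x)/(4 + x)`, matching to orders `1`, `2` and `3`. They are the coefficients
of `(1 + w)^i` for `i = 1, 2, 3`. Lowering `d` to `γ - 1` lowers one degree bound and makes the
linear system nonsingular. -/
theorem profile_flynn_four (hγ : 3 ≤ B.genus) (hB : IsFlynnCurve B B.genus 4 1)
    (hp : B.IsAffinePoint p 0 0) (hq : B.IsPointAtInfinity q)
    (hT : TorsionPresentation B B.genus 7 (flynnTheta k 4) (X + 1)) :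
    addOrderOf (pointClass p q) = 2 * B.genus + 7 ∧ IsMultiplicationProfile q (pointClass p q)
      (profileDeterminedBy B.genus (2 * B.genus + 7) [B.genus, B.genus]) := by
  have hh : B.h = X ^ 3 + 24 * X ^ 2 + 80 * X + 64 := by rw [hB.2.1, flynnPhi_four, mul_one]
  have hθ := flynnTheta_four k
  have h0 : B.h.coeff 0 = 64 := by simp [hh]
  have h1 : B.h.coeff 1 = 80 := by simp [hh, coeff_X, coeff_X_pow, coeff_ofNat_mul]
  have h2 : B.h.coeff 2 = 24 := by simp [hh, coeff_X, coeff_X_pow, coeff_ofNat_mul]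
  have t0 : (flynnTheta k 4).coeff 0 = 64 := by simp [hθ]
  have t1 : (flynnTheta k 4).coeff 1 = 112 := by
    simp [hθ, coeff_X, coeff_X_pow, coeff_ofNat_mul]
  have t2 : (flynnTheta k 4).coeff 2 = 56 := by
    simp [hθ, coeff_X, coeff_X_pow, coeff_ofNat_mul]
  refine hT.addOrderOf_and_isMultiplicationProfile hp hq (M := B.genus + 3) (by ring) (by omega)
    ?_ fun i hi1 hi2 => ?_
  · refine hT.mem_Theta hp hq (by omega) (by omega) (-1) 1 one_ne_zero (by simp; omega)
      (by simp; omega) ?_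
    rw [Nat.add_sub_cancel_left, hh, hθ]
    exact ⟨6 * X ^ 2 + 32 * X + 32, by ring⟩
  · obtain rfl | rfl : i = B.genus + 2 ∨ i = B.genus + 3 := by omega
    · rw [Nat.sub_self]
      refine ⟨by simp; omega, mem_ThetaStrict_of_notMem (by simp; omega) ?_ ?_⟩
      · have hd : (-(2 + X) : k[X]).natDegree ≤ 1 := by compute_degree
        refine hT.mem_Theta hp hq (by omega) (by omega) (-(2 + X)) 2 two_ne_zero ?_ ?_ ?_
        · simp only [List.getD_cons_zero]; omega
        · simp; omega
        rw [Nat.add_sub_cancel_left, hh, hθ]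
        exact ⟨-X ^ 2 - 12 * X - 16, by ring⟩
      · refine hT.notMem_Theta hp hq (by omega) (by omega) fun a b ha hb hdvd => ?_
        simp only [List.getD_cons_zero] at ha hb
        have ha' : a.natDegree = 0 := by
          by_cases h : a = 0
          · simp [h]
          · have := ha h; omega
        have hb' : b.natDegree = 0 := by
          by_cases h : b = 0
          · simp [h]
          · have := hb h; omega
        rw [Nat.add_sub_cancel_left, X_pow_dvd_iff] at hdvd
        have c0 := hdvd 0 (by norm_num)
        have c1 := hdvd 1 (by norm_num)
        have a1 : a.coeff 1 = 0 := coeff_eq_zero_of_natDegree_lt (by omega)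
        have a2 : a.coeff 2 = 0 := coeff_eq_zero_of_natDegree_lt (by omega)
        have b1 : b.coeff 1 = 0 := coeff_eq_zero_of_natDegree_lt (by omega)
        have b2 : b.coeff 2 = 0 := coeff_eq_zero_of_natDegree_lt (by omega)
        simp only [coeff_add, mul_coeff_zero, mul_coeff_one, h0, h1, t0, t1, a1, b1] at c0 c1
        -- With `a` and `b` constant, the system has matrix rows `(64, 64)` and `(80, 112)`, which
        -- are independent.
        have b0 : b.coeff 0 = 0 := by linear_combination (1 / 32) * c1 - (5 / 128) * c0
        have a0 : a.coeff 0 = 0 := by linear_combination (1 / 64) * c0 - b0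
        exact ⟨eq_zero_of_coeff_eq_zero_of_natDegree_le_two (by omega) a0 a1 a2,
          eq_zero_of_coeff_eq_zero_of_natDegree_le_two (by omega) b0 b1 b2⟩
    · rw [Nat.add_sub_add_left]
      have hg : [B.genus, B.genus].getD (3 - 2) 0 = B.genus := rfl
      refine ⟨by simp; omega, mem_ThetaStrict_of_notMem (by simp; omega) ?_ ?_⟩
      · have hd : (-(4 + 3 * X) : k[X]).natDegree ≤ 1 := by compute_degree
        have hd' : (4 + X : k[X]).natDegree = 1 := by compute_degree!
        refine hT.mem_Theta hp hq (by omega) (by omega) (-(4 + 3 * X)) (4 + X) ?_ ?_ ?_ ?_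
        · intro h; rw [h] at hd'; simp at hd'
        · rw [hg]; omega
        · rw [hg]; omega
        rw [Nat.add_sub_cancel_left, hh, hθ]
        exact ⟨4 * X + 8, by ring⟩
      · refine hT.notMem_Theta hp hq (by omega) (by omega) fun a b ha hb hdvd => ?_
        rw [hg] at ha hb
        have ha' : a.natDegree ≤ 1 := by
          by_cases h : a = 0
          · simp [h]
          · have := ha h; omega
        have hb' : b.natDegree = 0 := by
          by_cases h : b = 0
          · simp [h]
          · have := hb h; omega
        rw [Nat.add_sub_cancel_left, X_pow_dvd_iff] at hdvd
        have c0 := hdvd 0 (by norm_num)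
        have c1 := hdvd 1 (by norm_num)
        have c2 := hdvd 2 (by norm_num)
        have a2 : a.coeff 2 = 0 := coeff_eq_zero_of_natDegree_lt (by omega)
        have b1 : b.coeff 1 = 0 := coeff_eq_zero_of_natDegree_lt (by omega)
        have b2 : b.coeff 2 = 0 := coeff_eq_zero_of_natDegree_lt (by omega)
        simp only [coeff_add, mul_coeff_zero, mul_coeff_one, coeff_mul_two, h0, h1, h2, t0, t1, t2,
          a2, b1, b2] at c0 c1 c2
        have b0 : b.coeff 0 = 0 := by
          linear_combination (-1 / 8) * (c2 - 5 / 4 * c1 + 76 / 64 * c0)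
        have a0 : a.coeff 0 = 0 := by linear_combination (1 / 64) * c0 - b0
        have a1 : a.coeff 1 = 0 := by
          linear_combination (1 / 64) * c1 - 80 / 64 * a0 - 112 / 64 * b0
        exact ⟨eq_zero_of_coeff_eq_zero_of_natDegree_le_two (by omega) a0 a1 a2,
          eq_zero_of_coeff_eq_zero_of_natDegree_le_two (by omega) b0 b1 b2⟩

/-- The same approximants of `√(1+x)` serve, continued by `(8 + 8x + x²)/(8 + 4x)` of order `4`,
which comes from `(1 + w)^4`. -/
theorem profile_flynn_five (hγ : 4 ≤ B.genus) (hB : IsFlynnCurve B B.genus 5 1)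
    (hp : B.IsAffinePoint p 0 0) (hq : B.IsPointAtInfinity q)
    (hT : TorsionPresentation B B.genus 9 (flynnTheta k 5) (X + 1)) :
    addOrderOf (pointClass p q) = 2 * B.genus + 9 ∧ IsMultiplicationProfile q (pointClass p q)
      (profileDeterminedBy B.genus (2 * B.genus + 9) [B.genus, B.genus, B.genus]) := by
  have hh : B.h = X ^ 4 + 40 * X ^ 3 + 240 * X ^ 2 + 448 * X + 256 := by
    rw [hB.2.1, flynnPhi_five, mul_one]
  have hθ := flynnTheta_five k
  have h0 : B.h.coeff 0 = 256 := by
    simp [hh, coeff_X, coeff_X_pow, coeff_ofNat_mul]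
  have h1 : B.h.coeff 1 = 448 := by
    simp [hh, coeff_X, coeff_X_pow, coeff_ofNat_mul]
  have h2 : B.h.coeff 2 = 240 := by
    simp [hh, coeff_X, coeff_X_pow, coeff_ofNat_mul]
  have h3 : B.h.coeff 3 = 40 := by
    simp [hh, coeff_X, coeff_X_pow, coeff_ofNat_mul]
  have t0 : (flynnTheta k 5).coeff 0 = 256 := by
    simp [hθ, coeff_X, coeff_X_pow, coeff_ofNat_mul]
  have t1 : (flynnTheta k 5).coeff 1 = 576 := by
    simp [hθ, coeff_X, coeff_X_pow, coeff_ofNat_mul]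
  have t2 : (flynnTheta k 5).coeff 2 = 432 := by
    simp [hθ, coeff_X, coeff_X_pow, coeff_ofNat_mul]
  have t3 : (flynnTheta k 5).coeff 3 = 120 := by
    simp [hθ, coeff_X, coeff_X_pow, coeff_ofNat_mul]
  refine hT.addOrderOf_and_isMultiplicationProfile hp hq (M := B.genus + 4) (by ring) (by omega)
    ?_ fun i hi1 hi2 => ?_
  · refine hT.mem_Theta hp hq (by omega) (by omega) (-1) 1 one_ne_zero (by simp; omega)
      (by simp; omega) ?_
    rw [Nat.add_sub_cancel_left, hh, hθ]
    exact ⟨8 * X ^ 3 + 80 * X ^ 2 + 192 * X + 128, by ring⟩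
  · obtain rfl | rfl | rfl : i = B.genus + 2 ∨ i = B.genus + 3 ∨ i = B.genus + 4 := by omega
    · rw [Nat.sub_self]
      refine ⟨by simp; omega, mem_ThetaStrict_of_notMem (by simp; omega) ?_ ?_⟩
      · have hd : (-(2 + X) : k[X]).natDegree ≤ 1 := by compute_degree
        refine hT.mem_Theta hp hq (by omega) (by omega) (-(2 + X)) 2 two_ne_zero ?_ ?_ ?_
        · simp only [List.getD_cons_zero]; omega
        · simp; omega
        rw [Nat.add_sub_cancel_left, hh, hθ]
        exact ⟨-X ^ 3 - 24 * X ^ 2 - 80 * X - 64, by ring⟩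
      · refine hT.notMem_Theta hp hq (by omega) (by omega) fun a b ha hb hdvd => ?_
        simp only [List.getD_cons_zero] at ha hb
        have ha' : a.natDegree = 0 := by
          by_cases h : a = 0
          · simp [h]
          · have := ha h; omega
        have hb' : b.natDegree = 0 := by
          by_cases h : b = 0
          · simp [h]
          · have := hb h; omega
        rw [Nat.add_sub_cancel_left, X_pow_dvd_iff] at hdvd
        have c0 := hdvd 0 (by norm_num)
        have c1 := hdvd 1 (by norm_num)
        have a1 : a.coeff 1 = 0 := coeff_eq_zero_of_natDegree_lt (by omega)
        have a2 : a.coeff 2 = 0 := coeff_eq_zero_of_natDegree_lt (by omega)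
        have b1 : b.coeff 1 = 0 := coeff_eq_zero_of_natDegree_lt (by omega)
        have b2 : b.coeff 2 = 0 := coeff_eq_zero_of_natDegree_lt (by omega)
        simp only [coeff_add, mul_coeff_zero, mul_coeff_one, h0, h1, t0, t1, a1, b1] at c0 c1
        have b0 : b.coeff 0 = 0 := by linear_combination (1 / 128) * (c1 - 448 / 256 * c0)
        have a0 : a.coeff 0 = 0 := by linear_combination (1 / 256) * c0 - b0
        exact ⟨eq_zero_of_coeff_eq_zero_of_natDegree_le_two (by omega) a0 a1 a2,
          eq_zero_of_coeff_eq_zero_of_natDegree_le_two (by omega) b0 b1 b2⟩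
    · rw [Nat.add_sub_add_left]
      have hg : [B.genus, B.genus, B.genus].getD (3 - 2) 0 = B.genus := rfl
      refine ⟨by simp; omega, mem_ThetaStrict_of_notMem (by simp; omega) ?_ ?_⟩
      · have hd : (-(4 + 3 * X) : k[X]).natDegree ≤ 1 := by compute_degree
        have hd' : (4 + X : k[X]).natDegree = 1 := by compute_degree!
        refine hT.mem_Theta hp hq (by omega) (by omega) (-(4 + 3 * X)) (4 + X) ?_ ?_ ?_ ?_
        · intro h; rw [h] at hd'; simp at hd'
        · rw [hg]; omega
        · rw [hg]; omega
        rw [Nat.add_sub_cancel_left, hh, hθ]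
        exact ⟨6 * X ^ 2 + 32 * X + 32, by ring⟩
      · refine hT.notMem_Theta hp hq (by omega) (by omega) fun a b ha hb hdvd => ?_
        rw [hg] at ha hb
        have ha' : a.natDegree ≤ 1 := by
          by_cases h : a = 0
          · simp [h]
          · have := ha h; omega
        have hb' : b.natDegree = 0 := by
          by_cases h : b = 0
          · simp [h]
          · have := hb h; omega
        rw [Nat.add_sub_cancel_left, X_pow_dvd_iff] at hdvd
        have c0 := hdvd 0 (by norm_num)
        have c1 := hdvd 1 (by norm_num)
        have c2 := hdvd 2 (by norm_num)
        have a2 : a.coeff 2 = 0 := coeff_eq_zero_of_natDegree_lt (by omega)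
        have b1 : b.coeff 1 = 0 := coeff_eq_zero_of_natDegree_lt (by omega)
        have b2 : b.coeff 2 = 0 := coeff_eq_zero_of_natDegree_lt (by omega)
        simp only [coeff_add, mul_coeff_zero, mul_coeff_one, coeff_mul_two, h0, h1, h2, t0, t1, t2,
          a2, b1, b2] at c0 c1 c2
        have b0 : b.coeff 0 = 0 := by
          linear_combination (-1 / 32) * (c2 - 7 / 4 * c1 + 17 / 8 * c0)
        have a0 : a.coeff 0 = 0 := by linear_combination (1 / 256) * c0 - b0
        have a1 : a.coeff 1 = 0 := by
          linear_combination (1 / 256) * c1 - 448 / 256 * a0 - 576 / 256 * b0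
        exact ⟨eq_zero_of_coeff_eq_zero_of_natDegree_le_two (by omega) a0 a1 a2,
          eq_zero_of_coeff_eq_zero_of_natDegree_le_two (by omega) b0 b1 b2⟩
    · rw [Nat.add_sub_add_left]
      have hg : [B.genus, B.genus, B.genus].getD (4 - 2) 0 = B.genus := rfl
      refine ⟨by simp; omega, mem_ThetaStrict_of_notMem (by simp; omega) ?_ ?_⟩
      · have hd : (-(8 + 8 * X + X ^ 2) : k[X]).natDegree ≤ 2 := by compute_degree
        have hd' : (8 + 4 * X : k[X]).natDegree = 1 := by compute_degree!
        refine hT.mem_Theta hp hq (by omega) (by omega) (-(8 + 8 * X + X ^ 2)) (8 + 4 * X) ?_ ?_ ?_ ?_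
        · intro h; rw [h] at hd'; simp at hd'
        · rw [hg]; omega
        · rw [hg]; omega
        rw [Nat.add_sub_cancel_left, hh, hθ]
        exact ⟨-X ^ 2 - 12 * X - 16, by ring⟩
      · refine hT.notMem_Theta hp hq (by omega) (by omega) fun a b ha hb hdvd => ?_
        rw [hg] at ha hb
        have ha' : a.natDegree ≤ 1 := by
          by_cases h : a = 0
          · simp [h]
          · have := ha h; omega
        have hb' : b.natDegree ≤ 1 := by
          by_cases h : b = 0
          · simp [h]
          · have := hb h; omega
        rw [Nat.add_sub_cancel_left, X_pow_dvd_iff] at hdvd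
        have c0 := hdvd 0 (by norm_num)
        have c1 := hdvd 1 (by norm_num)
        have c2 := hdvd 2 (by norm_num)
        have c3 := hdvd 3 (by norm_num)
        have a2 : a.coeff 2 = 0 := coeff_eq_zero_of_natDegree_lt (by omega)
        have a3 : a.coeff 3 = 0 := coeff_eq_zero_of_natDegree_lt (by omega)
        have b2 : b.coeff 2 = 0 := coeff_eq_zero_of_natDegree_lt (by omega)
        have b3 : b.coeff 3 = 0 := coeff_eq_zero_of_natDegree_lt (by omega)
        simp only [coeff_add, mul_coeff_zero, mul_coeff_one, coeff_mul_two, coeff_mul_three, h0, h1,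
          h2, h3, t0, t1, t2, t3, a2, a3, b2, b3] at c0 c1 c2 c3
        have b0 : b.coeff 0 = 0 := by
          linear_combination (1 / 8) * (c3 - 3 / 2 * c2 + 27 / 16 * c1 - 109 / 64 * c0)
        have b1 : b.coeff 1 = 0 := by
          linear_combination (1 / 128) * (c2 - 7 / 4 * c1 + 17 / 8 * c0) + 1 / 4 * b0
        have a0 : a.coeff 0 = 0 := by linear_combination (1 / 256) * c0 - b0
        have a1 : a.coeff 1 = 0 := by
          linear_combination (1 / 256) * c1 - 448 / 256 * a0 - 576 / 256 * b0 - b1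
        exact ⟨eq_zero_of_coeff_eq_zero_of_natDegree_le_two (by omega) a0 a1 a2,
          eq_zero_of_coeff_eq_zero_of_natDegree_le_two (by omega) b0 b1 b2⟩

/-- Now `-θ/h ≡ √(1+x³) = 1 + O(x³)`, so the approximant `1` already matches to order `3`: `h + θ =
-2x³`. The pair `a = b = 1` therefore serves for both `γ + 1` and `γ + 2`, which is why the value
drops to `γ - 1` at `γ + 2`. Its multiple by `x` serves for `γ + 3`. -/
theorem profile_variant (hγ : 4 ≤ B.genus) (hh : B.h = X ^ 3 + 4)
    (hp : B.IsAffinePoint p 0 0) (hq : B.IsPointAtInfinity q)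
    (hT : TorsionPresentation B (B.genus - 1) 9 (-(3 * X ^ 3 + 4)) (X ^ 3 + 1)) :
    addOrderOf (pointClass p q) = 2 * B.genus + 7 ∧ IsMultiplicationProfile q (pointClass p q)
      (profileDeterminedBy B.genus (2 * B.genus + 7) [B.genus - 1, B.genus]) := by
  have h0 : B.h.coeff 0 = 4 := by simp [hh]
  have h1 : B.h.coeff 1 = 0 := by simp [hh, coeff_X_pow]
  have h2 : B.h.coeff 2 = 0 := by simp [hh, coeff_X_pow]
  have h3 : B.h.coeff 3 = 1 := by simp [hh, coeff_X_pow]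
  have t0 : (-(3 * X ^ 3 + 4) : k[X]).coeff 0 = -4 := by simp
  have t1 : (-(3 * X ^ 3 + 4) : k[X]).coeff 1 = 0 := by simp [coeff_X_pow, coeff_ofNat_mul]
  have t2 : (-(3 * X ^ 3 + 4) : k[X]).coeff 2 = 0 := by simp [coeff_X_pow, coeff_ofNat_mul]
  have t3 : (-(3 * X ^ 3 + 4) : k[X]).coeff 3 = -3 := by simp [coeff_X_pow, coeff_ofNat_mul]
  have eN : 2 * B.genus + 7 = 2 * (B.genus - 1) + 9 := by omega
  rw [eN]
  refine hT.addOrderOf_and_isMultiplicationProfile hp hq (M := B.genus + 3) (by omega) (by omega)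
    ?_ fun i hi1 hi2 => ?_
  · refine hT.mem_Theta hp hq (by omega) (by omega) 1 1 one_ne_zero (by simp; omega)
      (by simp; omega) ?_
    rw [show B.genus + 1 - (B.genus - 1) = 2 by omega, hh]
    exact ⟨-2 * X, by ring⟩
  · obtain rfl | rfl : i = B.genus + 2 ∨ i = B.genus + 3 := by omega
    · rw [Nat.sub_self]
      have hg : [B.genus - 1, B.genus].getD 0 0 = B.genus - 1 := rfl
      rw [hg]
      refine ⟨by omega, mem_ThetaStrict_of_notMem (by omega) ?_ ?_⟩
      · refine hT.mem_Theta hp hq (by omega) (by omega) 1 1 one_ne_zero (by simp; omega)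
          (by simp; omega) ?_
        rw [show B.genus + 2 - (B.genus - 1) = 3 by omega, hh]
        exact ⟨-2, by ring⟩
      · exact hT.notMem_Theta_of_add_le hp hq (by omega) (by omega) (by omega)
    · rw [Nat.add_sub_add_left]
      have hg : [B.genus - 1, B.genus].getD (3 - 2) 0 = B.genus := rfl
      rw [hg]
      refine ⟨by omega, mem_ThetaStrict_of_notMem (by omega) ?_ ?_⟩
      · refine hT.mem_Theta hp hq (by omega) (by omega) X X X_ne_zero (by simp; omega)
          (by simp; omega) ?_
        rw [show B.genus + 3 - (B.genus - 1) = 4 by omega, hh]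
        exact ⟨-2, by ring⟩
      · refine hT.notMem_Theta hp hq (by omega) (by omega) fun a b ha hb hdvd => ?_
        have ha' : a.natDegree ≤ 2 := by
          by_cases h : a = 0
          · simp [h]
          · have := ha h; omega
        have hb' : b.natDegree = 0 := by
          by_cases h : b = 0
          · simp [h]
          · have := hb h; omega
        rw [show B.genus + 3 - (B.genus - 1) = 4 by omega, X_pow_dvd_iff] at hdvd
        have c0 := hdvd 0 (by norm_num)
        have c1 := hdvd 1 (by norm_num)
        have c2 := hdvd 2 (by norm_num)
        have c3 := hdvd 3 (by norm_num)
        have a3 : a.coeff 3 = 0 := coeff_eq_zero_of_natDegree_lt (by omega)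
        have b1 : b.coeff 1 = 0 := coeff_eq_zero_of_natDegree_lt (by omega)
        have b2 : b.coeff 2 = 0 := coeff_eq_zero_of_natDegree_lt (by omega)
        have b3 : b.coeff 3 = 0 := coeff_eq_zero_of_natDegree_lt (by omega)
        simp only [coeff_add, mul_coeff_zero, mul_coeff_one, coeff_mul_two, coeff_mul_three, h0, h1,
          h2, h3, t0, t1, t2, t3, a3, b1, b2, b3] at c0 c1 c2 c3
        -- For constant `b` and `deg a ≤ 2`, the coefficient of `x³` is `a₀ - 3b₀`, while the
        -- constant term gives `a₀ = b₀`.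
        have b0 : b.coeff 0 = 0 := by linear_combination (-1 / 2) * (c3 - 1 / 4 * c0)
        have a0 : a.coeff 0 = 0 := by linear_combination (1 / 4) * c0 + b0
        have a1 : a.coeff 1 = 0 := by linear_combination (1 / 4) * c1
        have a2 : a.coeff 2 = 0 := by linear_combination (1 / 4) * c2
        exact ⟨eq_zero_of_coeff_eq_zero_of_natDegree_le_two (by omega) a0 a1 a2,
          eq_zero_of_coeff_eq_zero_of_natDegree_le_two (by omega) b0 b1 b2⟩

end HyperellipticCurve

theorem mainTheorem9 {k : Type*} [Field k] [IsAlgClosed k] [CharZero k] (γ : ℕ) :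
    (3 ≤ γ → ∃ B : HyperellipticCurve k, IsFlynnCurve B γ 4 1 ∧
      ∃ p q : B.Point, B.IsAffinePoint p 0 0 ∧ B.IsPointAtInfinity q ∧
        addOrderOf (pointClass p q) = 2 * γ + 7 ∧
        IsMultiplicationProfile q (pointClass p q)
          (profileDeterminedBy γ (2 * γ + 7) [γ, γ])) ∧
    (4 ≤ γ → ∃ B : HyperellipticCurve k, IsFlynnCurve B γ 5 1 ∧
      ∃ p q : B.Point, B.IsAffinePoint p 0 0 ∧ B.IsPointAtInfinity q ∧
        addOrderOf (pointClass p q) = 2 * γ + 9 ∧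
        IsMultiplicationProfile q (pointClass p q)
          (profileDeterminedBy γ (2 * γ + 9) [γ, γ, γ])) ∧
    (4 ≤ γ → ∃ B : HyperellipticCurve k, IsVariantCurve B γ ∧
      ∃ p q : B.Point, B.IsAffinePoint p 0 0 ∧ B.IsPointAtInfinity q ∧
        IsDivisorOf ((2 * γ + 7) • (Finsupp.single p 1 - Finsupp.single q 1))
          ((3 * B.x ^ 3 + 4) * B.x ^ (γ - 1) + (B.x ^ 3 + 4) * B.y) ∧
        addOrderOf (pointClass p q) = 2 * γ + 7 ∧
        IsMultiplicationProfile q (pointClass p q)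
          (profileDeterminedBy γ (2 * γ + 7) [γ - 1, γ])) := by
  refine ⟨fun hγ => ?_, fun hγ => ?_, fun hγ => ?_⟩
  · have hφ : (flynnPhi k 4).natDegree ≤ 3 := by rw [flynnPhi_four]; compute_degree
    have hθ : (flynnTheta k 4).natDegree ≤ 3 := by rw [flynnTheta_four]; compute_degree
    obtain ⟨B, hB⟩ : ∃ B : HyperellipticCurve k, IsFlynnCurve B γ 4 1 :=
      ⟨.ofThetaPhi γ _ _ (by omega) (hφ.trans hγ) (hθ.trans hγ) (separable_flynn_four hγ),
        rfl, (mul_one _).symm, rfl⟩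
    obtain rfl := hB.1
    have hT := HyperellipticCurve.torsionPresentation_flynn_four hγ hB
    obtain ⟨p, hp⟩ := hT.onCurve.exists_isAffinePoint
    obtain ⟨q, hq⟩ := B.exists_isPointAtInfinity
    exact ⟨B, hB, p, q, hp, hq, HyperellipticCurve.profile_flynn_four hγ hB hp hq hT⟩
  · have hφ : (flynnPhi k 5).natDegree ≤ 4 := by rw [flynnPhi_five]; compute_degree
    have hθ : (flynnTheta k 5).natDegree ≤ 4 := by rw [flynnTheta_five]; compute_degree
    obtain ⟨B, hB⟩ : ∃ B : HyperellipticCurve k, IsFlynnCurve B γ 5 1 :=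
      ⟨.ofThetaPhi γ _ _ (by omega) (hφ.trans hγ) (hθ.trans hγ) (separable_flynn_five hγ),
        rfl, (mul_one _).symm, rfl⟩
    obtain rfl := hB.1
    have hT := HyperellipticCurve.torsionPresentation_flynn_five hγ hB
    obtain ⟨p, hp⟩ := hT.onCurve.exists_isAffinePoint
    obtain ⟨q, hq⟩ := B.exists_isPointAtInfinity
    exact ⟨B, hB, p, q, hp, hq, HyperellipticCurve.profile_flynn_five hγ hB hp hq hT⟩
  · obtain ⟨B, hB⟩ : ∃ B : HyperellipticCurve k, IsVariantCurve B γ :=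
      ⟨.variantCurve γ hγ, rfl, rfl, rfl⟩
    obtain rfl := hB.1
    have hT := HyperellipticCurve.torsionPresentation_variant hγ hB
    obtain ⟨p, hp⟩ := hT.onCurve.exists_isAffinePoint
    obtain ⟨q, hq⟩ := B.exists_isPointAtInfinity
    refine ⟨B, hB, p, q, hp, hq, ?_, HyperellipticCurve.profile_variant hγ hB.2.1 hp hq hT⟩
    have h := hT.isDivisorOf hp hq
    rw [show 2 * (B.genus - 1) + 9 = 2 * B.genus + 7 by omega] at h
    convert h using 1
    rw [HyperellipticCurve.fn, hB.2.1]
    simp only [map_add, map_mul, map_neg, map_pow, aeval_X, map_ofNat (aeval B.x) 3,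
      map_ofNat (aeval B.x) 4]
    rw [neg_mul, neg_neg]
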